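/- Let $V:\mathbb R^2\to\mathbb R$ be measurable and not almost everywhere zero. Put $\langle x\rangle=(1+|x|^2)^{1/2}$, $w(x)=\log^2(2+|x|)$, $v=|V|^{1/2}$, $U=1$ where $V\ge 0$ and $U=-1$ where $V<0$. Let $0<\alpha<\frac14$ and suppose that for some $\delta>0$ and $A$ we have $v(x)\le A\langle x\rangle^{-\frac32-\alpha-\delta}$ for all $x$. On $L^2(\mathbb R^2)$ let $P=\|V\|_1^{-1}v\langle\cdot,v\rangle$, $Q=1-P$, $T=U+vG_0v$, where $G_0$ is the integral operator with kernel $-\frac1{2\pi}\log|x-y|$. Assume that zero is a regular point of the spectrum of $-\Delta+V$, i.e. that $QTQ$ is invertible on $QL^2$, and let $D_0=(QTQ)^{-1}$ on $QL^2$. Let $$S=P-PTQD_0Q-QD_0QTP+QD_0QTPTQD_0Q,$$ $$h_\pm(\lambda)=\|V\|_1\Big(\pm\frac i4-\frac1{2\pi}\log\frac\lambda2-\frac{\gamma}{2\pi}\Big)+c,\qquad c=\mathrm{Tr}\,(PTP-PTQD_0QTP),$$ where $\gamma$ is the Euler–Mascheroni constant, and let $$R_0^\pm(\lambda^2)(x,y)=\pm\frac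 i4\big(J_0\pm iY_0\big)(\lambda|x-y|)$$ be the kernel of the free resolvent $(-\Delta-(\lambda^2\pm i0))^{-1}$. Then $S$ has a square integrable kernel $S(x_1,y_1)$, and there is $\lambda_0>0$ such that the following holds for every $0<\lambda_1\le\lambda_0$, every even smooth $\chi:\mathbb R\to\mathbb R$ supported in $[-\lambda_1,\lambda_1]$ with $\chi(r)=1$ for $|r|<\lambda_1/2$, and every $\varepsilon>0$. With $$\mathcal R^\pm=\frac{R_0^\pm(\lambda^2)(x,x_1)\,R_0^\pm(\lambda^2)(y_1,y)}{h_\pm(\lambda)},$$ the iterated integral $$I(t,x,y)=\int_{\mathbb R^4}\int_0^\infty e^{it\lambda^2}\lambda\,\chi(\lambda)\,[\mathcal R^--\mathcal R^+]\,v(x_1)S(x_1,y_1)v(y_1)\,d\lambda\,dx_1\,dy_1$$ converges absolutely (the inner integral for almost every $(x_1,y_1)$, and then the outer one) for all $x,y\in\mathbb R^2$ and $t>2$, and there is a constant $C$, independent of $x$, $y$ and $t$, such that for all $x,y\in\mathbb R^2$ and $t>2$ $$\Big|I(t,x,y)-\frac1{4t}\Big|\le C\left(\frac{\sqrt{w(x)w(y)}}{t\log^2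 t}+\frac{\langle x\rangle^{\frac12+\alpha+\varepsilon}\langle y\rangle^{\frac12+\alpha+\varepsilon}}{t^{1+\alpha}}\right).$$ -/

import Mathlib

open MeasureTheory Set
open scoped ContDiff

noncomputable section

namespace PlanarSchrodinger

/-- The Euclidean plane. -/
abbrev Plane : Type := EuclideanSpace ℝ (Fin 2)

/-- The complex Hilbert space `L²(ℝ²)`. -/
abbrev L2 : Type := Lp ℂ 2 (volume : Measure Plane)

/-- The Japanese bracket `⟨x⟩ = (1 + |x|²)^{1/2}`. -/
def bracket (x : Plane) : ℝ := Real.sqrt (1 + ‖x‖ ^ 2)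

/-- The logarithmic weight `w(x) = log²(2 + |x|)`. -/
def weight (x : Plane) : ℝ := Real.log (2 + ‖x‖) ^ 2

/-! ### Bessel functions of order zero and the free resolvent -/

/-- The Bessel function `J₀(z) = ∑ₖ (-1)ᵏ (z²/4)ᵏ / (k!)²`. -/
def besselJ0 (z : ℝ) : ℝ :=
  ∑' k : ℕ, (-1) ^ k * (z ^ 2 / 4) ^ k / (k.factorial : ℝ) ^ 2

/-- The Bessel function of the second kind, for `z > 0`:
`Y₀(z) = (2/π) (log(z/2) + γ) J₀(z) + (2/π) ∑ₖ (-1)ᵏ⁺¹ Hₖ (z²/4)ᵏ / (k!)²`, where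
`Hₖ = 1 + 1/2 + ⋯ + 1/k` and `γ` is the Euler-Mascheroni constant. -/
def besselY0 (z : ℝ) : ℝ :=
  2 / Real.pi * (Real.log (z / 2) + Real.eulerMascheroniConstant) * besselJ0 z
    + 2 / Real.pi *
      ∑' k : ℕ, (-1) ^ (k + 1) * (harmonic k : ℝ) * (z ^ 2 / 4) ^ k / (k.factorial : ℝ) ^ 2

/-- The Hankel functions `H₀^± = J₀ ± i Y₀`; here and below `s = 1` stands for the sign `+` and
`s = -1` for the sign `-`. -/
def hankel0 (s : ℝ) (z : ℝ) : ℂ := besselJ0 z + s * Complex.I * besselY0 z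

/-- The kernel `R₀^±(lam²)(x, y) = ± (i/4) H₀^±(lam |x - y|)` of the limiting free resolvent
`(-Δ - (lam² ± i0))⁻¹` in the plane, for `lam > 0`. -/
def freeResolvent (s lam : ℝ) (x y : Plane) : ℂ :=
  s * (Complex.I / 4) * hankel0 s (lam * ‖x - y‖)

/-- The kernel `-(1/2π) log |x - y|` of the operator `G₀`. -/
def G0 (x y : Plane) : ℝ := -(1 / (2 * Real.pi)) * Real.log ‖x - y‖

/-! ### Operators on `L²` -/

/-- The bounded operator `A` on `L²` given by the formula `A f = F f` almost everywhere, for all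
`f` in `L²`. It is unique if it exists; if there is none, the value is `0`. -/
def opOfFormula (F : L2 → Plane → ℂ) : L2 →L[ℂ] L2 :=
  open Classical in
  if h : ∃ A : L2 →L[ℂ] L2, ∀ f : L2, (A f : Plane → ℂ) =ᵐ[volume] F f then h.choose else 0

/-- `K` is the (square integrable) integral kernel of the bounded operator `A`. -/
def IsKernel (A : L2 →L[ℂ] L2) (K : Plane × Plane → ℂ) : Prop :=
  MemLp K 2 volume ∧
    ∀ f : L2, (A f : Plane → ℂ) =ᵐ[volume] fun x => ∫ y, K (x, y) * f y

/-- `‖V‖₁`. -/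
def normOne (V : Plane → ℝ) : ℝ := ∫ x, |V x|

/-- `U = 1` where `V ≥ 0` and `U = -1` where `V < 0`. -/
def signU (V : Plane → ℝ) (x : Plane) : ℝ :=
  open Classical in if 0 ≤ V x then 1 else -1

/-- `v = |V|^{1/2}`. -/
def vRoot (V : Plane → ℝ) (x : Plane) : ℝ := Real.sqrt |V x|

/-- The operator `T = U + v G₀ v`. -/
def opT (V : Plane → ℝ) : L2 →L[ℂ] L2 :=
  opOfFormula fun f x => signU V x * f x + vRoot V x * ∫ y, (G0 x y : ℂ) * (vRoot V y * f y)

/-- The orthogonal projection `P = v ⟨·, v⟩ ‖V‖₁⁻¹` onto the span of `v`. -/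
def opP (V : Plane → ℝ) : L2 →L[ℂ] L2 :=
  opOfFormula fun f x => vRoot V x * (∫ y, f y * (vRoot V y : ℂ)) / normOne V

/-- `Q = 1 - P`. -/
def opQ (V : Plane → ℝ) : L2 →L[ℂ] L2 := ContinuousLinearMap.id ℂ L2 - opP V

/-- The space `P L²`. -/
def rangeP (V : Plane → ℝ) : Submodule ℂ L2 := LinearMap.range (opP V).toLinearMap

/-- The space `Q L²`. -/
def rangeQ (V : Plane → ℝ) : Submodule ℂ L2 := LinearMap.range (opQ V).toLinearMap

/-- `P` as a map onto `P L²`. -/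
def toRangeP (V : Plane → ℝ) : L2 →L[ℂ] rangeP V :=
  (opP V).codRestrict (rangeP V) fun f => LinearMap.mem_range_self (opP V).toLinearMap f

/-- `Q` as a map onto `Q L²`. -/
def toRangeQ (V : Plane → ℝ) : L2 →L[ℂ] rangeQ V :=
  (opQ V).codRestrict (rangeQ V) fun f => LinearMap.mem_range_self (opQ V).toLinearMap f

/-- `Q T Q` as an operator on `Q L²`. -/
def opQTQ (V : Plane → ℝ) : rangeQ V →L[ℂ] rangeQ V :=
  toRangeQ V ∘L opT V ∘L opQ V ∘L (rangeQ V).subtypeL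

/-- Zero is a regular point of the spectrum of `H = -Δ + V`: the operator `Q T Q` is invertible
on `Q L²`. -/
def ZeroIsRegular (V : Plane → ℝ) : Prop := IsUnit (opQTQ V)

/-- `D₀ = (Q T Q)⁻¹` on `Q L²`. -/
def opD0 (V : Plane → ℝ) : rangeQ V →L[ℂ] rangeQ V := Ring.inverse (opQTQ V)

/-- `Q D₀ Q` as an operator on `L²`. -/
def opQD0Q (V : Plane → ℝ) : L2 →L[ℂ] L2 :=
  opQ V ∘L (rangeQ V).subtypeL ∘L opD0 V ∘L toRangeQ V

/-- The sum of the four blocks of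
`S = [[P, -P T Q D₀ Q], [-Q D₀ Q T P, Q D₀ Q T P T Q D₀ Q]]`. -/
def opS (V : Plane → ℝ) : L2 →L[ℂ] L2 :=
  opP V - opP V ∘L opT V ∘L opQD0Q V - opQD0Q V ∘L opT V ∘L opP V
    + opQD0Q V ∘L opT V ∘L opP V ∘L opT V ∘L opQD0Q V

/-- The constant `c = Tr (P T P - P T Q D₀ Q T P)`, the trace being computed on the
one-dimensional space `P L²`, which contains the range of this operator. -/
def constC (V : Plane → ℝ) : ℂ :=
  LinearMap.trace ℂ (rangeP V)
    (toRangeP V ∘L (opT V - opT V ∘L opQD0Q V ∘L opT V) ∘L opP V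
      ∘L (rangeP V).subtypeL).toLinearMap

/-- `g^±(lam) = ‖V‖₁ (± i/4 - (1/2π) log(lam/2) - γ/(2π))`. -/
def gFun (V : Plane → ℝ) (s lam : ℝ) : ℂ :=
  normOne V * (s * (Complex.I / 4) - 1 / (2 * Real.pi) * Real.log (lam / 2)
    - Real.eulerMascheroniConstant / (2 * Real.pi))

/-- `h_±(lam) = g^±(lam) + c`. -/
def hFun (V : Plane → ℝ) (s lam : ℝ) : ℂ := gFun V s lam + constC V

/-- `𝓡^± = R₀^±(lam²)(x, x₁) R₀^±(lam²)(y₁, y) / h_±(lam)`. -/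
def calR (V : Plane → ℝ) (s lam : ℝ) (x x₁ y₁ y : Plane) : ℂ :=
  freeResolvent s lam x x₁ * freeResolvent s lam y₁ y / hFun V s lam

/-- A smooth even cut-off function supported in `[-lam₁, lam₁]` and equal to one on
`(-lam₁/2, lam₁/2)`. -/
structure IsCutoff (lam₁ : ℝ) (χ : ℝ → ℝ) : Prop where
  smooth : ContDiff ℝ ∞ χ
  even : ∀ r, χ (-r) = χ r
  support_subset : Function.support χ ⊆ Icc (-lam₁) lam₁
  eq_one : ∀ r, |r| < lam₁ / 2 → χ r = 1

/-- The integrand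
`e^{it lam²} lam χ(lam) [𝓡⁻ - 𝓡⁺] v(x₁) S(x₁, y₁) v(y₁)`, where `K` is the kernel of `S` and
`p = (x₁, y₁)`. -/
def stoneIntegrand (V : Plane → ℝ) (χ : ℝ → ℝ) (K : Plane × Plane → ℂ) (t : ℝ) (x y : Plane)
    (p : Plane × Plane) (lam : ℝ) : ℂ :=
  Complex.exp (Complex.I * t * lam ^ 2) * lam * χ lam
    * (calR V (-1) lam x p.1 p.2 y - calR V 1 lam x p.1 p.2 y)
    * vRoot V p.1 * K p * vRoot V p.2

/-- The inner integral over `0 < lam < ∞`. -/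
def stoneInner (V : Plane → ℝ) (χ : ℝ → ℝ) (K : Plane × Plane → ℂ) (t : ℝ) (x y : Plane)
    (p : Plane × Plane) : ℂ :=
  ∫ lam in Ioi (0 : ℝ), stoneIntegrand V χ K t x y p lam

end PlanarSchrodinger

end

namespace PlanarSchrodinger

/-! ### Entire power series -/

/-! Write `N = ‖V‖₁`, `r₁ = |x - x₁|`, `r₂ = |y₁ - y|`. Since `log (λr) = log λ + log r`, each free
resolvent equals `h_±(λ)/N + G(r) + E_±(λr)`, where `G` depends neither on `λ` nor on the sign and
`E_±(z)` is `O(z^{1/2})` (`freeResolvent_eq`). Multiplying two such expansions and dividing by `h_±`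
gives `h_±/N² + (G₁ + G₂)/N + G₁G₂/h_±` plus terms that contain some `E`. Because `h_+ - h_- =
iN/2`, the difference `𝓡⁻ - 𝓡⁺` (`calR_sub_eq`) consists of the constant `-i/(2N)`, a term `G₁G₂
(iN/2)/(h_- h_+)` of size `1/log² λ`, and the `E`-terms; the middle summands `(G₁ + G₂)/N` cancel.

The factor `λ e^{itλ²}` is an exact derivative, so an amplitude `F` contributes `-F(0)/(2it)` and an
integral of `e^{itλ²} F'`. That integral is estimated trivially on `(0, ρ)` and by another
integration by parts beyond `ρ`, with `ρ` chosen according to the size of `F`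
(`norm_integral_phase_le`). The constant amplitude produces `1/(4tN)`, the logarithmic one `O(1/(t
log² t))`, and the `E`-terms `O(t^{-1-α} (2 + r₁ + r₂)^α)`, all with explicit weights in `r₁`, `r₂`
(`exists_resolventIntegrand_estimate`). The bounds on `E` and two derivatives come from power series
for `z ≤ 1` and from a monotone energy of Bessel's equation for `z ≥ 1`
(`exists_abs_le_div_sqrt_of_bessel_ode`).

It remains to integrate against `v(x₁) S(x₁, y₁) v(y₁)`. The operator `S` has rank at most one, so
it has an `L²` kernel, and `Q D₀ Q` kills `v` and has range orthogonal to `v`; hence `∬ v S v = ⟨Sv,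
v⟩ = N` (`integral_vRoot_kernel_vRoot`), which turns `1/(4tN)` into `1/(4t)`. The errors are bounded
by Cauchy–Schwarz (`integral_kernel_weight_le`): the growth in `x` is that of the `L²` norm of `v`
times the weight centred at `x`, and this norm is finite because `v` decays faster than
`⟨x⟩^{-3/2-α}`. -/

/-- The sum of the power series with coefficients `a`. -/
noncomputable def entireSeries (a : ℕ → ℝ) (s : ℝ) : ℝ := ∑' k, a k * s ^ k

/-- The coefficients of the derivative of a power series. -/
def derivCoeff (a : ℕ → ℝ) (k : ℕ) : ℝ := (k + 1) * a (k + 1)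

/-- The bound `1/k!` survives differentiation because `(k+1)/(k+1)! = 1/k!`. One hypothesis on the
coefficients therefore serves a series and all its derivatives. -/
lemma abs_derivCoeff_le {a : ℕ → ℝ} (ha : ∀ k, |a k| ≤ 1 / (k.factorial : ℝ)) (k : ℕ) :
    |derivCoeff a k| ≤ 1 / (k.factorial : ℝ) := by
  unfold derivCoeff
  have h := ha (k + 1)
  rw [Nat.factorial_succ] at h
  push_cast at h
  have hk : (0 : ℝ) < k + 1 := by positivity
  rw [abs_mul, abs_of_pos hk]
  calc ((k : ℝ) + 1) * |a (k + 1)| ≤ (k + 1) * (1 / ((k + 1) * (k.factorial : ℝ))) := by gcongr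
    _ = 1 / (k.factorial : ℝ) := by field_simp

lemma summable_entireSeries {a : ℕ → ℝ} (ha : ∀ k, |a k| ≤ 1 / (k.factorial : ℝ)) (s : ℝ) :
    Summable fun k => a k * s ^ k := by
  refine Summable.of_norm_bounded (g := fun k => |s| ^ k / (k.factorial : ℝ))
    (Real.summable_pow_div_factorial |s|) fun k => ?_
  rw [norm_mul, norm_pow, Real.norm_eq_abs, Real.norm_eq_abs]
  calc |a k| * |s| ^ k ≤ 1 / (k.factorial : ℝ) * |s| ^ k := by gcongr; exact ha k
    _ = |s| ^ k / (k.factorial : ℝ) := by ring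

lemma abs_entireSeries_le {a : ℕ → ℝ} (ha : ∀ k, |a k| ≤ 1 / (k.factorial : ℝ)) (s : ℝ) :
    |entireSeries a s| ≤ Real.exp |s| := by
  have h : HasSum (fun k : ℕ => |s| ^ k / (k.factorial : ℝ)) (Real.exp |s|) := by
    have := NormedSpace.expSeries_div_hasSum_exp (𝔸 := ℝ) |s|
    rwa [← Real.exp_eq_exp_ℝ] at this
  have := tsum_of_norm_bounded (f := fun k => a k * s ^ k) h fun k => by
    rw [norm_mul, norm_pow, Real.norm_eq_abs, Real.norm_eq_abs]
    calc |a k| * |s| ^ k ≤ 1 / (k.factorial : ℝ) * |s| ^ k := by gcongr; exact ha k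
      _ = |s| ^ k / (k.factorial : ℝ) := by ring
  simpa [entireSeries] using this

lemma entireSeries_eq_add {a : ℕ → ℝ} (ha : ∀ k, |a k| ≤ 1 / (k.factorial : ℝ)) (s : ℝ) :
    entireSeries a s = a 0 + s * entireSeries (fun k => a (k + 1)) s := by
  unfold entireSeries
  rw [(summable_entireSeries ha s).tsum_eq_zero_add, ← tsum_mul_left]
  simp only [pow_zero, mul_one]
  congr 2
  ext k
  ring

lemma abs_shift_le {a : ℕ → ℝ} (ha : ∀ k, |a k| ≤ 1 / (k.factorial : ℝ)) (k : ℕ) :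
    |a (k + 1)| ≤ 1 / (k.factorial : ℝ) := by
  refine (ha (k + 1)).trans ?_
  have : k.factorial ≤ (k + 1).factorial := Nat.factorial_le (Nat.le_succ k)
  gcongr

lemma hasDerivAt_entireSeries {a : ℕ → ℝ} (ha : ∀ k, |a k| ≤ 1 / (k.factorial : ℝ)) (s : ℝ) :
    HasDerivAt (entireSeries a) (entireSeries (derivCoeff a) s) s := by
  -- Any radius exceeding `|s|` would do: termwise differentiation takes place on a ball that
  -- contains both `s` and the base point `0`.
  set r : ℝ := |s| + 1
  have hr : 0 ≤ r := by positivity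
  set u : ℕ → ℝ := fun k => |a k| * (k * r ^ (k - 1))
  have hu : Summable u := by
    rw [← summable_nat_add_iff 1]
    refine Summable.of_norm_bounded (g := fun k => r ^ k / (k.factorial : ℝ))
      (Real.summable_pow_div_factorial r) fun k => ?_
    have h := abs_derivCoeff_le ha k
    have hk : (0 : ℝ) < k + 1 := by positivity
    rw [derivCoeff, abs_mul, abs_of_pos hk] at h
    simp only [u, Nat.add_sub_cancel]
    push_cast
    rw [Real.norm_of_nonneg (by positivity)]
    calc |a (k + 1)| * ((k + 1) * r ^ k) = ((k + 1) * |a (k + 1)|) * r ^ k := by ring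
      _ ≤ 1 / (k.factorial : ℝ) * r ^ k := by gcongr
      _ = r ^ k / (k.factorial : ℝ) := by ring
  have hs : s ∈ Metric.ball (0 : ℝ) r := by simp [r]
  have key := hasDerivAt_tsum_of_isPreconnected (𝕜 := ℝ) (F := ℝ)
    (g := fun k y => a k * y ^ k) (g' := fun k y => a k * (k * y ^ (k - 1)))
    (y₀ := 0) (y := s) (t := Metric.ball 0 r) hu Metric.isOpen_ball
    (convex_ball 0 r).isPreconnected
    (fun k y _ => (hasDerivAt_pow k y).const_mul (a k))
    (fun k y hy => by
      have hy' : |y| ≤ r := by simpa using (Metric.mem_ball.mp hy).le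
      simp only [u, norm_mul, norm_pow, Real.norm_eq_abs, Nat.abs_cast]
      gcongr)
    (by simp [r]; positivity) (summable_entireSeries ha 0) hs
  refine key.congr_deriv ?_
  have hsum : Summable fun k => a k * (k * s ^ (k - 1)) := by
    refine Summable.of_norm_bounded hu fun k => ?_
    simp only [u, norm_mul, norm_pow, Real.norm_eq_abs, Nat.abs_cast]
    gcongr
    simp [r]
  rw [hsum.tsum_eq_zero_add]
  simp only [entireSeries, derivCoeff]
  simp only [Nat.cast_zero, zero_mul, mul_zero, zero_add, Nat.add_sub_cancel]
  congr 1
  ext k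
  push_cast
  ring

/-! ### The Bessel functions of order zero -/

/-- The coefficients of `J₀` as a power series in `z² / 4`. -/
noncomputable def coeffJ (k : ℕ) : ℝ := (-1) ^ k / (k.factorial : ℝ) ^ 2

/-- The coefficients of the regular part of `Y₀` as a power series in `z² / 4`. -/
noncomputable def coeffY (k : ℕ) : ℝ :=
  (-1) ^ (k + 1) * (harmonic k : ℝ) / (k.factorial : ℝ) ^ 2

lemma abs_coeffJ_le (k : ℕ) : |coeffJ k| ≤ 1 / (k.factorial : ℝ) := by
  have h : (1 : ℝ) ≤ k.factorial := by exact_mod_cast Nat.factorial_pos k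
  rw [coeffJ, abs_div, abs_pow, abs_neg, abs_one, one_pow, abs_of_nonneg (by positivity)]
  gcongr
  nlinarith

lemma harmonic_le_natCast (k : ℕ) : (harmonic k : ℝ) ≤ k := by
  induction k with
  | zero => simp
  | succ n ih =>
    rw [harmonic_succ]
    push_cast
    have : ((n : ℝ) + 1)⁻¹ ≤ 1 := inv_le_one_of_one_le₀ (by linarith [n.cast_nonneg (α := ℝ)])
    linarith

lemma harmonic_cast_nonneg (k : ℕ) : (0 : ℝ) ≤ harmonic k := by
  simp only [harmonic, Rat.cast_sum]
  exact Finset.sum_nonneg fun i _ => by push_cast; positivity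

/-- The chain `H_k ≤ k ≤ k!` uses up one of the two factorials in the denominator and leaves the
other. -/
lemma abs_coeffY_le (k : ℕ) : |coeffY k| ≤ 1 / (k.factorial : ℝ) := by
  have h : (0 : ℝ) < k.factorial := by exact_mod_cast Nat.factorial_pos k
  have hk : (harmonic k : ℝ) ≤ k.factorial :=
    (harmonic_le_natCast k).trans (by exact_mod_cast Nat.self_le_factorial k)
  rw [coeffY, abs_div, abs_mul, abs_pow, abs_neg, abs_one, one_pow, one_mul,
    abs_of_nonneg (harmonic_cast_nonneg k), abs_of_nonneg (by positivity),
    div_le_div_iff₀ (by positivity) h]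
  nlinarith

lemma besselJ0_eq (z : ℝ) : besselJ0 z = entireSeries coeffJ (z ^ 2 / 4) := by
  unfold besselJ0 entireSeries coeffJ
  congr 1
  ext k
  ring

/-- The regular part of `Y₀`. -/
noncomputable def besselYReg (z : ℝ) : ℝ := entireSeries coeffY (z ^ 2 / 4)

lemma besselY0_eq (z : ℝ) :
    besselY0 z = 2 / Real.pi * (Real.log (z / 2) + Real.eulerMascheroniConstant) * besselJ0 z
      + 2 / Real.pi * besselYReg z := by
  unfold besselY0 besselYReg entireSeries coeffY
  congr 3
  ext k
  ring

/-- The Euler operator `s d/ds` multiplies the `k`-th coefficient by `k`, so the differential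
equations below can be verified coefficient by coefficient. -/
lemma hasSum_mul_entireSeries_derivCoeff {a : ℕ → ℝ} (ha : ∀ k, |a k| ≤ 1 / (k.factorial : ℝ))
    (s : ℝ) :
    HasSum (fun k : ℕ => (k : ℝ) * a k * s ^ k) (s * entireSeries (derivCoeff a) s) := by
  have h := ((summable_entireSeries (abs_derivCoeff_le ha) s).hasSum).mul_left s
  rw [← hasSum_nat_add_iff' 1]
  simp only [Finset.range_one, Finset.sum_singleton, Nat.cast_zero, zero_mul, sub_zero]
  refine h.congr_fun fun k => ?_
  rw [derivCoeff]
  push_cast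
  ring

/-- The differential equation `s F'' + F' + F = 0` of `F(z² / 4) = J₀(z)`. -/
lemma entireSeries_coeffJ_ode (s : ℝ) :
    s * entireSeries (derivCoeff (derivCoeff coeffJ)) s + entireSeries (derivCoeff coeffJ) s
      + entireSeries coeffJ s = 0 := by
  have h := ((hasSum_mul_entireSeries_derivCoeff (abs_derivCoeff_le abs_coeffJ_le) s).add
    (summable_entireSeries (abs_derivCoeff_le abs_coeffJ_le) s).hasSum).add
    (summable_entireSeries abs_coeffJ_le s).hasSum
  refine h.unique ?_
  convert hasSum_zero with k
  simp only [derivCoeff, coeffJ, Nat.factorial_succ]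
  have : (k.factorial : ℝ) ≠ 0 := by exact_mod_cast Nat.factorial_ne_zero k
  push_cast
  field_simp
  ring

/-- The differential equation `s G'' + G' + G = -F'` of the regular part of `Y₀`. -/
lemma entireSeries_coeffY_ode (s : ℝ) :
    s * entireSeries (derivCoeff (derivCoeff coeffY)) s + entireSeries (derivCoeff coeffY) s
      + entireSeries coeffY s = - entireSeries (derivCoeff coeffJ) s := by
  have h := (((hasSum_mul_entireSeries_derivCoeff (abs_derivCoeff_le abs_coeffY_le) s).add
    (summable_entireSeries (abs_derivCoeff_le abs_coeffY_le) s).hasSum).add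
    (summable_entireSeries abs_coeffY_le s).hasSum).add
    (summable_entireSeries (abs_derivCoeff_le abs_coeffJ_le) s).hasSum
  rw [← sub_eq_zero, sub_neg_eq_add]
  refine h.unique ?_
  convert hasSum_zero with k
  simp only [derivCoeff, coeffY, coeffJ, Nat.factorial_succ, harmonic_succ]
  have : (k.factorial : ℝ) ≠ 0 := by exact_mod_cast Nat.factorial_ne_zero k
  push_cast
  field_simp
  ring

/-- The derivative of `J₀`. -/
noncomputable def besselJ0Deriv (z : ℝ) : ℝ := z / 2 * entireSeries (derivCoeff coeffJ) (z ^ 2 / 4)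

/-- The derivative of the regular part of `Y₀`. -/
noncomputable def besselYRegDeriv (z : ℝ) : ℝ :=
  z / 2 * entireSeries (derivCoeff coeffY) (z ^ 2 / 4)

lemma hasDerivAt_entireSeries_sq {a : ℕ → ℝ} (ha : ∀ k, |a k| ≤ 1 / (k.factorial : ℝ)) (z : ℝ) :
    HasDerivAt (fun z => entireSeries a (z ^ 2 / 4))
      (z / 2 * entireSeries (derivCoeff a) (z ^ 2 / 4)) z := by
  have h1 : HasDerivAt (fun z : ℝ => z ^ 2 / 4) (z / 2) z := by
    refine ((hasDerivAt_pow 2 z).div_const 4).congr_deriv ?_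
    push_cast
    ring
  refine ((hasDerivAt_entireSeries ha (z ^ 2 / 4)).comp z h1).congr_deriv ?_
  ring

lemma hasDerivAt_besselJ0 (z : ℝ) : HasDerivAt besselJ0 (besselJ0Deriv z) z := by
  have h := hasDerivAt_entireSeries_sq abs_coeffJ_le z
  exact h.congr_of_eventuallyEq (Filter.Eventually.of_forall besselJ0_eq)

lemma hasDerivAt_besselYReg (z : ℝ) : HasDerivAt besselYReg (besselYRegDeriv z) z :=
  hasDerivAt_entireSeries_sq abs_coeffY_le z

lemma hasDerivAt_besselJ0Deriv {z : ℝ} (hz : 0 < z) :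
    HasDerivAt besselJ0Deriv (-besselJ0 z - besselJ0Deriv z / z) z := by
  have h := ((hasDerivAt_id z).div_const 2).mul
    (hasDerivAt_entireSeries_sq (abs_derivCoeff_le abs_coeffJ_le) z)
  refine h.congr_deriv ?_
  have ode := entireSeries_coeffJ_ode (z ^ 2 / 4)
  rw [besselJ0_eq, besselJ0Deriv]
  simp only [id]
  field_simp
  linear_combination 4 * ode

lemma hasDerivAt_besselYRegDeriv {z : ℝ} (hz : 0 < z) :
    HasDerivAt besselYRegDeriv
      (-besselYReg z - besselYRegDeriv z / z - 2 * besselJ0Deriv z / z) z := by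
  have h := ((hasDerivAt_id z).div_const 2).mul
    (hasDerivAt_entireSeries_sq (abs_derivCoeff_le abs_coeffY_le) z)
  refine h.congr_deriv ?_
  have ode := entireSeries_coeffY_ode (z ^ 2 / 4)
  rw [besselYReg, besselYRegDeriv, besselJ0Deriv]
  simp only [id]
  field_simp
  linear_combination 4 * ode

/-- The derivative of `Y₀`. -/
noncomputable def besselY0Deriv (z : ℝ) : ℝ :=
  2 / Real.pi * (besselJ0 z / z
    + (Real.log (z / 2) + Real.eulerMascheroniConstant) * besselJ0Deriv z + besselYRegDeriv z)

lemma hasDerivAt_log_half {z : ℝ} (hz : 0 < z) :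
    HasDerivAt (fun z => Real.log (z / 2) + Real.eulerMascheroniConstant) (1 / z) z := by
  have h := (((hasDerivAt_id z).div_const 2).log (by simpa using hz.ne')).add_const
    Real.eulerMascheroniConstant
  refine h.congr_deriv ?_
  simp only [id]
  field_simp

lemma hasDerivAt_besselY0 {z : ℝ} (hz : 0 < z) : HasDerivAt besselY0 (besselY0Deriv z) z := by
  have h := (((hasDerivAt_log_half hz).mul (hasDerivAt_besselJ0 z)).add
    (hasDerivAt_besselYReg z)).const_mul (2 / Real.pi)
  refine (h.congr_of_eventuallyEq (Filter.Eventually.of_forall fun x => ?_)).congr_deriv ?_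
  · rw [besselY0_eq]
    simp only [Pi.add_apply, Pi.mul_apply]
    ring
  · rw [besselY0Deriv]
    ring

/-- The product of the logarithm with `J₀` misses Bessel's equation by `2 J₀'/z`, and the regular
part misses it by the opposite amount. -/
lemma hasDerivAt_besselY0Deriv {z : ℝ} (hz : 0 < z) :
    HasDerivAt besselY0Deriv (-besselY0 z - besselY0Deriv z / z) z := by
  have h := ((((hasDerivAt_besselJ0 z).div (hasDerivAt_id z) hz.ne').add
    ((hasDerivAt_log_half hz).mul (hasDerivAt_besselJ0Deriv hz))).add
    (hasDerivAt_besselYRegDeriv hz)).const_mul (2 / Real.pi)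
  refine h.congr_deriv ?_
  rw [besselY0_eq, besselY0Deriv]
  simp only [id]
  have := Real.pi_pos
  field_simp
  ring

/-! ### Decay at infinity and behaviour at the origin -/

/-- A solution of Bessel's equation of order zero and its derivative are `O(z^{-1/2})`. -/
lemma exists_abs_le_div_sqrt_of_bessel_ode {u u' : ℝ → ℝ}
    (hu : ∀ z, 0 < z → HasDerivAt u (u' z) z)
    (hu' : ∀ z, 0 < z → HasDerivAt u' (-u z - u' z / z) z) :
    ∃ C, 0 ≤ C ∧ ∀ z, 1 ≤ z → |u z| ≤ C / √z ∧ |u' z| ≤ C / √z := by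
  -- A corrected energy: the terms `u u'` and `u²/(2z)` are chosen so that Bessel's equation leaves
  -- only `e' = -u²/(2z²) ≤ 0`. For `z ≥ 1` the cross term costs at most half of `z (u² + u'²)`, so
  -- `e 1` controls that quantity.
  set e : ℝ → ℝ := fun z => z * (u z ^ 2 + u' z ^ 2) + u z * u' z + u z ^ 2 / (2 * z) with he
  have hde : ∀ z, 0 < z → HasDerivAt e (-(u z ^ 2 / (2 * z ^ 2))) z := by
    intro z hz
    have h := (((hasDerivAt_id z).mul (((hu z hz).pow 2).add ((hu' z hz).pow 2))).add
      ((hu z hz).mul (hu' z hz))).add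
      (((hu z hz).pow 2).div ((hasDerivAt_id z).const_mul 2) (by simpa using hz.ne'))
    refine h.congr_deriv ?_
    simp only [id, Pi.add_apply, Pi.pow_apply]
    field_simp
    ring
  have hanti : AntitoneOn e (Ici 1) := by
    refine antitoneOn_of_deriv_nonpos (convex_Ici 1)
      (fun z hz => (hde z (by have := mem_Ici.mp hz; linarith)).continuousAt.continuousWithinAt)
      (fun z hz => ?_) fun z hz => ?_
    · rw [interior_Ici] at hz
      exact (hde z (by have := mem_Ioi.mp hz; linarith)).differentiableAt.differentiableWithinAt
    · rw [interior_Ici] at hz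
      rw [(hde z (by have := mem_Ioi.mp hz; linarith)).deriv]
      have : 0 ≤ u z ^ 2 / (2 * z ^ 2) := by positivity
      linarith
  have hle : ∀ z, 1 ≤ z → u z ^ 2 + u' z ^ 2 ≤ 2 * e 1 / z := by
    intro z hz
    have h1 : e z ≤ e 1 := hanti (by simp) hz hz
    have h2 : 0 ≤ u z ^ 2 / (2 * z) := by positivity
    rw [le_div_iff₀ (by linarith)]
    simp only [he] at h1 ⊢
    nlinarith [sq_nonneg (u z + u' z), sq_nonneg (u z), sq_nonneg (u' z)]
  refine ⟨√(2 * e 1), Real.sqrt_nonneg _, fun z hz => ?_⟩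
  rw [← Real.sqrt_div' _ (by linarith)]
  exact ⟨Real.abs_le_sqrt ((le_add_of_nonneg_right (sq_nonneg _)).trans (hle z hz)),
    Real.abs_le_sqrt ((le_add_of_nonneg_left (sq_nonneg _)).trans (hle z hz))⟩

/-- The argument is at most `1/4`, and `e^{1/4} ≤ 2` because `e < 2⁴`. -/
lemma abs_entireSeries_le_two {a : ℕ → ℝ} (ha : ∀ k, |a k| ≤ 1 / (k.factorial : ℝ)) {z : ℝ}
    (hz : 0 < z) (hz1 : z ≤ 1) : |entireSeries a (z ^ 2 / 4)| ≤ 2 := by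
  refine (abs_entireSeries_le ha _).trans ?_
  rw [abs_of_nonneg (by positivity)]
  have h : Real.exp (z ^ 2 / 4) ≤ Real.exp (1 / 4) := Real.exp_le_exp.mpr (by nlinarith)
  have h2 : Real.exp (1 / 4) ≤ 2 := by
    have := Real.exp_one_lt_d9
    have h3 : Real.exp (1 / 4) ^ 4 = Real.exp 1 := by rw [← Real.exp_nat_mul]; norm_num
    by_contra hcon
    push Not at hcon
    have : (2 : ℝ) ^ 4 < Real.exp (1 / 4) ^ 4 := by gcongr
    linarith
  linarith

lemma abs_besselJ0_sub_one_le {z : ℝ} (hz : 0 < z) (hz1 : z ≤ 1) :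
    |besselJ0 z - 1| ≤ z ^ 2 := by
  have h := abs_entireSeries_le_two (abs_shift_le abs_coeffJ_le) hz hz1
  rw [besselJ0_eq, entireSeries_eq_add abs_coeffJ_le]
  have h0 : coeffJ 0 = 1 := by simp [coeffJ]
  rw [h0, add_sub_cancel_left, abs_mul, abs_of_nonneg (by positivity)]
  nlinarith [sq_nonneg z]

lemma abs_besselYReg_le {z : ℝ} (hz : 0 < z) (hz1 : z ≤ 1) : |besselYReg z| ≤ z ^ 2 := by
  have h := abs_entireSeries_le_two (abs_shift_le abs_coeffY_le) hz hz1
  rw [besselYReg, entireSeries_eq_add abs_coeffY_le]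
  have h0 : coeffY 0 = 0 := by simp [coeffY]
  rw [h0, zero_add, abs_mul, abs_of_nonneg (by positivity)]
  nlinarith [sq_nonneg z]

lemma abs_besselJ0Deriv_le {z : ℝ} (hz : 0 < z) (hz1 : z ≤ 1) : |besselJ0Deriv z| ≤ z := by
  have h := abs_entireSeries_le_two (abs_derivCoeff_le abs_coeffJ_le) hz hz1
  rw [besselJ0Deriv, abs_mul, abs_of_nonneg (by positivity)]
  nlinarith

lemma abs_besselYRegDeriv_le {z : ℝ} (hz : 0 < z) (hz1 : z ≤ 1) : |besselYRegDeriv z| ≤ z := by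
  have h := abs_entireSeries_le_two (abs_derivCoeff_le abs_coeffY_le) hz hz1
  rw [besselYRegDeriv, abs_mul, abs_of_nonneg (by positivity)]
  nlinarith

/-- `f` vanishes like `z^{1/2}` at the origin, with the corresponding bounds on two derivatives,
and grows at most like `z^{1/2}` with derivatives `O(z^{-1/2})` at infinity. -/
def HalfGrowth (f : ℝ → ℝ) : Prop :=
  ∃ C, 0 ≤ C ∧ ∃ f' f'' : ℝ → ℝ, ∀ z, 0 < z → HasDerivAt f (f' z) z ∧ HasDerivAt f' (f'' z) z ∧
    |f z| ≤ C * √z ∧ |f' z| ≤ C / √z ∧ |f'' z| ≤ C / √z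

lemma sq_le_sqrt {z : ℝ} (hz : 0 < z) (hz1 : z ≤ 1) : z ≤ √z ∧ √z ≤ 1 ∧ 1 ≤ 1 / √z := by
  have h : √z ≤ 1 := Real.sqrt_le_one.mpr hz1
  have hp : 0 < √z := Real.sqrt_pos.mpr hz
  refine ⟨?_, h, by rwa [le_div_iff₀ hp, one_mul]⟩
  nlinarith [Real.sq_sqrt hz.le]

/-- The power series gives the bounds up to `z = 1`. Beyond it the subtracted constant is dominated
by `√z`, and `J₀` and its derivatives decay by the energy estimate. -/
lemma halfGrowth_besselJ0_sub_one : HalfGrowth fun z => besselJ0 z - 1 := by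
  obtain ⟨C, hC, hb⟩ := exists_abs_le_div_sqrt_of_bessel_ode
    (fun z _ => hasDerivAt_besselJ0 z) (fun z hz => hasDerivAt_besselJ0Deriv hz)
  refine ⟨2 * C + 3, by positivity, besselJ0Deriv, fun z => -besselJ0 z - besselJ0Deriv z / z,
    fun z hz => ⟨(hasDerivAt_besselJ0 z).sub_const 1, hasDerivAt_besselJ0Deriv hz, ?_⟩⟩
  have hp : 0 < √z := Real.sqrt_pos.mpr hz
  rcases le_total z 1 with hz1 | hz1
  · obtain ⟨h1, h2, h3⟩ := sq_le_sqrt hz hz1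
    have a0 := abs_besselJ0_sub_one_le hz hz1
    have a1 := abs_besselJ0Deriv_le hz hz1
    have a2 : |besselJ0Deriv z / z| ≤ 1 := by
      rw [abs_div, abs_of_pos hz, div_le_one hz]
      exact a1
    have a3 : (2 * C + 3) / √z = (2 * C + 3) * (1 / √z) := by ring
    rw [a3]
    refine ⟨by nlinarith, by nlinarith, ?_⟩
    have : |(-besselJ0 z - besselJ0Deriv z / z)| ≤ 3 := by
      rw [abs_le] at a0 a2 ⊢
      constructor <;> nlinarith
    nlinarith
  · obtain ⟨b0, b1⟩ := hb z hz1
    have h1 : 1 ≤ √z := Real.one_le_sqrt.mpr hz1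
    have h2 : C / √z ≤ C := div_le_self hC h1
    have a3 : (2 * C + 3) / √z = 2 * (C / √z) + 3 / √z := by ring
    have a4 : 0 ≤ C / √z := by positivity
    have a5 : 0 ≤ 3 / √z := by positivity
    have a6 : |besselJ0Deriv z / z| ≤ C / √z := by
      rw [abs_div, abs_of_pos hz]
      exact (div_le_self (abs_nonneg _) hz1).trans b1
    rw [a3]
    refine ⟨?_, by linarith, ?_⟩
    · rw [abs_le] at b0 ⊢
      constructor <;> nlinarith
    · rw [abs_le] at b0 a6 ⊢
      constructor <;> linarith

lemma abs_log_le_div_sqrt {z : ℝ} (hz : 0 < z) (hz1 : z ≤ 1) : |Real.log z| ≤ 2 / √z := by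
  have hp : 0 < √z := Real.sqrt_pos.mpr hz
  have h := Real.log_le_sub_one_of_pos (inv_pos.mpr hp)
  rw [Real.log_inv, Real.log_sqrt hz.le] at h
  rw [abs_of_nonpos (Real.log_nonpos hz.le hz1), div_eq_mul_inv]
  linarith

lemma abs_log_le_sqrt {z : ℝ} (hz1 : 1 ≤ z) : |Real.log z| ≤ 2 * √z := by
  have hz : 0 < z := by linarith
  have hp : 0 < √z := Real.sqrt_pos.mpr hz
  have h := Real.log_le_sub_one_of_pos hp
  rw [Real.log_sqrt hz.le] at h
  rw [abs_of_nonneg (Real.log_nonneg hz1)]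
  linarith

lemma abs_log_half_add_le {z : ℝ} (hz : 0 < z) :
    |Real.log (z / 2) + Real.eulerMascheroniConstant| ≤ |Real.log z| + 2 := by
  rw [Real.log_div hz.ne' two_ne_zero]
  have h1 := Real.log_two_lt_d9
  have h2 := Real.log_two_gt_d9
  have h3 := Real.one_half_lt_eulerMascheroniConstant
  have h4 := Real.eulerMascheroniConstant_lt_two_thirds
  refine (abs_le.mpr ⟨?_, ?_⟩)
  · linarith [neg_abs_le (Real.log z)]
  · linarith [le_abs_self (Real.log z)]

/-- Since `(1/4)(2/π) = 1/(2π)`, the added logarithm removes the singular part of `Y₀`, and with it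
the poles `1/z` and `1/z²` of the derivatives. In the function and its first derivative the
surviving logarithms carry a factor `J₀ - 1` or `J₀'`; the second derivative retains a bare
logarithm, which is `O(z^{-1/2})`. -/
lemma abs_besselY0_sub_log_le {z : ℝ} (hz : 0 < z) (hz1 : z ≤ 1) :
    |-(1 / 4) * besselY0 z
      + 1 / (2 * Real.pi) * (Real.log (z / 2) + Real.eulerMascheroniConstant)| ≤ 20 * √z ∧
    |-(1 / 4) * besselY0Deriv z + 1 / (2 * Real.pi) * (1 / z)| ≤ 20 / √z ∧
    |-(1 / 4) * (-besselY0 z - besselY0Deriv z / z) + 1 / (2 * Real.pi) * (-(z ^ 2)⁻¹)|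
      ≤ 20 / √z := by
  have hpi := Real.pi_gt_three
  have hpi' : 1 / (2 * Real.pi) ≤ 1 := by
    rw [div_le_one (by positivity)]; linarith
  have hpi0 : 0 < 1 / (2 * Real.pi) := by positivity
  have hp : 0 < √z := Real.sqrt_pos.mpr hz
  have hsq : √z ^ 2 = z := Real.sq_sqrt hz.le
  have hL := abs_log_half_add_le hz
  have hzz : z ^ 2 ≤ z := by nlinarith
  obtain ⟨h1, h2, h3⟩ := sq_le_sqrt hz hz1
  have hlog := abs_log_le_div_sqrt hz hz1
  have a0 := abs_besselJ0_sub_one_le hz hz1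
  have a1 := abs_besselJ0Deriv_le hz hz1
  have y0 := abs_besselYReg_le hz hz1
  have y1 := abs_besselYRegDeriv_le hz hz1
  set L := Real.log (z / 2) + Real.eulerMascheroniConstant with hLdef
  have hL' : |L| ≤ 4 / √z := by
    have : 4 / √z = 2 / √z + 2 * (1 / √z) := by ring
    linarith
  have e0 : -(1 / 4) * besselY0 z + 1 / (2 * Real.pi) * L
      = -(1 / (2 * Real.pi)) * (L * (besselJ0 z - 1) + besselYReg z) := by
    rw [besselY0_eq, ← hLdef]
    field_simp
    ring
  have e1 : -(1 / 4) * besselY0Deriv z + 1 / (2 * Real.pi) * (1 / z)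
      = -(1 / (2 * Real.pi)) * ((besselJ0 z - 1) / z + L * besselJ0Deriv z
        + besselYRegDeriv z) := by
    rw [besselY0Deriv, ← hLdef]
    field_simp
    ring
  have e2 : -(1 / 4) * (-besselY0 z - besselY0Deriv z / z) + 1 / (2 * Real.pi) * (-(z ^ 2)⁻¹)
      = 1 / (2 * Real.pi) * (L + L * (besselJ0 z - 1) + besselYReg z + (besselJ0 z - 1) / z ^ 2
        + L * (besselJ0Deriv z / z) + besselYRegDeriv z / z) := by
    rw [besselY0_eq, besselY0Deriv, ← hLdef]
    field_simp
    ring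
  have hLz : |L| * z ≤ 4 * √z := by
    calc |L| * z ≤ 4 / √z * z := by gcongr
      _ = 4 * √z := by
        field_simp
        rw [hsq]
  have b1 : |(besselJ0 z - 1) / z| ≤ z := by
    rw [abs_div, abs_of_pos hz, div_le_iff₀ hz]
    linarith [sq z]
  have b2 : |(besselJ0 z - 1) / z ^ 2| ≤ 1 := by
    rw [abs_div, abs_of_pos (by positivity : 0 < z ^ 2), div_le_one (by positivity)]
    exact a0
  have b3 : |besselJ0Deriv z / z| ≤ 1 := by
    rw [abs_div, abs_of_pos hz, div_le_one hz]
    exact a1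
  have b4 : |besselYRegDeriv z / z| ≤ 1 := by
    rw [abs_div, abs_of_pos hz, div_le_one hz]
    exact y1
  have hscale : ∀ x : ℝ, |1 / (2 * Real.pi) * x| ≤ |x| := fun x => by
    rw [abs_mul, abs_of_pos hpi0]
    exact mul_le_of_le_one_left (abs_nonneg _) hpi'
  have hscale' : ∀ x : ℝ, |-(1 / (2 * Real.pi)) * x| ≤ |x| := fun x => by
    rw [neg_mul, abs_neg]
    exact hscale x
  have a3 : 20 / √z = 20 * (1 / √z) := by ring
  have a4 : 4 / √z = 4 * (1 / √z) := by ring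
  rw [e0, e1, e2, a3]
  refine ⟨(hscale' _).trans ?_, (hscale' _).trans ?_, (hscale _).trans ?_⟩
  · calc |L * (besselJ0 z - 1) + besselYReg z|
        ≤ |L| * |besselJ0 z - 1| + |besselYReg z| := by
          rw [← abs_mul]; exact abs_add_le _ _
      _ ≤ |L| * z + z ^ 2 := by
          gcongr
          exact a0.trans hzz
      _ ≤ 20 * √z := by linarith
  · calc |(besselJ0 z - 1) / z + L * besselJ0Deriv z + besselYRegDeriv z|
        ≤ |(besselJ0 z - 1) / z| + |L| * |besselJ0Deriv z| + |besselYRegDeriv z| := by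
          rw [← abs_mul]; exact abs_add_three _ _ _
      _ ≤ z + |L| * z + z := by gcongr
      _ ≤ 20 * (1 / √z) := by linarith
  · calc |L + L * (besselJ0 z - 1) + besselYReg z + (besselJ0 z - 1) / z ^ 2
          + L * (besselJ0Deriv z / z) + besselYRegDeriv z / z|
        ≤ |L| + |L| * |besselJ0 z - 1| + |besselYReg z| + |(besselJ0 z - 1) / z ^ 2|
          + |L| * |besselJ0Deriv z / z| + |besselYRegDeriv z / z| := by
          rw [← abs_mul, ← abs_mul]
          refine (abs_add_le _ _).trans (add_le_add_left ?_ _)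
          refine (abs_add_le _ _).trans (add_le_add_left ?_ _)
          refine (abs_add_le _ _).trans (add_le_add_left ?_ _)
          exact abs_add_three _ _ _
      _ ≤ |L| + |L| * 1 + 1 + 1 + |L| * 1 + 1 := by
          gcongr
          · linarith
          · linarith
      _ ≤ 20 * (1 / √z) := by linarith

lemma halfGrowth_besselY0_sub_log : HalfGrowth fun z => -(1 / 4) * besselY0 z
    + 1 / (2 * Real.pi) * (Real.log (z / 2) + Real.eulerMascheroniConstant) := by
  obtain ⟨C, hC, hb⟩ := exists_abs_le_div_sqrt_of_bessel_ode
    (fun z hz => hasDerivAt_besselY0 hz) (fun z hz => hasDerivAt_besselY0Deriv hz)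
  have hpi := Real.pi_gt_three
  have hpi' : 1 / (2 * Real.pi) ≤ 1 := by
    rw [div_le_one (by positivity)]; linarith
  have hpi0 : 0 < 1 / (2 * Real.pi) := by positivity
  refine ⟨C + 20, by positivity, fun z => -(1 / 4) * besselY0Deriv z + 1 / (2 * Real.pi) * (1 / z),
    fun z => -(1 / 4) * (-besselY0 z - besselY0Deriv z / z) + 1 / (2 * Real.pi) * (-(z ^ 2)⁻¹),
    fun z hz => ⟨((hasDerivAt_besselY0 hz).const_mul _).add ((hasDerivAt_log_half hz).const_mul _),
      ((hasDerivAt_besselY0Deriv hz).const_mul _).add ?_, ?_⟩⟩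
  · simp only [one_div]
    exact (hasDerivAt_inv hz.ne').const_mul _
  have hp : 0 < √z := Real.sqrt_pos.mpr hz
  have hsq : √z ^ 2 = z := Real.sq_sqrt hz.le
  have hL := abs_log_half_add_le hz
  rcases le_total z 1 with hz1 | hz1
  · obtain ⟨b0, b1, b2⟩ := abs_besselY0_sub_log_le hz hz1
    have h20 : 20 / √z ≤ (C + 20) / √z := by gcongr; linarith
    exact ⟨b0.trans (by gcongr; linarith), b1.trans h20, b2.trans h20⟩
  · obtain ⟨b0, b1⟩ := hb z hz1
    have hlog := abs_log_le_sqrt hz1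
    have h1 : 1 ≤ √z := Real.one_le_sqrt.mpr hz1
    have h2 : C / √z ≤ C := div_le_self hC h1
    have a3 : (C + 20) / √z = C / √z + 20 * (1 / √z) := by ring
    have a4 : 0 ≤ C / √z := by positivity
    have a5 : 0 < 1 / √z := by positivity
    have a6 : |besselY0Deriv z / z| ≤ C / √z := by
      rw [abs_div, abs_of_pos hz]
      exact (div_le_self (abs_nonneg _) hz1).trans b1
    have a7 : 1 / z ≤ 1 / √z := one_div_le_one_div_of_le hp (by nlinarith)
    have a8 : (z ^ 2)⁻¹ ≤ 1 / z := by
      rw [← one_div]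
      exact one_div_le_one_div_of_le hz (by nlinarith)
    have a9 : 0 < (z ^ 2)⁻¹ := by positivity
    have a10 : 0 < 1 / z := by positivity
    set k := 1 / (2 * Real.pi)
    rw [a3]
    refine ⟨?_, ?_, ?_⟩
    · set L := Real.log (z / 2) + Real.eulerMascheroniConstant
      have : |k * L| ≤ 2 * √z + 2 := by
        rw [abs_mul, abs_of_pos hpi0]
        nlinarith [abs_nonneg L]
      rw [abs_le] at b0 this ⊢
      constructor <;> nlinarith
    · have : k * (1 / z) ≤ 1 / √z := by nlinarith
      have : 0 < k * (1 / z) := by positivity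
      rw [abs_le] at b1 ⊢
      constructor <;> linarith
    · have : k * (z ^ 2)⁻¹ ≤ 1 / √z := by nlinarith
      have : 0 < k * (z ^ 2)⁻¹ := by positivity
      rw [abs_le] at b0 a6 ⊢
      constructor <;> linarith

/-- The remainder in the expansion `R₀^±(lam²)(x, y) = ± i/4 - (1/2π) (log (z/2) + γ) + …`, where
`z = lam |x - y|`. -/
noncomputable def resolventRemainder (s z : ℝ) : ℂ :=
  s * (Complex.I / 4) * hankel0 s z
    - (s * (Complex.I / 4)
      - 1 / (2 * Real.pi) * ((Real.log (z / 2) + Real.eulerMascheroniConstant : ℝ) : ℂ))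

/-- As `s² = 1`, one has `(s i/4)(s i) Y₀ = -Y₀/4`. The remainder is thus a combination of `J₀ - 1`
and of `Y₀` with its logarithm removed, with constants common to both signs. -/
lemma exists_resolventRemainder_bound : ∃ C, 0 ≤ C ∧ ∀ s : ℝ, s ^ 2 = 1 → ∃ f' f'' : ℝ → ℂ,
    ∀ z, 0 < z → HasDerivAt (resolventRemainder s) (f' z) z ∧ HasDerivAt f' (f'' z) z ∧
      ‖resolventRemainder s z‖ ≤ C * √z ∧ ‖f' z‖ ≤ C / √z ∧ ‖f'' z‖ ≤ C / √z := by
  obtain ⟨C₁, hC₁, f', f'', hf⟩ := halfGrowth_besselJ0_sub_one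
  obtain ⟨C₂, hC₂, g', g'', hg⟩ := halfGrowth_besselY0_sub_log
  refine ⟨C₁ + C₂, by positivity, fun s hs => ⟨fun z => s * (Complex.I / 4) * (f' z : ℂ) + g' z,
    fun z => s * (Complex.I / 4) * (f'' z : ℂ) + g'' z, fun z hz => ?_⟩⟩
  obtain ⟨hf1, hf2, bf0, bf1, bf2⟩ := hf z hz
  obtain ⟨hg1, hg2, bg0, bg1, bg2⟩ := hg z hz
  have hsc : (s : ℂ) ^ 2 = 1 := by exact_mod_cast hs
  have hfun : resolventRemainder s = fun z => s * (Complex.I / 4) * ((besselJ0 z - 1 : ℝ) : ℂ)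
      + ((-(1 / 4) * besselY0 z + 1 / (2 * Real.pi) *
        (Real.log (z / 2) + Real.eulerMascheroniConstant) : ℝ) : ℂ) := by
    ext z
    rw [resolventRemainder, hankel0]
    push_cast
    linear_combination (besselY0 z : ℂ) * (1 / 4) * Complex.I ^ 2 * hsc
      + (1 / 4) * (besselY0 z : ℂ) * Complex.I_sq
  have hnorm : ‖(s : ℂ) * (Complex.I / 4)‖ ≤ 1 := by
    have : |s| = 1 := by
      rw [← sq_eq_sq₀ (abs_nonneg s) zero_le_one, sq_abs, hs, one_pow]
    simp [this]
    norm_num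
  have hb : ∀ {a b A B : ℝ}, |a| ≤ A → |b| ≤ B →
      ‖(s : ℂ) * (Complex.I / 4) * (a : ℂ) + (b : ℂ)‖ ≤ A + B := by
    intro a b A B ha hb
    refine (norm_add_le _ _).trans (add_le_add ?_ (by simpa using hb))
    rw [norm_mul, Complex.norm_real, Real.norm_eq_abs]
    exact (mul_le_of_le_one_left (abs_nonneg a) hnorm).trans ha
  refine ⟨?_, ?_, ?_, ?_, ?_⟩
  · rw [hfun]
    exact (hf1.ofReal_comp.const_mul _).add hg1.ofReal_comp
  · exact (hf2.ofReal_comp.const_mul _).add hg2.ofReal_comp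
  · rw [hfun, add_mul]
    exact hb bf0 bg0
  · rw [add_div]
    exact hb bf1 bg1
  · rw [add_div]
    exact hb bf2 bg2

end PlanarSchrodinger

namespace PlanarSchrodinger

open Filter Topology

/-! ### Functions with two controlled derivatives -/

/-- `F` has two derivatives on `(0, b)`, and `a₀`, `a₁`, `a₂` dominate `F` and its derivatives. -/
def C2Bound (b : ℝ) (F : ℝ → ℂ) (a₀ a₁ a₂ : ℝ → ℝ) : Prop :=
  ∃ F' F'' : ℝ → ℂ, ∀ l ∈ Ioo 0 b, HasDerivAt F (F' l) l ∧ HasDerivAt F' (F'' l) l ∧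
    ‖F l‖ ≤ a₀ l ∧ ‖F' l‖ ≤ a₁ l ∧ ‖F'' l‖ ≤ a₂ l

namespace C2Bound

variable {b : ℝ} {F H : ℝ → ℂ} {a₀ a₁ a₂ c₀ c₁ c₂ : ℝ → ℝ}

lemma mono (h : C2Bound b F a₀ a₁ a₂)
    (h' : ∀ l ∈ Ioo 0 b, a₀ l ≤ c₀ l ∧ a₁ l ≤ c₁ l ∧ a₂ l ≤ c₂ l) : C2Bound b F c₀ c₁ c₂ := by
  obtain ⟨F', F'', hF⟩ := h
  refine ⟨F', F'', fun l hl => ?_⟩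
  obtain ⟨h1, h2, h3, h4, h5⟩ := hF l hl
  obtain ⟨k0, k1, k2⟩ := h' l hl
  exact ⟨h1, h2, h3.trans k0, h4.trans k1, h5.trans k2⟩

lemma add (hF : C2Bound b F a₀ a₁ a₂) (hH : C2Bound b H c₀ c₁ c₂) :
    C2Bound b (fun l => F l + H l) (fun l => a₀ l + c₀ l) (fun l => a₁ l + c₁ l)
      (fun l => a₂ l + c₂ l) := by
  obtain ⟨F', F'', hF⟩ := hF
  obtain ⟨H', H'', hH⟩ := hH
  refine ⟨fun l => F' l + H' l, fun l => F'' l + H'' l, fun l hl => ?_⟩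
  obtain ⟨h1, h2, h3, h4, h5⟩ := hF l hl
  obtain ⟨k1, k2, k3, k4, k5⟩ := hH l hl
  exact ⟨h1.add k1, h2.add k2, norm_add_le_of_le h3 k3, norm_add_le_of_le h4 k4,
    norm_add_le_of_le h5 k5⟩

lemma mul (hF : C2Bound b F a₀ a₁ a₂) (hH : C2Bound b H c₀ c₁ c₂) :
    C2Bound b (fun l => F l * H l) (fun l => a₀ l * c₀ l) (fun l => a₁ l * c₀ l + a₀ l * c₁ l)
      (fun l => a₂ l * c₀ l + 2 * (a₁ l * c₁ l) + a₀ l * c₂ l) := by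
  obtain ⟨F', F'', hF⟩ := hF
  obtain ⟨H', H'', hH⟩ := hH
  refine ⟨fun l => F' l * H l + F l * H' l,
    fun l => F'' l * H l + 2 * (F' l * H' l) + F l * H'' l, fun l hl => ?_⟩
  obtain ⟨h1, h2, h3, h4, h5⟩ := hF l hl
  obtain ⟨k1, k2, k3, k4, k5⟩ := hH l hl
  have n : ∀ {x y : ℂ} {p q : ℝ}, ‖x‖ ≤ p → ‖y‖ ≤ q → ‖x * y‖ ≤ p * q := by
    intro x y p q hx hy
    rw [norm_mul]
    exact mul_le_mul hx hy (norm_nonneg _) ((norm_nonneg _).trans hx)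
  refine ⟨h1.mul k1, ?_, n h3 k3, norm_add_le_of_le (n h4 k3) (n h3 k4),
    norm_add_le_of_le (norm_add_le_of_le (n h5 k3) (n (by simp) (n h4 k4))) (n h3 k5)⟩
  refine ((h2.mul k1).add (h1.mul k2)).congr_deriv ?_
  ring

lemma const (c : ℂ) : C2Bound b (fun _ => c) (fun _ => ‖c‖) (fun _ => 0) (fun _ => 0) :=
  ⟨fun _ => 0, fun _ => 0, fun l _ =>
    ⟨hasDerivAt_const l c, hasDerivAt_const l 0, le_rfl, by simp, by simp⟩⟩

lemma const_mul (c : ℂ) (hF : C2Bound b F a₀ a₁ a₂) :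
    C2Bound b (fun l => c * F l) (fun l => ‖c‖ * a₀ l) (fun l => ‖c‖ * a₁ l)
      (fun l => ‖c‖ * a₂ l) :=
  ((const c).mul hF).mono fun l _ => by simp

/-- The existential witnesses may be replaced by `deriv F` and `deriv (deriv F)`, whose
measurability is automatic. -/
lemma deriv_spec (h : C2Bound b F a₀ a₁ a₂) : ∀ l ∈ Ioo 0 b,
    HasDerivAt F (deriv F l) l ∧ HasDerivAt (deriv F) (deriv (deriv F) l) l ∧
      ‖F l‖ ≤ a₀ l ∧ ‖deriv F l‖ ≤ a₁ l ∧ ‖deriv (deriv F) l‖ ≤ a₂ l := by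
  obtain ⟨F', F'', hF⟩ := h
  have heq : ∀ l ∈ Ioo 0 b, deriv F l = F' l := fun l hl => (hF l hl).1.deriv
  intro l hl
  obtain ⟨h1, h2, h3, h4, h5⟩ := hF l hl
  have h2' : HasDerivAt (deriv F) (F'' l) l :=
    h2.congr_of_eventuallyEq (eventually_of_mem (Ioo_mem_nhds hl.1 hl.2) heq)
  rw [heq l hl, h2'.deriv]
  exact ⟨h1, h2', h3, h4, h5⟩

end C2Bound

/-! ### Oscillatory integrals with phase `t lam²` -/

/-- The phase factor `e^{it lam²}`. -/
noncomputable def phase (t l : ℝ) : ℂ := Complex.exp (Complex.I * t * l ^ 2)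

lemma norm_phase (t l : ℝ) : ‖phase t l‖ = 1 := by
  have : Complex.I * t * (l : ℂ) ^ 2 = ((t * l ^ 2 : ℝ) : ℂ) * Complex.I := by push_cast; ring
  rw [phase, this, Complex.norm_exp_ofReal_mul_I]

lemma hasDerivAt_phase (t l : ℝ) : HasDerivAt (phase t) (2 * Complex.I * t * l * phase t l) l := by
  have h : HasDerivAt (fun z : ℂ => Complex.exp (Complex.I * t * z ^ 2))
      (2 * Complex.I * t * l * phase t l) (l : ℂ) := by
    refine (((hasDerivAt_pow 2 (l : ℂ)).const_mul (Complex.I * t)).cexp).congr_deriv ?_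
    rw [phase]
    push_cast
    ring
  exact h.comp_ofReal

lemma continuous_phase (t : ℝ) : Continuous (phase t) := by
  unfold phase
  fun_prop

lemma intervalIntegrable_phase_mul {b K : ℝ} {F : ℝ → ℂ} {a₀ a₁ a₂ : ℝ → ℝ} (hb : 0 < b)
    (hF : C2Bound b F a₀ a₁ a₂) (hK : ∀ l ∈ Ioo 0 b, a₀ l ≤ K) (t : ℝ) :
    IntervalIntegrable (fun l => phase t l * l * F l) volume 0 b := by
  have hD := hF.deriv_spec
  have hFc : ContinuousOn F (Ioo 0 b) := fun l hl => (hD l hl).1.continuousAt.continuousWithinAt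
  rw [intervalIntegrable_iff_integrableOn_Ioo_of_le hb.le]
  refine Integrable.mono' (integrableOn_const (C := b * K) (by simp))
    ((((continuous_phase t).mul Complex.continuous_ofReal).continuousOn.mul
      hFc).aestronglyMeasurable measurableSet_Ioo) ?_
  refine (ae_restrict_mem measurableSet_Ioo).mono fun l hl => ?_
  rw [norm_mul, norm_mul, norm_phase, one_mul, Complex.norm_real, Real.norm_of_nonneg hl.1.le]
  exact mul_le_mul hl.2.le ((hD l hl).2.2.1.trans (hK l hl)) (norm_nonneg _) hb.le

/-- Two integrations by parts, the second one only on `(ρ, b)`. The functions `P` and `-G` are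
primitives of majorants of `F'` and of the derivative of `F' / lam`. -/
theorem norm_integral_phase_le {b l₁ K : ℝ} {F : ℝ → ℂ} {a₀ a₁ a₂ P p G g : ℝ → ℝ} {F₀ : ℂ}
    (hb : 0 < b) (hl₁ : l₁ < b) (hF : C2Bound b F a₀ a₁ a₂) (hK : ∀ l ∈ Ioo 0 b, a₀ l ≤ K)
    (hvan : ∀ l, l₁ < l → F l = 0) (hF₀ : Tendsto F (𝓝[>] 0) (𝓝 F₀))
    (hPc : ContinuousOn P (Icc 0 b)) (hP : ∀ l ∈ Ioo 0 b, HasDerivAt P (p l) l)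
    (hp : ∀ l ∈ Ioo 0 b, a₁ l ≤ p l) (hG : ∀ l ∈ Ioo 0 b, HasDerivAt G (g l) l)
    (hg : ∀ l ∈ Ioo 0 b, a₂ l / l + a₁ l / l ^ 2 ≤ -g l)
    (hG₀ : ∀ l ∈ Ioo 0 b, a₁ l / l ≤ G l) {t : ℝ} (ht : 0 < t) :
    ‖(∫ l in 0..b, phase t l * l * F l) + F₀ / (2 * Complex.I * t)‖ ≤ 1 / (2 * t) * (P b - P 0) ∧
    ∀ ρ ∈ Ioo 0 b, ‖(∫ l in 0..b, phase t l * l * F l) + F₀ / (2 * Complex.I * t)‖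
      ≤ 1 / (2 * t) * (P ρ - P 0 + G ρ / t) := by
  have hD := hF.deriv_spec
  have htc : (t : ℂ) ≠ 0 := by exact_mod_cast ht.ne'
  have hp0 : ∀ l ∈ Ioo 0 b, 0 ≤ p l := fun l hl =>
    ((norm_nonneg _).trans (hD l hl).2.2.2.1).trans (hp l hl)
  have hF'c : ContinuousOn (deriv F) (Ioo 0 b) := fun l hl =>
    (hD l hl).2.1.continuousAt.continuousWithinAt
  have hvan' : ∀ l, l₁ < l → deriv F l = 0 := by
    intro l hl
    have : F =ᶠ[𝓝 l] fun _ => 0 := eventually_of_mem (Ioi_mem_nhds hl) hvan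
    rw [this.deriv_eq, deriv_const]
  have hpint : IntegrableOn p (Ioc 0 b) := intervalIntegral.integrableOn_deriv_of_nonneg hPc hP hp0
  have hpint' : ∀ {u w : ℝ}, 0 ≤ u → u ≤ w → w ≤ b → IntervalIntegrable p volume u w := by
    intro u w hu huw hw
    rw [intervalIntegrable_iff_integrableOn_Ioc_of_le huw]
    exact hpint.mono_set (Ioc_subset_Ioc hu hw)
  have hF'int : IntegrableOn (fun l => phase t l * deriv F l) (Ioc 0 b) := by
    rw [integrableOn_Ioc_iff_integrableOn_Ioo]
    refine Integrable.mono' (hpint.mono_set Ioo_subset_Ioc_self)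
      (((continuous_phase t).continuousOn.mul hF'c).aestronglyMeasurable measurableSet_Ioo) ?_
    refine (ae_restrict_mem measurableSet_Ioo).mono fun l hl => ?_
    rw [norm_mul, norm_phase, one_mul]
    exact (hD l hl).2.2.2.1.trans (hp l hl)
  have hF'int' : ∀ {u w : ℝ}, 0 ≤ u → u ≤ w → w ≤ b →
      IntervalIntegrable (fun l => phase t l * deriv F l) volume u w := by
    intro u w hu huw hw
    rw [intervalIntegrable_iff_integrableOn_Ioc_of_le huw]
    exact hF'int.mono_set (Ioc_subset_Ioc hu hw)
  have hFint := intervalIntegrable_phase_mul hb hF hK t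
  -- The factor `λ e^{itλ²}` is `1/(2it)` times the derivative of the phase. The boundary term at
  -- `b` is zero because `F` vanishes beyond `l₁ < b`; the one at `0` yields `F₀`.
  have hparts : (∫ l in 0..b, phase t l * l * F l) + F₀ / (2 * Complex.I * t)
      = -(1 / (2 * Complex.I * t)) * ∫ l in 0..b, phase t l * deriv F l := by
    have h := intervalIntegral.integral_eq_sub_of_hasDerivAt_of_tendsto (E := ℂ) hb
      (f := fun l => phase t l * F l)
      (f' := fun l => 2 * Complex.I * t * (phase t l * l * F l) + phase t l * deriv F l)
      (fa := F₀) (fb := 0)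
      (fun l hl => ((hasDerivAt_phase t l).mul (hD l hl).1).congr_deriv (by ring))
      ((hFint.const_mul _).add (hF'int' le_rfl hb.le le_rfl)) ?_ ?_
    · rw [intervalIntegral.integral_add (hFint.const_mul _) (hF'int' le_rfl hb.le le_rfl),
        intervalIntegral.integral_const_mul] at h
      have hI := Complex.I_ne_zero
      field_simp
      linear_combination h
    · have h1 : Tendsto (phase t) (𝓝[>] 0) (𝓝 (phase t 0)) :=
        (continuous_phase t).continuousAt.tendsto.mono_left nhdsWithin_le_nhds
      have h2 : phase t 0 = 1 := by simp [phase]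
      rw [h2] at h1
      simpa using h1.mul hF₀
    · refine tendsto_const_nhds.congr' ?_
      filter_upwards [mem_nhdsWithin_of_mem_nhds (Ioi_mem_nhds hl₁)] with l hl
      rw [hvan l hl, mul_zero]
  have hnorm : ‖(∫ l in 0..b, phase t l * l * F l) + F₀ / (2 * Complex.I * t)‖
      = 1 / (2 * t) * ‖∫ l in 0..b, phase t l * deriv F l‖ := by
    rw [hparts, norm_mul]
    simp [abs_of_pos ht]
  have hfirst : ∀ {w : ℝ}, 0 ≤ w → w ≤ b →
      ‖∫ l in 0..w, phase t l * deriv F l‖ ≤ P w - P 0 := by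
    intro w hw hwb
    have h1 : ∫ l in 0..w, p l = P w - P 0 :=
      intervalIntegral.integral_eq_sub_of_hasDerivAt_of_le hw
        (hPc.mono (Icc_subset_Icc le_rfl hwb)) (fun l hl => hP l ⟨hl.1, hl.2.trans_le hwb⟩)
        (hpint' le_rfl hw hwb)
    rw [← h1]
    refine intervalIntegral.norm_integral_le_of_norm_le hw ?_ (hpint' le_rfl hw hwb)
    have hne : ∀ᵐ l : ℝ, l ≠ b := by simp [ae_iff]
    filter_upwards [hne] with l hlb hl
    have hl' : l ∈ Ioo 0 b := ⟨hl.1, lt_of_le_of_ne (hl.2.trans hwb) hlb⟩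
    rw [norm_mul, norm_phase, one_mul]
    exact (hD l hl').2.2.2.1.trans (hp l hl')
  rw [hnorm]
  refine ⟨by gcongr; exact hfirst hb.le le_rfl, fun ρ hρ => ?_⟩
  gcongr
  -- The second integration by parts ends at an interior point where `F'` already vanishes, since
  -- nothing is assumed about `F` and `G` at `b` itself.
  set m := (max l₁ ρ + b) / 2 with hm
  have hmb : m < b := by
    have := max_lt hl₁ hρ.2
    linarith
  have hm₁ : l₁ < m := by
    have := le_max_left l₁ ρ
    linarith
  have hmρ : ρ < m := by
    have := le_max_right l₁ ρ
    have := hρ.2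
    linarith [max_lt hl₁ hρ.2]
  have hm0 : 0 < m := hρ.1.trans hmρ
  have hsub : ∀ l ∈ Icc ρ m, l ∈ Ioo 0 b := fun l hl =>
    ⟨hρ.1.trans_le hl.1, hl.2.trans_lt hmb⟩
  have hsplit : ∫ l in 0..b, phase t l * deriv F l
      = (∫ l in 0..ρ, phase t l * deriv F l) + ∫ l in ρ..m, phase t l * deriv F l := by
    rw [intervalIntegral.integral_add_adjacent_intervals (hF'int' le_rfl hρ.1.le hρ.2.le)
      (hF'int' hρ.1.le hmρ.le hmb.le),
      ← intervalIntegral.integral_add_adjacent_intervals (hF'int' le_rfl hm0.le hmb.le)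
      (hF'int' hm0.le hmb.le le_rfl), intervalIntegral.integral_zero_ae (a := m), add_zero]
    refine Eventually.of_forall fun l hl => ?_
    rw [uIoc_of_le hmb.le] at hl
    rw [hvan' l (hm₁.trans hl.1), mul_zero]
  have hgint : IntegrableOn (fun l => -g l) (Ioc ρ m) := by
    refine intervalIntegral.integrableOn_deriv_of_nonneg (g := fun l => -G l)
      (fun l hl => (hG l (hsub l hl)).neg.continuousAt.continuousWithinAt)
      (fun l hl => (hG l (hsub l (Ioo_subset_Icc_self hl))).neg) fun l hl => ?_
    have hl' := hsub l (Ioo_subset_Icc_self hl)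
    refine le_trans ?_ (hg l hl')
    have h1 := (norm_nonneg _).trans (hD l hl').2.2.2.1
    have h2 := (norm_nonneg _).trans (hD l hl').2.2.2.2
    have := hl'.1
    positivity
  -- The phase times the derivative of `F'/λ`, which is what the second integration by parts leaves.
  set k : ℝ → ℂ := fun l => phase t l * (deriv (deriv F) l / l - deriv F l / l ^ 2) with hk
  have hkb : ∀ l ∈ Ioo 0 b, ‖k l‖ ≤ -g l := by
    intro l hl
    obtain ⟨-, -, -, d1, d2⟩ := hD l hl
    have hl0 := hl.1
    rw [hk, norm_mul, norm_phase, one_mul]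
    refine (norm_sub_le _ _).trans (le_trans ?_ (hg l hl))
    rw [norm_div, norm_div, norm_pow, Complex.norm_real, Real.norm_of_nonneg hl0.le]
    gcongr
  have hgint' : IntervalIntegrable (fun l => -g l) volume ρ m := by
    rwa [intervalIntegrable_iff_integrableOn_Ioc_of_le hmρ.le]
  have hkint : IntervalIntegrable k volume ρ m := by
    rw [intervalIntegrable_iff_integrableOn_Ioc_of_le hmρ.le]
    refine Integrable.mono' hgint ?_ ?_
    · have h1 : Measurable k := by
        have h3 := (continuous_phase t).measurable
        have h4 := measurable_deriv (deriv F)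
        have h5 := measurable_deriv F
        have h6 := Complex.measurable_ofReal
        exact h3.mul ((h4.div h6).sub (h5.div (h6.pow_const 2)))
      exact h1.aestronglyMeasurable
    · refine (ae_restrict_mem measurableSet_Ioc).mono fun l hl => ?_
      exact hkb l (hsub l (Ioc_subset_Icc_self hl))
  have hk_le : ‖∫ l in ρ..m, k l‖ ≤ G ρ - G m := by
    have h1 : ∫ l in ρ..m, -g l = -G m - -G ρ :=
      intervalIntegral.integral_eq_sub_of_hasDerivAt_of_le (f := fun l => -G l) hmρ.le
        (fun l hl => (hG l (hsub l hl)).neg.continuousAt.continuousWithinAt)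
        (fun l hl => (hG l (hsub l (Ioo_subset_Icc_self hl))).neg) hgint'
    have h2 : G ρ - G m = ∫ l in ρ..m, -g l := by rw [h1]; ring
    rw [h2]
    refine intervalIntegral.norm_integral_le_of_norm_le hmρ.le ?_ hgint'
    exact Eventually.of_forall fun l hl => hkb l (hsub l (Ioc_subset_Icc_self hl))
  have hsecond : ‖∫ l in ρ..m, phase t l * deriv F l‖ ≤ G ρ / t := by
    have hint := hF'int' hρ.1.le hmρ.le hmb.le
    have h := intervalIntegral.integral_eq_sub_of_hasDerivAt_of_le (E := ℂ) hmρ.le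
      (f := fun l => phase t l * (deriv F l / l))
      (f' := fun l => 2 * Complex.I * t * (phase t l * deriv F l) + k l) ?_ ?_
      ((hint.const_mul _).add hkint)
    · rw [intervalIntegral.integral_add (hint.const_mul _) hkint,
        intervalIntegral.integral_const_mul, hvan' m hm₁, zero_div, mul_zero, zero_sub] at h
      have hI := Complex.I_ne_zero
      have h' : ∫ l in ρ..m, phase t l * deriv F l
          = 1 / (2 * Complex.I * t) * (-(phase t ρ * (deriv F ρ / ρ)) - ∫ l in ρ..m, k l) := by
        field_simp
        linear_combination h
      have hρ' : ‖phase t ρ * (deriv F ρ / ρ)‖ ≤ G ρ := by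
        have := hρ.1
        rw [norm_mul, norm_phase, one_mul, norm_div, Complex.norm_real,
          Real.norm_of_nonneg hρ.1.le]
        refine le_trans ?_ (hG₀ ρ hρ)
        gcongr
        exact (hD ρ hρ).2.2.2.1
      have hm' : 0 ≤ G m := by
        refine le_trans ?_ (hG₀ m ⟨hm0, hmb⟩)
        have := (norm_nonneg _).trans (hD m ⟨hm0, hmb⟩).2.2.2.1
        positivity
      have hc : ‖1 / (2 * Complex.I * (t : ℂ))‖ = 1 / (2 * t) := by
        simp [abs_of_pos ht]
      rw [h', norm_mul, hc]
      -- One `G ρ` bounds the boundary term and another the integral; the leftover `-G m` is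
      -- nonpositive.
      calc 1 / (2 * t) * ‖-(phase t ρ * (deriv F ρ / ρ)) - ∫ l in ρ..m, k l‖
          ≤ 1 / (2 * t) * (G ρ + (G ρ - G m)) := by
            gcongr
            refine (norm_sub_le _ _).trans ?_
            rw [norm_neg]
            exact add_le_add hρ' hk_le
        _ ≤ 1 / (2 * t) * (2 * G ρ) := by gcongr; linarith
        _ = G ρ / t := by field_simp
    · intro l hl
      have hl' := hsub l hl
      have : (l : ℂ) ≠ 0 := by exact_mod_cast hl'.1.ne'
      exact ((continuous_phase t).continuousAt.mul ((hD l hl').2.1.continuousAt.div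
        Complex.continuous_ofReal.continuousAt this)).continuousWithinAt
    · intro l hl
      have hl' := hsub l (Ioo_subset_Icc_self hl)
      have hl0 : (l : ℂ) ≠ 0 := by exact_mod_cast hl'.1.ne'
      refine ((hasDerivAt_phase t l).mul ((hD l hl').2.1.div
        ((hasDerivAt_id (l : ℂ)).comp_ofReal) hl0)).congr_deriv ?_
      simp only [hk, id, Pi.div_apply]
      field_simp
  rw [hsplit]
  exact norm_add_le_of_le (hfirst hρ.1.le hρ.2.le) hsecond

/-- Decay `t^{-1-α}` for amplitudes vanishing like `lam^{1/2}`. -/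
theorem norm_integral_phase_le_half {b l₁ K B R α : ℝ} {F : ℝ → ℂ} {F₀ : ℂ} (hb : 0 < b)
    (hb1 : b ≤ 1) (hl₁ : l₁ < b) (hB : 0 ≤ B) (hR : 1 ≤ R)
    (hF : C2Bound b F (fun _ => K) (fun l => B / √l) (fun l => B * (1 / (l * √l) + R / √l)))
    (hvan : ∀ l, l₁ < l → F l = 0) (hF₀ : Tendsto F (𝓝[>] 0) (𝓝 F₀))
    (hα : 0 < α) (hα' : α ≤ 1 / 4) {t : ℝ} (ht : 1 ≤ t) :
    ‖(∫ l in 0..b, phase t l * l * F l) + F₀ / (2 * Complex.I * t)‖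
      ≤ 3 * (B * R ^ α / t ^ (1 + α)) := by
  have ht0 : 0 < t := by linarith
  have hsqrt : ∀ l ∈ Ioo 0 b, HasDerivAt (fun l => √l) (1 / (2 * √l)) l := fun l hl =>
    Real.hasDerivAt_sqrt hl.1.ne'
  obtain ⟨htriv, hmain⟩ := norm_integral_phase_le (P := fun l => 2 * B * √l) (p := fun l => B / √l)
    (G := fun l => 2 * B * (1 / (l * √l) + R / √l))
    (g := fun l => -(B * (3 / (l ^ 2 * √l) + R / (l * √l)))) hb hl₁ hF (fun l _ => le_rfl) hvan
    hF₀ (by fun_prop)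
    (fun l hl => ((hsqrt l hl).const_mul (2 * B)).congr_deriv (by field_simp)) (fun l _ => le_rfl)
    (fun l hl => by
      have hl0 := hl.1
      have hs : 0 < √l := Real.sqrt_pos.mpr hl0
      have hs2 : √l ^ 2 = l := Real.sq_sqrt hl0.le
      refine ((((hasDerivAt_const l (1 : ℝ)).div ((hasDerivAt_id l).mul (hsqrt l hl))
        (by simp only [id, Pi.mul_apply]; positivity)).add
        ((hasDerivAt_const l R).div (hsqrt l hl) hs.ne')).const_mul (2 * B)).congr_deriv ?_
      simp only [id, Pi.mul_apply]
      rw [← hs2] at hs ⊢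
      set r := √l
      have hr : 0 < r := Real.sqrt_pos.mpr hl0
      rw [Real.sqrt_sq hr.le]
      field_simp
      ring)
    (fun l hl => by
      have hl0 := hl.1
      have hs : 0 < √l := Real.sqrt_pos.mpr hl0
      have e : B * (1 / (l * √l) + R / √l) / l + B / √l / l ^ 2
          = B * (2 / (l ^ 2 * √l) + R / (l * √l)) := by
        field_simp
        ring
      rw [neg_neg, e]
      gcongr
      norm_num)
    (fun l hl => by
      have hl0 := hl.1
      have hs : 0 < √l := Real.sqrt_pos.mpr hl0
      have e1 : B / √l / l = B * (1 / (l * √l)) := by field_simp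
      have e2 : 0 ≤ B * (1 / (l * √l)) := by positivity
      have e3 : 0 ≤ B * (R / √l) := by positivity
      rw [e1]
      linarith) ht0
  -- The region below `ρ` costs `√ρ`, the one above costs `1/(t ρ^{3/2})` and `R/(t √ρ)`. These two
  -- are at most `√ρ` exactly when `ρ ≥ 1/√t` and `ρ ≥ R/t`.
  set ρ := max (1 / √t) (R / t) with hρdef
  have hst : 0 < √t := Real.sqrt_pos.mpr ht0
  have hst1 : 1 / √t ≤ 1 := by
    rw [div_le_one hst]
    exact Real.one_le_sqrt.mpr ht
  have hρ0 : 0 < ρ := lt_max_of_lt_left (by positivity)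
  have hRt : 0 < R / t := by positivity
  have hle : t ^ (-α) ≤ (R / t) ^ α := by
    rw [Real.rpow_neg ht0.le, ← Real.inv_rpow ht0.le]
    refine Real.rpow_le_rpow (by positivity) ?_ hα.le
    rw [← one_div]
    gcongr
  -- Here `α ≤ 1/4` enters: `ρ = 1/√t` gives `√ρ = t^{-1/4} ≤ t^{-α}`. In the case `ρ = R/t` an
  -- exponent `α ≤ 1/2` would be enough.
  have key : √(min ρ 1) ≤ (R / t) ^ α := by
    rcases le_total (R / t) (1 / √t) with h | h
    · have hρ : ρ = 1 / √t := max_eq_left h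
      rw [hρ, min_eq_left hst1]
      refine le_trans ?_ hle
      rw [Real.sqrt_eq_rpow, Real.sqrt_eq_rpow, one_div, ← Real.rpow_neg ht0.le,
        ← Real.rpow_mul ht0.le]
      exact Real.rpow_le_rpow_of_exponent_le ht (by linarith)
    · have hρ : ρ = R / t := max_eq_right h
      rw [hρ]
      rcases le_total (R / t) 1 with h1 | h1
      · rw [min_eq_left h1, Real.sqrt_eq_rpow]
        exact Real.rpow_le_rpow_of_exponent_ge hRt h1 (by linarith)
      · rw [min_eq_right h1, Real.sqrt_one]
        exact Real.one_le_rpow h1 hα.le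
  have hfin : 3 * (B * R ^ α / t ^ (1 + α)) = 1 / (2 * t) * (6 * B * (R / t) ^ α) := by
    rw [Real.div_rpow (by linarith) ht0.le, Real.rpow_add ht0, Real.rpow_one]
    have : 0 < t ^ α := by positivity
    field_simp
    ring
  rw [hfin]
  rcases lt_or_ge ρ b with h | h
  · refine (hmain ρ ⟨hρ0, h⟩).trans ?_
    rw [min_eq_left (h.le.trans hb1)] at key
    have hs : 0 < √ρ := Real.sqrt_pos.mpr hρ0
    have hs2 : √ρ * √ρ = ρ := Real.mul_self_sqrt hρ0.le
    have h1 : 1 / (ρ * √ρ) / t ≤ √ρ := by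
      rw [div_div, div_le_iff₀ (by positivity)]
      have : 1 / √t ≤ ρ := le_max_left _ _
      rw [div_le_iff₀ hst] at this
      have h2 : 1 * 1 ≤ (ρ * √t) * (ρ * √t) := mul_le_mul this this (by norm_num) (by positivity)
      calc (1 : ℝ) ≤ (ρ * √t) * (ρ * √t) := by linarith
        _ = ρ * ρ * (√t * √t) := by ring
        _ = √ρ * √ρ * ρ * t := by rw [Real.mul_self_sqrt ht0.le, hs2]
        _ = √ρ * (ρ * √ρ * t) := by ring
    have h2 : R / √ρ / t ≤ √ρ := by
      have : R / t ≤ ρ := le_max_right _ _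
      rw [div_right_comm, div_le_iff₀ hs, hs2]
      exact this
    have h3 : 2 * B * √ρ - 2 * B * √0 + 2 * B * (1 / (ρ * √ρ) + R / √ρ) / t
        = 2 * B * (√ρ + 1 / (ρ * √ρ) / t + R / √ρ / t) := by
      rw [Real.sqrt_zero]
      ring
    rw [h3]
    have h4 : 6 * B * (R / t) ^ α = 2 * B * (3 * (R / t) ^ α) := by ring
    rw [h4]
    gcongr
    linarith
  -- If `ρ ≥ b` there is no room for the second integration by parts, and none is needed: `b ≤ min ρ
  -- 1`, so the trivial bound already decays.
  · refine htriv.trans ?_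
    have h1 : √b ≤ (R / t) ^ α := (Real.sqrt_le_sqrt (le_min h hb1)).trans key
    have h0 : 0 ≤ √b := Real.sqrt_nonneg b
    rw [Real.sqrt_zero, mul_zero, sub_zero]
    have : 2 * B * √b ≤ 6 * B * (R / t) ^ α := by
      have := mul_le_mul_of_nonneg_left h1 hB
      have : 0 ≤ B * (R / t) ^ α := by positivity
      linarith
    gcongr

lemma tendsto_div_log_sq (c : ℝ) : Tendsto (fun l => c / Real.log l ^ 2) (𝓝[>] 0) (𝓝 0) := by
  refine tendsto_const_nhds.div_atTop ?_
  exact ((tendsto_pow_atTop two_ne_zero).comp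
    (tendsto_neg_atBot_atTop.comp Real.tendsto_log_nhdsGT_zero)).congr fun l => by simp

/-- At the endpoint `0` the conventions `log 0 = 0` and `c / 0 = 0` give the value `0`, which agrees
with the limit from the right. -/
lemma continuousOn_div_log_sq {b : ℝ} (hb : b < 1) (c : ℝ) :
    ContinuousOn (fun l => c / Real.log l ^ 2) (Icc 0 b) := by
  intro l hl
  rcases hl.1.eq_or_lt with rfl | h
  · have h1 := tendsto_div_log_sq c
    have h2 : ContinuousWithinAt (fun l => c / Real.log l ^ 2) (Ioi 0) 0 := by
      simpa [ContinuousWithinAt] using h1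
    exact (continuousWithinAt_Ioi_iff_Ici.mp h2).mono Icc_subset_Ici_self
  · have : Real.log l ≠ 0 := (Real.log_neg h (hl.2.trans_lt hb)).ne
    have h3 : ContinuousAt (fun l => c / Real.log l ^ 2) l :=
      continuousAt_const.div ((Real.continuousAt_log h.ne').pow 2) (by positivity)
    exact h3.continuousWithinAt

/-- Decay `(t log² t)⁻¹` for amplitudes of size `1 / log² lam`. -/
theorem norm_integral_phase_le_log {b l₁ K B : ℝ} {F : ℝ → ℂ} {F₀ : ℂ} (hb : 0 < b)
    (hb2 : b ≤ Real.exp (-2)) (hl₁ : l₁ < b) (hB : 0 ≤ B)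
    (hF : C2Bound b F (fun _ => K) (fun l => B / (l * (-Real.log l) ^ 3))
      (fun l => B / (l ^ 2 * (-Real.log l) ^ 3)))
    (hvan : ∀ l, l₁ < l → F l = 0) (hF₀ : Tendsto F (𝓝[>] 0) (𝓝 F₀)) {t : ℝ} (ht : 1 < t) :
    ‖(∫ l in 0..b, phase t l * l * F l) + F₀ / (2 * Complex.I * t)‖
      ≤ (1 + 4 / b ^ 2) * B / (t * Real.log t ^ 2) := by
  have ht0 : 0 < t := by linarith
  have hlog : ∀ l ∈ Ioo 0 b, 2 ≤ -Real.log l := fun l hl => by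
    have := Real.log_le_log hl.1 (hl.2.le.trans hb2)
    rw [Real.log_exp] at this
    linarith
  have hb1 : b < 1 := hb2.trans_lt (by rw [Real.exp_lt_one_iff]; norm_num)
  -- With `L = -log λ ≥ 2`, the factor `4` in `G` compensates for `2 - 3/L ≥ 1/2` in its derivative.
  -- At the splitting point `ρ = b/√t` the quantity `ρ² t` is the constant `b²`, and `L ≥ (log
  -- t)/2`.
  have hmain := (norm_integral_phase_le (P := fun l => B / 2 / Real.log l ^ 2)
    (p := fun l => B / (l * (-Real.log l) ^ 3)) (G := fun l => 4 * B / (l ^ 2 * (-Real.log l) ^ 3))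
    (g := fun l => -(4 * B / (l ^ 3 * (-Real.log l) ^ 3) * (2 - 3 / (-Real.log l))))
    hb hl₁ hF (fun l _ => le_rfl) hvan hF₀
    (continuousOn_div_log_sq hb1 _)
    (fun l hl => by
      have h2 := hlog l hl
      have hl0 := hl.1.ne'
      have h0 : Real.log l ≠ 0 := by intro h; rw [h] at h2; norm_num at h2
      refine ((hasDerivAt_const l (B / 2)).div ((Real.hasDerivAt_log hl0).pow 2)
        (pow_ne_zero 2 h0)).congr_deriv ?_
      simp only [Pi.pow_apply]
      have h0' : -Real.log l ≠ 0 := neg_ne_zero.mpr h0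
      field_simp
      ring) (fun l _ => le_rfl)
    (fun l hl => by
      have h2 := hlog l hl
      have hl0 := hl.1.ne'
      have h0 : -Real.log l ≠ 0 := by intro h; rw [h] at h2; norm_num at h2
      refine ((hasDerivAt_const l (4 * B)).div ((hasDerivAt_pow 2 l).mul
        ((Real.hasDerivAt_log hl0).neg.pow 3)) ?_).congr_deriv ?_
      · simp only [Pi.mul_apply, Pi.pow_apply, Pi.neg_apply]
        positivity
      simp only [Pi.mul_apply, Pi.pow_apply, Pi.neg_apply]
      set L := -Real.log l
      field_simp
      push_cast
      ring)
    (fun l hl => by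
      have h2 := hlog l hl
      have hl0 := hl.1
      set L := -Real.log l
      have hL : 0 < L := by linarith
      have e : B / (l ^ 2 * L ^ 3) / l + B / (l * L ^ 3) / l ^ 2
          = 4 * B / (l ^ 3 * L ^ 3) * (1 / 2) := by
        field_simp
        ring
      rw [neg_neg, e]
      gcongr
      have : 3 / L ≤ 3 / 2 := by gcongr
      linarith)
    (fun l hl => by
      have h2 := hlog l hl
      have hl0 := hl.1
      set L := -Real.log l
      have hL : 0 < L := by linarith
      have e : B / (l * L ^ 3) / l = B / (l ^ 2 * L ^ 3) := by field_simp
      rw [e]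
      gcongr
      linarith) ht0).2 (b / √t) ⟨by positivity, div_lt_self hb (by
        rw [Real.lt_sqrt (by norm_num)]; linarith)⟩
  refine hmain.trans ?_
  have hst : 0 < √t := Real.sqrt_pos.mpr ht0
  have hlt : 0 < Real.log t := Real.log_pos ht
  have hLρ : -Real.log (b / √t) = -Real.log b + Real.log t / 2 := by
    rw [Real.log_div hb.ne' hst.ne', Real.log_sqrt ht0.le]
    ring
  have hLb : 2 ≤ -Real.log b := by
    have := Real.log_le_log hb hb2
    rw [Real.log_exp] at this
    linarith
  have hsq : Real.log (b / √t) ^ 2 = (-Real.log (b / √t)) ^ 2 := by ring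
  rw [Real.log_zero, hsq, hLρ, div_pow, Real.sq_sqrt ht0.le]
  set L := -Real.log b + Real.log t / 2
  have hL2 : 2 ≤ L := by simp only [L]; linarith
  have hL : Real.log t / 2 ≤ L := by simp only [L]; linarith
  have hLsq : 1 / L ^ 2 ≤ 4 / Real.log t ^ 2 := by
    have : (Real.log t / 2) ^ 2 ≤ L ^ 2 := by gcongr
    rw [div_le_div_iff₀ (by positivity) (by positivity)]
    linarith
  have hL3 : 1 / L ^ 3 ≤ 2 / Real.log t ^ 2 := by
    have e : 1 / L ^ 3 = 1 / L ^ 2 * (1 / L) := by field_simp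
    have h1 : 1 / L ≤ 1 / 2 := by gcongr
    rw [e]
    calc 1 / L ^ 2 * (1 / L) ≤ 4 / Real.log t ^ 2 * (1 / 2) := by gcongr
      _ = 2 / Real.log t ^ 2 := by ring
  have e1 : B / 2 / L ^ 2 - B / 2 / 0 ^ 2 + 4 * B / (b ^ 2 / t * L ^ 3) / t
      = B / 2 * (1 / L ^ 2) + 4 * B / b ^ 2 * (1 / L ^ 3) := by
    simp
    field_simp
  rw [e1]
  calc 1 / (2 * t) * (B / 2 * (1 / L ^ 2) + 4 * B / b ^ 2 * (1 / L ^ 3))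
      ≤ 1 / (2 * t) * (B / 2 * (4 / Real.log t ^ 2) + 4 * B / b ^ 2 * (2 / Real.log t ^ 2)) := by
        gcongr
    _ = (1 + 4 / b ^ 2) * B / (t * Real.log t ^ 2) := by
        field_simp
        ring

/-! ### Symbol classes -/

/-- Amplitudes vanishing like `lam^{1/2}`, whose second derivative is controlled by `R`. -/
def HalfSymbol (b B R : ℝ) (F : ℝ → ℂ) : Prop :=
  C2Bound b F (fun l => B * √l) (fun l => B / √l) (fun l => B * (1 / (l * √l) + R / √l))

/-- Symbols of order zero. -/
def ZeroSymbol (b B : ℝ) (F : ℝ → ℂ) : Prop :=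
  C2Bound b F (fun _ => B) (fun l => B / l) (fun l => B / l ^ 2)

/-- Symbols of size `1 / |log lam|`. -/
def LogSymbol (b B : ℝ) (F : ℝ → ℂ) : Prop :=
  C2Bound b F (fun l => B / (-Real.log l)) (fun l => B / (l * (-Real.log l) ^ 2))
    (fun l => B / (l ^ 2 * (-Real.log l) ^ 2))

lemma HalfSymbol.mono {b B B' R R' : ℝ} {F : ℝ → ℂ} (hF : HalfSymbol b B R F) (hB : B ≤ B')
    (hB' : 0 ≤ B') (hR0 : 0 ≤ R) (hR : R ≤ R') : HalfSymbol b B' R' F :=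
  C2Bound.mono hF fun l hl => by
    have hs : 0 < √l := Real.sqrt_pos.mpr hl.1
    have := hl.1
    refine ⟨by gcongr, by gcongr, by gcongr⟩

lemma HalfSymbol.add {b B B' R : ℝ} {F H : ℝ → ℂ} (hF : HalfSymbol b B R F)
    (hH : HalfSymbol b B' R H) : HalfSymbol b (B + B') R (fun l => F l + H l) :=
  (C2Bound.add hF hH).mono fun l _ => ⟨by linarith, by rw [add_div], by linarith⟩

lemma HalfSymbol.const_mul {b B R : ℝ} {F : ℝ → ℂ} (hF : HalfSymbol b B R F) (c : ℂ) :
    HalfSymbol b (‖c‖ * B) R (fun l => c * F l) :=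
  (C2Bound.const_mul c hF).mono fun l _ =>
    ⟨by rw [mul_assoc], by rw [mul_div_assoc], by rw [mul_assoc]⟩

/-- Differentiating either factor costs one power of `λ`, so the class is preserved; `4 = 1 + 2 + 1`
is the Leibniz sum for the second derivative. -/
lemma ZeroSymbol.mul_half {b B₀ B R : ℝ} {g F : ℝ → ℂ} (hg : ZeroSymbol b B₀ g)
    (hF : HalfSymbol b B R F) (hB₀ : 0 ≤ B₀) (hB : 0 ≤ B) (hR : 0 ≤ R) :
    HalfSymbol b (4 * (B₀ * B)) R (fun l => g l * F l) :=
  (C2Bound.mul hg hF).mono fun l hl => by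
    have hl0 := hl.1
    have hs : 0 < √l := Real.sqrt_pos.mpr hl0
    have hs2 : √l * √l = l := Real.mul_self_sqrt hl0.le
    have e0 : B₀ / l * (B * √l) = B₀ * B / √l := by
      field_simp
      rw [Real.sq_sqrt hl0.le]
      ring
    have e2 : B₀ / l ^ 2 * (B * √l) = B₀ * B * (1 / (l * √l)) := by
      field_simp
      rw [Real.sq_sqrt hl0.le]
      ring
    have e3 : B₀ / l * (B / √l) = B₀ * B * (1 / (l * √l)) := by field_simp
    have p0 : 0 ≤ B₀ * B * √l := by positivity
    have p1 : 0 ≤ B₀ * B / √l := by positivity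
    have p2 : 0 ≤ B₀ * B * (1 / (l * √l)) := by positivity
    have p3 : 0 ≤ B₀ * B * (R / √l) := by positivity
    refine ⟨by linarith, ?_, ?_⟩
    · rw [e0]
      have : 4 * (B₀ * B) / √l = 4 * (B₀ * B / √l) := by ring
      have : B₀ * (B / √l) = B₀ * B / √l := by ring
      linarith
    · rw [e2, e3]
      linarith

/-- The product even vanishes like `λ`; on `(0, 1]` this is relaxed to `√λ` to remain in the class.
The parameters add because each enters only through the second derivative of its own factor. -/
lemma HalfSymbol.mul {b B B' R R' : ℝ} {F H : ℝ → ℂ} (hF : HalfSymbol b B R F)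
    (hH : HalfSymbol b B' R' H) (hb : b ≤ 1) (hB : 0 ≤ B) (hB' : 0 ≤ B') (hR : 0 ≤ R)
    (hR' : 0 ≤ R') : HalfSymbol b (4 * (B * B')) (R + R') (fun l => F l * H l) :=
  (C2Bound.mul hF hH).mono fun l hl => by
    have hl0 := hl.1
    have hl1 : l ≤ 1 := hl.2.le.trans hb
    obtain ⟨q1, q2, q3⟩ := sq_le_sqrt hl0 hl1
    have hs : 0 < √l := Real.sqrt_pos.mpr hl0
    have hs2 : √l * √l = l := Real.mul_self_sqrt hl0.le
    have e0 : B * √l * (B' * √l) = B * B' * l := by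
      calc B * √l * (B' * √l) = B * B' * (√l * √l) := by ring
        _ = B * B' * l := by rw [hs2]
    have e1 : B / √l * (B' * √l) = B * B' := by field_simp
    have e1' : B * √l * (B' / √l) = B * B' := by field_simp
    have e2 : B * (1 / (l * √l) + R / √l) * (B' * √l) = B * B' * (1 / l + R) := by field_simp
    have e2' : B * √l * (B' * (1 / (l * √l) + R' / √l)) = B * B' * (1 / l + R') := by field_simp
    have e3 : B / √l * (B' / √l) = B * B' * (1 / l) := by
      rw [div_mul_div_comm, hs2]; ring
    have p : 0 ≤ B * B' := by positivity
    have g1 : 1 / l ≤ 1 / (l * √l) := one_div_le_one_div_of_le (by positivity) (by nlinarith)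
    have g2 : R ≤ R / √l := le_div_self hR hs q2
    have g3 : R' ≤ R' / √l := le_div_self hR' hs q2
    have g4 : 0 ≤ R / √l := by positivity
    have g5 : 0 ≤ R' / √l := by positivity
    refine ⟨?_, ?_, ?_⟩
    · rw [e0]
      nlinarith
    · rw [e1, e1']
      have : 4 * (B * B') / √l = 4 * (B * B') * (1 / √l) := by ring
      nlinarith
    · rw [e2, e2', e3]
      have : B * B' * (1 / l + R) + 2 * (B * B' * (1 / l)) + B * B' * (1 / l + R')
          = B * B' * (4 * (1 / l) + R + R') := by ring
      rw [this, add_div]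
      have := mul_le_mul_of_nonneg_left (show 4 * (1 / l) + R + R'
        ≤ 4 * (1 / (l * √l) + (R / √l + R' / √l)) by linarith) p
      linarith

lemma LogSymbol.zeroSymbol {b B : ℝ} {F : ℝ → ℂ} (hF : LogSymbol b B F) (hB : 0 ≤ B)
    (hb : b ≤ Real.exp (-2)) : ZeroSymbol b B F :=
  C2Bound.mono hF fun l hl => by
    have hl0 := hl.1
    have h := Real.log_le_log hl0 (hl.2.le.trans hb)
    rw [Real.log_exp] at h
    set L := -Real.log l with hL
    have h2 : 1 ≤ L := by linarith
    have h3 : 1 ≤ L ^ 2 := one_le_pow₀ h2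
    refine ⟨div_le_self hB h2, ?_, ?_⟩
    · gcongr
      nlinarith
    · gcongr
      nlinarith [sq_nonneg l]

/-- The amplitude of the term of order `(t log² t)⁻¹`. -/
lemma LogSymbol.cutoff_mul_mul {b B₁ B₂ Bχ : ℝ} {F H χ : ℝ → ℂ} (hF : LogSymbol b B₁ F)
    (hH : LogSymbol b B₂ H) (hχ : C2Bound b χ (fun _ => Bχ) (fun _ => Bχ) (fun _ => Bχ))
    (hB₁ : 0 ≤ B₁) (hB₂ : 0 ≤ B₂) (hBχ : 0 ≤ Bχ) (hb : b ≤ Real.exp (-2)) :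
    C2Bound b (fun l => χ l * (F l * H l))
      (fun l => 9 * (Bχ * (B₁ * B₂)) / Real.log l ^ 2)
      (fun l => 9 * (Bχ * (B₁ * B₂)) / (l * (-Real.log l) ^ 3))
      (fun l => 9 * (Bχ * (B₁ * B₂)) / (l ^ 2 * (-Real.log l) ^ 3)) :=
  (C2Bound.mul hχ (C2Bound.mul hF hH)).mono fun l hl => by
    have hl0 := hl.1
    have h := Real.log_le_log hl0 (hl.2.le.trans hb)
    rw [Real.log_exp] at h
    have hlog := Real.log_le_sub_one_of_pos (inv_pos.mpr hl0)
    rw [Real.log_inv] at hlog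
    have hsq : Real.log l ^ 2 = (-Real.log l) ^ 2 := by ring
    rw [hsq]
    set L := -Real.log l with hL
    have h2 : 2 ≤ L := by linarith
    have hL0 : 0 < L := by linarith
    have hlL : l * L ≤ 1 := by
      have : l * L ≤ l * l⁻¹ := by gcongr; linarith
      rwa [mul_inv_cancel₀ hl0.ne'] at this
    have hl1 : l ≤ 1 := by nlinarith
    set D := Bχ * (B₁ * B₂) with hD
    have hD0 : 0 ≤ D := by positivity
    have e0 : Bχ * (B₁ / L * (B₂ / L)) = D * (1 / L ^ 2) := by rw [hD]; field_simp
    have e1 : Bχ * (B₁ / (l * L ^ 2) * (B₂ / L) + B₁ / L * (B₂ / (l * L ^ 2)))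
        = D * (2 / (l * L ^ 3)) := by rw [hD]; field_simp; ring
    have e2 : Bχ * (B₁ / (l ^ 2 * L ^ 2) * (B₂ / L)
        + 2 * (B₁ / (l * L ^ 2) * (B₂ / (l * L ^ 2))) + B₁ / L * (B₂ / (l ^ 2 * L ^ 2)))
        = D * (2 / (l ^ 2 * L ^ 3) + 2 / (l ^ 2 * L ^ 4)) := by rw [hD]; field_simp; ring
    -- A derivative falling on the cut-off does not improve `1/L²`; the missing factor `1/(λL)` is
    -- supplied by `λL ≤ 1`. The second derivative then collects `1 + 4 + 2 + 2 = 9`.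
    have f0 : 1 / L ^ 2 ≤ 1 / (l * L ^ 3) := by
      refine one_div_le_one_div_of_le (by positivity) ?_
      have : l * L ^ 3 = l * L * L ^ 2 := by ring
      rw [this]
      exact mul_le_of_le_one_left (by positivity) hlL
    have f1 : 1 / (l * L ^ 3) ≤ 1 / (l ^ 2 * L ^ 3) := by
      refine one_div_le_one_div_of_le (by positivity) ?_
      gcongr
      nlinarith
    have f2 : 1 / (l ^ 2 * L ^ 4) ≤ 1 / (l ^ 2 * L ^ 3) := by
      refine one_div_le_one_div_of_le (by positivity) ?_
      gcongr
      · linarith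
      · norm_num
    have g : ∀ y : ℝ, 9 * D / y = D * (9 * (1 / y)) := fun y => by ring
    have k : ∀ y : ℝ, 2 / y = 2 * (1 / y) := fun y => by ring
    have z0 : 0 < 1 / L ^ 2 := by positivity
    have z1 : 0 < 1 / (l * L ^ 3) := by positivity
    refine ⟨?_, ?_, ?_⟩
    · rw [e0, g]
      gcongr
      linarith
    · rw [e0, e1, g, k, ← mul_add]
      gcongr
      linarith
    · have e3 : 2 * (Bχ * (B₁ / (l * L ^ 2) * (B₂ / L) + B₁ / L * (B₂ / (l * L ^ 2))))
          = D * (4 * (1 / (l * L ^ 3))) := by rw [e1]; ring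
      rw [e0, e3, e2, g, k, k, ← mul_add, ← mul_add]
      gcongr
      linarith

/-- The reciprocal of a function with a logarithmic singularity at the origin. -/
lemma logSymbol_inv {A b : ℝ} {κ : ℂ} {h : ℝ → ℂ} (hA : 0 < A) (hb : b ≤ Real.exp (-2))
    (hbκ : b ≤ Real.exp (-(2 * ‖κ‖ / A)))
    (hh : ∀ l, 0 < l → h l = A * (-Real.log l : ℝ) + κ) :
    (∀ l ∈ Ioo 0 b, h l ≠ 0) ∧ LogSymbol b (20 / A) (fun l => (h l)⁻¹) := by
  -- The second condition on `b` makes `κ` at most half of the logarithmic term, so `h` has no zero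
  -- on the interval.
  have hlow : ∀ l ∈ Ioo 0 b, 2 ≤ -Real.log l ∧ A / 2 * (-Real.log l) ≤ ‖h l‖ := by
    intro l hl
    have h1 := Real.log_le_log hl.1 (hl.2.le.trans hb)
    have h2 := Real.log_le_log hl.1 (hl.2.le.trans hbκ)
    rw [Real.log_exp] at h1 h2
    refine ⟨by linarith, ?_⟩
    rw [hh l hl.1]
    have h3 : 2 * ‖κ‖ ≤ A * (-Real.log l) := by
      have : 2 * ‖κ‖ / A ≤ -Real.log l := by linarith
      rw [div_le_iff₀ hA] at this
      linarith
    have h4 : ‖(A : ℂ) * ((-Real.log l : ℝ) : ℂ)‖ = A * (-Real.log l) := by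
      rw [norm_mul, Complex.norm_real, Complex.norm_real, Real.norm_of_nonneg hA.le,
        Real.norm_of_nonneg (by linarith)]
    have h5 := norm_sub_le_norm_add ((A : ℂ) * ((-Real.log l : ℝ) : ℂ)) κ
    rw [h4] at h5
    linarith
  have hne : ∀ l ∈ Ioo 0 b, h l ≠ 0 := by
    intro l hl h0
    obtain ⟨h1, h2⟩ := hlow l hl
    rw [h0, norm_zero] at h2
    nlinarith
  have hd : ∀ l : ℝ, 0 < l → HasDerivAt h (-((A : ℂ) / (l : ℂ))) l := by
    intro l hl
    have h1 : HasDerivAt (fun l : ℝ => (A : ℂ) * ((-Real.log l : ℝ) : ℂ) + κ)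
        (-((A : ℂ) / (l : ℂ))) l := by
      refine ((((Real.hasDerivAt_log hl.ne').neg.ofReal_comp).const_mul (A : ℂ)).add_const
        κ).congr_deriv ?_
      push_cast
      ring
    exact h1.congr_of_eventuallyEq (eventually_of_mem (Ioi_mem_nhds hl) hh)
  refine ⟨hne, fun l => A / l * ((h l)⁻¹) ^ 2,
    fun l => -(A / l ^ 2) * ((h l)⁻¹) ^ 2 + 2 * (A / l) ^ 2 * ((h l)⁻¹) ^ 3, fun l hl => ?_⟩
  obtain ⟨hL, hhl⟩ := hlow l hl
  have hl0 := hl.1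
  have hlc : (l : ℂ) ≠ 0 := by exact_mod_cast hl0.ne'
  have h0 := hne l hl
  have hdi : HasDerivAt (fun l => (h l)⁻¹) (A / l * ((h l)⁻¹) ^ 2) l := by
    refine ((hd l hl0).inv h0).congr_deriv ?_
    field_simp
  have hinv : ‖(h l)⁻¹‖ ≤ 2 / (A * -Real.log l) := by
    rw [norm_inv, ← one_div, div_le_div_iff₀ (norm_pos_iff.mpr h0) (by nlinarith)]
    linarith
  set L := -Real.log l with hLdef
  have hL0 : 0 < L := by linarith
  have hnl : ‖(l : ℂ)‖ = l := by rw [Complex.norm_real, Real.norm_of_nonneg hl0.le]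
  have hnA : ‖(A : ℂ)‖ = A := by rw [Complex.norm_real, Real.norm_of_nonneg hA.le]
  refine ⟨hdi, ?_, ?_, ?_, ?_⟩
  · have h1 : HasDerivAt (fun l : ℝ => (A : ℂ) / l) (-(A / l ^ 2)) l := by
      refine ((hasDerivAt_const (l : ℂ) (A : ℂ)).div (hasDerivAt_id (l : ℂ))
        hlc).comp_ofReal.congr_deriv ?_
      simp only [id]
      field_simp
      ring
    refine (h1.mul (hdi.pow 2)).congr_deriv ?_
    simp only [Pi.pow_apply]
    push_cast
    ring
  · refine hinv.trans ?_
    change 2 / (A * L) ≤ 20 / A / L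
    rw [div_div]
    gcongr
    norm_num
  · rw [norm_mul, norm_div, norm_pow, hnl, hnA]
    calc A / l * ‖(h l)⁻¹‖ ^ 2 ≤ A / l * (2 / (A * L)) ^ 2 := by gcongr
      _ = 4 / A / (l * L ^ 2) := by field_simp; ring
      _ ≤ 20 / A / (l * L ^ 2) := by gcongr; norm_num
  · have e1 : ‖-((A : ℂ) / l ^ 2) * ((h l)⁻¹) ^ 2‖ ≤ 4 / A / (l ^ 2 * L ^ 2) := by
      rw [norm_mul, norm_neg, norm_div, norm_pow, norm_pow, hnl, hnA]
      calc A / l ^ 2 * ‖(h l)⁻¹‖ ^ 2 ≤ A / l ^ 2 * (2 / (A * L)) ^ 2 := by gcongr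
        _ = 4 / A / (l ^ 2 * L ^ 2) := by field_simp; ring
    have e2 : ‖2 * ((A : ℂ) / l) ^ 2 * ((h l)⁻¹) ^ 3‖ ≤ 16 / A / (l ^ 2 * L ^ 2) := by
      rw [norm_mul, norm_mul, norm_pow, norm_pow, norm_div, hnl, hnA, Complex.norm_ofNat]
      calc 2 * (A / l) ^ 2 * ‖(h l)⁻¹‖ ^ 3 ≤ 2 * (A / l) ^ 2 * (2 / (A * L)) ^ 3 := by gcongr
        _ = 16 / A / (l ^ 2 * L ^ 2) * (1 / L) := by field_simp; ring
        _ ≤ 16 / A / (l ^ 2 * L ^ 2) * 1 := by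
          gcongr
          rw [div_le_one hL0]
          linarith
        _ = 16 / A / (l ^ 2 * L ^ 2) := mul_one _
    refine (norm_add_le_of_le e1 e2).trans (le_of_eq ?_)
    change _ = 20 / A / (l ^ 2 * L ^ 2)
    field_simp
    norm_num

/-- Substituting `z = λr`, two derivatives bring out `r²`, and `r² (λr)^{-1/2} = √r · (r/√λ)`. This
is why `HalfSymbol` carries a separate parameter for the second derivative. -/
lemma halfSymbol_resolventRemainder : ∃ C, 0 ≤ C ∧ ∀ s : ℝ, s ^ 2 = 1 → ∀ b r : ℝ, 0 < r →
    HalfSymbol b (C * √r) r (fun l => resolventRemainder s (l * r)) := by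
  obtain ⟨C, hC, h⟩ := exists_resolventRemainder_bound
  refine ⟨C, hC, fun s hs b r hr => ?_⟩
  obtain ⟨f', f'', hf⟩ := h s hs
  refine ⟨fun l => r * f' (l * r), fun l => r * (r * f'' (l * r)), fun l hl => ?_⟩
  have hl0 := hl.1
  obtain ⟨d1, d2, b0, b1, b2⟩ := hf (l * r) (by positivity)
  have hsl : 0 < √l := Real.sqrt_pos.mpr hl0
  have hsr : 0 < √r := Real.sqrt_pos.mpr hr
  have hsr2 : √r * √r = r := Real.mul_self_sqrt hr.le
  have hmul : HasDerivAt (fun l => l * r) r l := by simpa using (hasDerivAt_id l).mul_const r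
  rw [Real.sqrt_mul hl0.le] at b0 b1 b2
  refine ⟨?_, ?_, by linarith, ?_, ?_⟩
  · refine (d1.scomp l hmul).congr_deriv ?_
    simp
  · refine ((d2.scomp l hmul).const_mul (r : ℂ)).congr_deriv ?_
    simp
  · rw [norm_mul, Complex.norm_real, Real.norm_of_nonneg hr.le]
    calc r * ‖f' (l * r)‖ ≤ √r * √r * (C / (√l * √r)) := by rw [hsr2]; gcongr
      _ = C * √r / √l := by field_simp
  · rw [norm_mul, norm_mul, Complex.norm_real, Real.norm_of_nonneg hr.le]
    calc r * (r * ‖f'' (l * r)‖) ≤ r * (√r * √r * (C / (√l * √r))) := by rw [hsr2]; gcongr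
      _ = C * √r * (r / √l) := by field_simp
      _ ≤ C * √r * (1 / (l * √l) + r / √l) := by
        gcongr
        exact le_add_of_nonneg_left (by positivity)

lemma IsCutoff.c2Bound {l₁ : ℝ} {χ : ℝ → ℝ} (hχ : IsCutoff l₁ χ) : ∃ B, 0 ≤ B ∧ ∀ b ≤ 1,
    C2Bound b (fun l => (χ l : ℂ)) (fun _ => B) (fun _ => B) (fun _ => B) := by
  have h0 := hχ.smooth.continuous
  have h1 : ContDiff ℝ ∞ (deriv χ) := (contDiff_infty_iff_deriv.mp hχ.smooth).2
  have h2 : ContDiff ℝ ∞ (deriv (deriv χ)) := (contDiff_infty_iff_deriv.mp h1).2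
  obtain ⟨B₀, hB₀⟩ := (isCompact_Icc (a := (0 : ℝ)) (b := 1)).exists_bound_of_continuousOn
    h0.continuousOn
  obtain ⟨B₁, hB₁⟩ := (isCompact_Icc (a := (0 : ℝ)) (b := 1)).exists_bound_of_continuousOn
    h1.continuous.continuousOn
  obtain ⟨B₂, hB₂⟩ := (isCompact_Icc (a := (0 : ℝ)) (b := 1)).exists_bound_of_continuousOn
    h2.continuous.continuousOn
  have p0 : 0 ≤ B₀ := (norm_nonneg _).trans (hB₀ 0 (by simp))
  have p1 : 0 ≤ B₁ := (norm_nonneg _).trans (hB₁ 0 (by simp))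
  have p2 : 0 ≤ B₂ := (norm_nonneg _).trans (hB₂ 0 (by simp))
  refine ⟨B₀ + B₁ + B₂, by positivity, fun b hb => ⟨fun l => ((deriv χ l : ℝ) : ℂ),
    fun l => ((deriv (deriv χ) l : ℝ) : ℂ), fun l hl => ?_⟩⟩
  have hl' : l ∈ Icc (0 : ℝ) 1 := ⟨hl.1.le, hl.2.le.trans hb⟩
  have q0 := hB₀ l hl'
  have q1 := hB₁ l hl'
  have q2 := hB₂ l hl'
  refine ⟨((hχ.smooth.differentiable (by simp)) l).hasDerivAt.ofReal_comp,
    ((h1.differentiable (by simp)) l).hasDerivAt.ofReal_comp, ?_, ?_, ?_⟩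
  · rw [Complex.norm_real]; linarith
  · rw [Complex.norm_real]; linarith
  · rw [Complex.norm_real]; linarith

/-! ### Expansion of the product of two free resolvents -/

/-- The part of the free resolvent that does not depend on the spectral parameter, relative to
`h_±(lam) / ‖V‖₁`. -/
noncomputable def greenShift (V : Plane → ℝ) (r : ℝ) : ℂ :=
  -(1 / (2 * Real.pi)) * Real.log r - constC V / normOne V

/-- Splitting `log (λr)` isolates the dependence on `λ`; adding and subtracting `c/‖V‖₁` completes
that part to `h_±/‖V‖₁`. -/
lemma freeResolvent_eq {V : Plane → ℝ} (hN : normOne V ≠ 0) (s : ℝ) {l : ℝ} (hl : 0 < l)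
    {x y : Plane} (hxy : x ≠ y) :
    freeResolvent s l x y = hFun V s l / normOne V + greenShift V ‖x - y‖
      + resolventRemainder s (l * ‖x - y‖) := by
  have hr : ‖x - y‖ ≠ 0 := norm_ne_zero_iff.mpr (sub_ne_zero.mpr hxy)
  have hNc : (normOne V : ℂ) ≠ 0 := by exact_mod_cast hN
  have hpi : (Real.pi : ℂ) ≠ 0 := by exact_mod_cast Real.pi_ne_zero
  rw [freeResolvent, hFun, gFun, greenShift, resolventRemainder,
    Real.log_div (mul_ne_zero hl.ne' hr) two_ne_zero, Real.log_mul hl.ne' hr,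
    Real.log_div hl.ne' two_ne_zero]
  push_cast
  field_simp
  ring

/-- The part of `𝓡^±` containing a remainder of one of the two free resolvents. -/
noncomputable def remainderAmplitude (V : Plane → ℝ) (s r₁ r₂ l : ℝ) : ℂ :=
  1 / (normOne V : ℂ) * (resolventRemainder s (l * r₁) + resolventRemainder s (l * r₂))
    + (hFun V s l)⁻¹ * (greenShift V r₁ * resolventRemainder s (l * r₂)
      + greenShift V r₂ * resolventRemainder s (l * r₁)
      + resolventRemainder s (l * r₁) * resolventRemainder s (l * r₂))

/-- Only the terms `± i/4` depend on the sign. -/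
lemma hFun_sub (V : Plane → ℝ) (l : ℝ) :
    hFun V 1 l - hFun V (-1) l = Complex.I * normOne V / 2 := by
  simp only [hFun, gFun]
  push_cast
  ring

/-- Of the product expansion, the part linear in `greenShift` is the same for both signs and drops
out. The part with both factors `greenShift` gains a second `1/h`, since a difference of reciprocals
contains their product. -/
lemma calR_sub_eq {V : Plane → ℝ} (hN : normOne V ≠ 0) {l : ℝ} (hl : 0 < l)
    (hp : hFun V 1 l ≠ 0) (hm : hFun V (-1) l ≠ 0) {x x₁ y₁ y : Plane} (hx : x ≠ x₁)
    (hy : y₁ ≠ y) :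
    calR V (-1) l x x₁ y₁ y - calR V 1 l x x₁ y₁ y = -(Complex.I / (2 * normOne V))
      + greenShift V ‖x - x₁‖ * greenShift V ‖y₁ - y‖ * (Complex.I * normOne V / 2)
        * ((hFun V (-1) l)⁻¹ * (hFun V 1 l)⁻¹)
      + (remainderAmplitude V (-1) ‖x - x₁‖ ‖y₁ - y‖ l
        - remainderAmplitude V 1 ‖x - x₁‖ ‖y₁ - y‖ l) := by
  have hNc : (normOne V : ℂ) ≠ 0 := by exact_mod_cast hN
  have key : ∀ s, hFun V s l ≠ 0 → calR V s l x x₁ y₁ y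
      = hFun V s l / (normOne V : ℂ) ^ 2
        + (greenShift V ‖x - x₁‖ + greenShift V ‖y₁ - y‖) / normOne V
        + greenShift V ‖x - x₁‖ * greenShift V ‖y₁ - y‖ * (hFun V s l)⁻¹
        + remainderAmplitude V s ‖x - x₁‖ ‖y₁ - y‖ l := by
    intro s hs
    rw [calR, freeResolvent_eq hN s hl hx, freeResolvent_eq hN s hl hy, remainderAmplitude]
    field_simp
    ring
  have hinv : (hFun V (-1) l)⁻¹ - (hFun V 1 l)⁻¹
      = Complex.I * normOne V / 2 * ((hFun V (-1) l)⁻¹ * (hFun V 1 l)⁻¹) := by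
    rw [← hFun_sub V l]
    field_simp
  have hdiv : hFun V (-1) l / (normOne V : ℂ) ^ 2 - hFun V 1 l / (normOne V : ℂ) ^ 2
      = -(Complex.I / (2 * normOne V)) := by
    rw [← sub_div, ← neg_sub, hFun_sub]
    field_simp
  rw [key _ hm, key _ hp]
  linear_combination hdiv + greenShift V ‖x - x₁‖ * greenShift V ‖y₁ - y‖ * hinv

lemma exists_norm_greenShift_le (V : Plane → ℝ) : ∃ C, 0 ≤ C ∧ ∀ r,
    ‖greenShift V r‖ ≤ C * (1 + |Real.log r|) := by
  refine ⟨1 + ‖constC V / normOne V‖, by positivity, fun r => ?_⟩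
  have hpi := Real.pi_gt_three
  have h1 : ‖-(1 / (2 * (Real.pi : ℂ))) * Real.log r‖ ≤ |Real.log r| := by
    rw [norm_mul, Complex.norm_real, Real.norm_eq_abs]
    refine mul_le_of_le_one_left (abs_nonneg _) ?_
    rw [norm_neg, norm_div, norm_mul, Complex.norm_real, Real.norm_of_nonneg Real.pi_pos.le,
      norm_one, Complex.norm_ofNat, div_le_one (by positivity)]
    linarith
  rw [greenShift]
  refine (norm_sub_le _ _).trans ?_
  have := mul_nonneg (norm_nonneg (constC V / normOne V)) (abs_nonneg (Real.log r))
  linarith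

/-- The logarithmic singularity of the free resolvent. -/
noncomputable def logFactor (r : ℝ) : ℝ := 1 + |Real.log r|

lemma one_le_logFactor (r : ℝ) : 1 ≤ logFactor r := le_add_of_nonneg_right (abs_nonneg _)

/-- Each summand contains at least one remainder, which supplies the `√λ`. The factor `1/h` is used
only as a symbol of order zero, and `2 + r₁ + r₂` dominates the parameter of every summand. -/
lemma exists_halfSymbol_remainderAmplitude {V : Plane → ℝ} {b : ℝ} (hb : b ≤ Real.exp (-2))
    {Bq : ℝ} (hBq : 0 ≤ Bq) (hq : ∀ s : ℝ, s ^ 2 = 1 → LogSymbol b Bq fun l => (hFun V s l)⁻¹) :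
    ∃ C, 0 ≤ C ∧ ∀ s : ℝ, s ^ 2 = 1 → ∀ r₁ r₂ : ℝ, 0 < r₁ → 0 < r₂ →
      HalfSymbol b (C * (logFactor r₁ * √(1 + r₁) * (logFactor r₂ * √(1 + r₂)))) (2 + r₁ + r₂)
        (remainderAmplitude V s r₁ r₂) := by
  obtain ⟨C, hC, hE⟩ := halfSymbol_resolventRemainder
  obtain ⟨K, hK, hG⟩ := exists_norm_greenShift_le V
  have hb1 : b ≤ 1 := hb.trans (by rw [Real.exp_le_one_iff]; norm_num)
  refine ⟨‖1 / (normOne V : ℂ)‖ * (2 * C) + 4 * (Bq * (2 * (K * C) + 4 * (C * C))),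
    by positivity, fun s hs r₁ r₂ h₁ h₂ => ?_⟩
  set L₁ := logFactor r₁
  set L₂ := logFactor r₂
  set w₁ := √(1 + r₁)
  set w₂ := √(1 + r₂)
  have hL₁ : 1 ≤ L₁ := one_le_logFactor r₁
  have hL₂ : 1 ≤ L₂ := one_le_logFactor r₂
  have hw₁ : 1 ≤ w₁ := Real.one_le_sqrt.mpr (by linarith)
  have hw₂ : 1 ≤ w₂ := Real.one_le_sqrt.mpr (by linarith)
  have hM₁ : w₁ ≤ L₁ * w₁ := le_mul_of_one_le_left (by linarith) hL₁
  have hM₂ : w₂ ≤ L₂ * w₂ := le_mul_of_one_le_left (by linarith) hL₂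
  set M := L₁ * w₁ * (L₂ * w₂) with hM
  have m1 : w₁ ≤ M := hM₁.trans (le_mul_of_one_le_right (by positivity) (hw₂.trans hM₂))
  have m2 : w₂ ≤ M := hM₂.trans (le_mul_of_one_le_left (by positivity) (hw₁.trans hM₁))
  have m3 : L₁ * w₂ ≤ M := by
    rw [hM]
    exact mul_le_mul (le_mul_of_one_le_right (by linarith) hw₁) hM₂ (by linarith) (by positivity)
  have m4 : L₂ * w₁ ≤ M := by
    rw [hM, mul_comm]
    exact mul_le_mul hM₁ (le_mul_of_one_le_right (by linarith) hw₂) (by linarith) (by positivity)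
  have m5 : w₁ * w₂ ≤ M := mul_le_mul hM₁ hM₂ (by linarith) (by positivity)
  have hM0 : 0 ≤ M := by positivity
  have hv₁ : √r₁ ≤ w₁ := Real.sqrt_le_sqrt (by linarith)
  have hv₂ : √r₂ ≤ w₂ := Real.sqrt_le_sqrt (by linarith)
  set R := 2 + r₁ + r₂ with hR
  have e₁ := hE s hs b r₁ h₁
  have e₂ := hE s hs b r₂ h₂
  have E₁ : HalfSymbol b (C * M) R fun l => resolventRemainder s (l * r₁) :=
    e₁.mono (by gcongr; linarith) (by positivity) h₁.le (by linarith)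
  have E₂ : HalfSymbol b (C * M) R fun l => resolventRemainder s (l * r₂) :=
    e₂.mono (by gcongr; linarith) (by positivity) h₂.le (by linarith)
  have E₁₂ : HalfSymbol b (4 * (C * C) * M) R
      fun l => resolventRemainder s (l * r₁) * resolventRemainder s (l * r₂) := by
    refine (e₁.mul e₂ hb1 (by positivity) (by positivity) h₁.le h₂.le).mono ?_ (by positivity)
      (by positivity) (by linarith)
    calc 4 * (C * √r₁ * (C * √r₂)) = 4 * (C * C) * (√r₁ * √r₂) := by ring
      _ ≤ 4 * (C * C) * M := by
        gcongr
        exact (mul_le_mul hv₁ hv₂ (by positivity) (by positivity)).trans m5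
  have G₂ : HalfSymbol b (K * C * M) R
      fun l => greenShift V r₁ * resolventRemainder s (l * r₂) := by
    refine (e₂.const_mul _).mono ?_ (by positivity) h₂.le (by linarith)
    calc ‖greenShift V r₁‖ * (C * √r₂) ≤ K * L₁ * (C * w₂) := by gcongr; exact hG r₁
      _ = K * C * (L₁ * w₂) := by ring
      _ ≤ K * C * M := by gcongr
  have G₁ : HalfSymbol b (K * C * M) R
      fun l => greenShift V r₂ * resolventRemainder s (l * r₁) := by
    refine (e₁.const_mul _).mono ?_ (by positivity) h₁.le (by linarith)
    calc ‖greenShift V r₂‖ * (C * √r₁) ≤ K * L₂ * (C * w₁) := by gcongr; exact hG r₂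
      _ = K * C * (L₂ * w₁) := by ring
      _ ≤ K * C * M := by gcongr
  have hsum := ((E₁.add E₂).const_mul (1 / (normOne V : ℂ))).add
    (((hq s hs).zeroSymbol hBq hb).mul_half ((G₂.add G₁).add E₁₂) hBq (by positivity)
      (by positivity))
  refine hsum.mono (le_of_eq ?_) (by positivity) (by positivity) le_rfl
  ring

lemma hFun_eq (V : Plane → ℝ) (s : ℝ) {l : ℝ} (hl : 0 < l) :
    hFun V s l = ((normOne V / (2 * Real.pi) : ℝ) : ℂ) * ((-Real.log l : ℝ) : ℂ)
      + (normOne V * (s * (Complex.I / 4)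
        + (Real.log 2 - Real.eulerMascheroniConstant) / (2 * Real.pi)) + constC V) := by
  rw [hFun, gFun, Real.log_div hl.ne' two_ne_zero]
  push_cast
  ring

lemma exists_logSymbol_inv_hFun {V : Plane → ℝ} (hN : 0 < normOne V) : ∃ b, 0 < b ∧
    b ≤ Real.exp (-2) ∧ ∃ B, 0 ≤ B ∧ ∀ s : ℝ, s ^ 2 = 1 →
      (∀ l ∈ Ioo 0 b, hFun V s l ≠ 0) ∧ LogSymbol b B fun l => (hFun V s l)⁻¹ := by
  set A := normOne V / (2 * Real.pi) with hA
  have hA0 : 0 < A := by have := Real.pi_pos; positivity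
  set κ : ℝ → ℂ := fun s => normOne V * (s * (Complex.I / 4)
        + (Real.log 2 - Real.eulerMascheroniConstant) / (2 * Real.pi)) + constC V with hκ
  -- The minimum serves both signs at once, since the amplitude involves `h_+` and `h_-` on the same
  -- interval.
  set b := min (Real.exp (-2)) (min (Real.exp (-(2 * ‖κ 1‖ / A))) (Real.exp (-(2 * ‖κ (-1)‖ / A))))
  have hb2 : b ≤ Real.exp (-2) := min_le_left _ _
  refine ⟨b, by positivity, hb2, 20 / A, by positivity, fun s hs => ?_⟩
  have hbκ : b ≤ Real.exp (-(2 * ‖κ s‖ / A)) := by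
    rcases mul_self_eq_one_iff.mp ((sq s).symm.trans hs) with rfl | rfl
    · exact (min_le_right _ _).trans (min_le_left _ _)
    · exact (min_le_right _ _).trans (min_le_right _ _)
  exact logSymbol_inv hA0 hb2 hbκ fun l hl => hFun_eq V s hl

/-! ### The pointwise estimate of the spectral integral -/

/-- The integrand `e^{it lam²} lam χ(lam) [𝓡⁻ - 𝓡⁺]`. -/
noncomputable def resolventIntegrand (V : Plane → ℝ) (χ : ℝ → ℝ) (t : ℝ) (x y : Plane)
    (p : Plane × Plane) (l : ℝ) : ℂ :=
  phase t l * l * (χ l * (calR V (-1) l x p.1 p.2 y - calR V 1 l x p.1 p.2 y))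

/-- The majorant of the free resolvent in the remainder term. -/
noncomputable def growthFactor (α r : ℝ) : ℝ := logFactor r * (1 + r) ^ (1 / 2 + α)

/-- The oscillatory estimate yields `(2 + r₁ + r₂)^α`, which does not factor. The inequality `2 + r₁
+ r₂ ≤ 2 (1 + r₁)(1 + r₂)` separates the variables, as the later Cauchy–Schwarz argument needs. -/
lemma rpow_two_add_add_le {α r₁ r₂ : ℝ} (hα : 0 ≤ α) (hα1 : α ≤ 1) (h₁ : 0 < r₁) (h₂ : 0 < r₂) :
    logFactor r₁ * √(1 + r₁) * (logFactor r₂ * √(1 + r₂)) * (2 + r₁ + r₂) ^ α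
      ≤ 2 * (growthFactor α r₁ * growthFactor α r₂) := by
  have hR : (2 + r₁ + r₂) ^ α ≤ 2 * ((1 + r₁) ^ α * (1 + r₂) ^ α) := by
    calc (2 + r₁ + r₂) ^ α ≤ (2 * ((1 + r₁) * (1 + r₂))) ^ α := by
          gcongr
          nlinarith
      _ = 2 ^ α * ((1 + r₁) ^ α * (1 + r₂) ^ α) := by
          rw [Real.mul_rpow (by norm_num) (by positivity), Real.mul_rpow (by positivity)
            (by positivity)]
      _ ≤ 2 * ((1 + r₁) ^ α * (1 + r₂) ^ α) := by
          gcongr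
          calc (2 : ℝ) ^ α ≤ 2 ^ (1 : ℝ) := Real.rpow_le_rpow_of_exponent_le (by norm_num) hα1
            _ = 2 := Real.rpow_one 2
  have hL₁ := one_le_logFactor r₁
  have hL₂ := one_le_logFactor r₂
  calc logFactor r₁ * √(1 + r₁) * (logFactor r₂ * √(1 + r₂)) * (2 + r₁ + r₂) ^ α
      ≤ logFactor r₁ * √(1 + r₁) * (logFactor r₂ * √(1 + r₂))
        * (2 * ((1 + r₁) ^ α * (1 + r₂) ^ α)) := by gcongr
    _ = 2 * (growthFactor α r₁ * growthFactor α r₂) := by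
        rw [growthFactor, growthFactor, Real.rpow_add (by positivity), Real.rpow_add (by positivity),
          Real.sqrt_eq_rpow, Real.sqrt_eq_rpow]
        ring

/-- The amplitude splits into a constant, a logarithmic term and a remainder. Only the first has a
nonzero limit as `λ → 0`, and that limit produces the main term. -/
theorem exists_resolventIntegrand_estimate {V : Plane → ℝ} (hN : 0 < normOne V) {α : ℝ}
    (hα : 0 < α) (hα' : α ≤ 1 / 4) : ∃ lam₀, 0 < lam₀ ∧ ∀ lam₁ ≤ lam₀, 0 < lam₁ →
    ∀ χ : ℝ → ℝ, IsCutoff lam₁ χ → ∃ C, 0 ≤ C ∧ ∀ (x y : Plane) (p : Plane × Plane), x ≠ p.1 →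
      p.2 ≠ y → ∀ t : ℝ, 2 < t → IntegrableOn (resolventIntegrand V χ t x y p) (Ioi 0) ∧
        ‖(∫ l in Ioi 0, resolventIntegrand V χ t x y p l) - 1 / (4 * t * normOne V)‖
          ≤ C * (logFactor ‖x - p.1‖ * logFactor ‖p.2 - y‖ / (t * Real.log t ^ 2)
            + growthFactor α ‖x - p.1‖ * growthFactor α ‖p.2 - y‖ / t ^ (1 + α)) := by
  obtain ⟨b, hb0, hb2, Bq, hBq, hq⟩ := exists_logSymbol_inv_hFun hN
  obtain ⟨D, hD, hrem⟩ := exists_halfSymbol_remainderAmplitude (V := V) hb2 hBq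
    fun s hs => (hq s hs).2
  obtain ⟨K, hK, hG⟩ := exists_norm_greenShift_le V
  have hb1 : b ≤ 1 := hb2.trans (by rw [Real.exp_le_one_iff]; norm_num)
  -- Halving keeps the support of the cut-off strictly below `b`, so that no boundary term arises
  -- there.
  refine ⟨b / 2, by positivity, fun lam₁ hlam hlam0 χ hχ => ?_⟩
  have hlb : lam₁ < b := by linarith
  obtain ⟨Bχ, hBχ, hχb⟩ := hχ.c2Bound
  have hχC := hχb b hb1
  have hχvan : ∀ l, lam₁ < l → χ l = 0 := by
    intro l hl
    by_contra h
    exact absurd (hχ.support_subset h).2 (not_le.mpr hl)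
  have hχ0 : χ 0 = 1 := hχ.eq_one 0 (by simpa using hlam0)
  set N := normOne V
  have hNc : (N : ℂ) ≠ 0 := by exact_mod_cast hN.ne'
  set Q := 9 * (Bχ * (Bq * Bq)) with hQ
  refine ⟨3 * (Bχ / N) + (1 + 4 / b ^ 2) * (K * K * N * Q) + 48 * (Bχ * D), by positivity,
    fun x y p hx hy t ht => ?_⟩
  set r₁ := ‖x - p.1‖
  set r₂ := ‖p.2 - y‖
  have hr₁ : 0 < r₁ := norm_pos_iff.mpr (sub_ne_zero.mpr hx)
  have hr₂ : 0 < r₂ := norm_pos_iff.mpr (sub_ne_zero.mpr hy)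
  have ht0 : 0 < t := by linarith
  have hsqb : ∀ l ∈ Ioo 0 b, 0 < √l ∧ l ≤ √l ∧ √l ≤ 1 ∧ 1 ≤ 1 / √l := fun l hl =>
    ⟨Real.sqrt_pos.mpr hl.1, sq_le_sqrt hl.1 (hl.2.le.trans hb1)⟩
  -- the leading term
  set F₁ : ℝ → ℂ := fun l => -(Complex.I / (2 * N)) * χ l with hF₁
  have hc₁ : ‖-(Complex.I / (2 * (N : ℂ)))‖ ≤ 1 / N := by
    rw [norm_neg, norm_div, norm_mul, Complex.norm_real, Complex.norm_I, Complex.norm_ofNat,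
      Real.norm_of_nonneg hN.le]
    gcongr
    linarith
  -- The cut-off does not vanish at `0`, but the half-order estimate needs a decaying weight only
  -- for its derivatives; these are bounded, and `R = 1` suffices.
  have B₁ : C2Bound b F₁ (fun _ => Bχ / N) (fun l => Bχ / N / √l)
      (fun l => Bχ / N * (1 / (l * √l) + 1 / √l)) := by
    refine (hχC.const_mul (-(Complex.I / (2 * N)))).mono fun l hl => ?_
    obtain ⟨q0, q1, q2, q3⟩ := hsqb l hl
    have hl0 := hl.1
    have h1 : ‖-(Complex.I / (2 * (N : ℂ)))‖ * Bχ ≤ Bχ / N := by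
      calc ‖-(Complex.I / (2 * (N : ℂ)))‖ * Bχ ≤ 1 / N * Bχ := by gcongr
        _ = Bχ / N := by ring
    refine ⟨h1, h1.trans ?_, h1.trans ?_⟩
    · exact le_div_self (by positivity) q0 q2
    · refine le_mul_of_one_le_right (by positivity) ?_
      have : 0 ≤ 1 / (l * √l) := by positivity
      linarith
  have V₁ : ∀ l, lam₁ < l → F₁ l = 0 := fun l hl => by simp [hF₁, hχvan l hl]
  have T₁ : Tendsto F₁ (𝓝[>] 0) (𝓝 (-(Complex.I / (2 * N)))) := by
    have h1 : Tendsto (fun l => (χ l : ℂ)) (𝓝[>] 0) (𝓝 ((χ 0 : ℝ) : ℂ)) :=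
      ((Complex.continuous_ofReal.comp hχ.smooth.continuous).tendsto 0).mono_left
        nhdsWithin_le_nhds
    rw [hχ0] at h1
    simpa only [Complex.ofReal_one, mul_one] using h1.const_mul (-(Complex.I / (2 * (N : ℂ))))
  have I₁ := intervalIntegrable_phase_mul hb0 B₁ (fun l _ => le_rfl) t
  have E₁ := norm_integral_phase_le_half hb0 hb1 hlb (by positivity) le_rfl B₁ V₁ T₁ hα hα'
    (t := t) (by linarith)
  -- the logarithmic term
  set k : ℂ := greenShift V r₁ * greenShift V r₂ * (Complex.I * N / 2) with hk
  have hk_le : ‖k‖ ≤ K * K * N * (logFactor r₁ * logFactor r₂) := by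
    have h3 : ‖Complex.I * (N : ℂ) / 2‖ ≤ N := by
      rw [norm_div, norm_mul, Complex.norm_real, Complex.norm_I, Complex.norm_ofNat,
        Real.norm_of_nonneg hN.le]
      linarith
    rw [hk, norm_mul, norm_mul]
    have := one_le_logFactor r₁
    have := one_le_logFactor r₂
    calc ‖greenShift V r₁‖ * ‖greenShift V r₂‖ * ‖Complex.I * (N : ℂ) / 2‖
        ≤ (K * logFactor r₁) * (K * logFactor r₂) * N := by
          gcongr
          · exact hG r₁
          · exact hG r₂
      _ = K * K * N * (logFactor r₁ * logFactor r₂) := by ring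
  set F₂ : ℝ → ℂ := fun l => k * (χ l * ((hFun V (-1) l)⁻¹ * (hFun V 1 l)⁻¹)) with hF₂
  have hlog := (((hq (-1) (by norm_num)).2).cutoff_mul_mul ((hq 1 (by norm_num)).2) hχC hBq hBq
    hBχ hb2).const_mul k
  have hlogl : ∀ l ∈ Ioo 0 b, 2 ≤ -Real.log l := fun l hl => by
    have := Real.log_le_log hl.1 (hl.2.le.trans hb2)
    rw [Real.log_exp] at this
    linarith
  have B₂ : C2Bound b F₂ (fun _ => ‖k‖ * Q) (fun l => ‖k‖ * Q / (l * (-Real.log l) ^ 3))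
      (fun l => ‖k‖ * Q / (l ^ 2 * (-Real.log l) ^ 3)) := by
    refine hlog.mono fun l hl => ⟨?_, (mul_div_assoc _ _ _).ge, (mul_div_assoc _ _ _).ge⟩
    have h2 := hlogl l hl
    gcongr
    refine div_le_self (by positivity) ?_
    nlinarith
  have V₂ : ∀ l, lam₁ < l → F₂ l = 0 := fun l hl => by simp [hF₂, hχvan l hl]
  have T₂ : Tendsto F₂ (𝓝[>] 0) (𝓝 0) := by
    refine squeeze_zero_norm' ?_ (by simpa using (tendsto_div_log_sq Q).const_mul ‖k‖)
    filter_upwards [Ioo_mem_nhdsGT hb0] with l hl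
    exact (hlog.deriv_spec l hl).2.2.1
  have I₂ := intervalIntegrable_phase_mul hb0 B₂ (fun l _ => le_rfl) t
  have E₂ := norm_integral_phase_le_log hb0 hb2 hlb (by positivity) B₂ V₂ T₂ (t := t) (by linarith)
  -- the remainder
  set M := logFactor r₁ * √(1 + r₁) * (logFactor r₂ * √(1 + r₂)) with hM
  have hM0 : 0 ≤ M := by
    have := one_le_logFactor r₁
    have := one_le_logFactor r₂
    positivity
  set F₃ : ℝ → ℂ := fun l => χ l * (remainderAmplitude V (-1) r₁ r₂ l
    + (-1) * remainderAmplitude V 1 r₁ r₂ l) with hF₃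
  have H₃ : HalfSymbol b (8 * (Bχ * D) * M) (2 + r₁ + r₂) F₃ := by
    have hz : ZeroSymbol b Bχ fun l => (χ l : ℂ) := hχC.mono fun l hl => by
      have hl0 := hl.1
      have hl1 : l ≤ 1 := hl.2.le.trans hb1
      exact ⟨le_rfl, le_div_self hBχ hl0 hl1,
        le_div_self hBχ (by positivity) (pow_le_one₀ hl0.le hl1)⟩
    have h := hz.mul_half ((hrem (-1) (by norm_num) r₁ r₂ hr₁ hr₂).add
      ((hrem 1 (by norm_num) r₁ r₂ hr₁ hr₂).const_mul (-1))) hBχ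
      (by simp only [norm_neg, norm_one]; positivity) (by positivity)
    refine h.mono (le_of_eq ?_) (by positivity) (by positivity) le_rfl
    rw [norm_neg, norm_one]
    ring
  have B₃ : C2Bound b F₃ (fun _ => 8 * (Bχ * D) * M) (fun l => 8 * (Bχ * D) * M / √l)
      (fun l => 8 * (Bχ * D) * M * (1 / (l * √l) + (2 + r₁ + r₂) / √l)) :=
    C2Bound.mono H₃ fun l hl =>
      ⟨mul_le_of_le_one_right (by positivity) (hsqb l hl).2.2.1, le_rfl, le_rfl⟩
  have V₃ : ∀ l, lam₁ < l → F₃ l = 0 := fun l hl => by simp [hF₃, hχvan l hl]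
  have T₃ : Tendsto F₃ (𝓝[>] 0) (𝓝 0) := by
    have h0 : Tendsto (fun l => 8 * (Bχ * D) * M * √l) (𝓝[>] 0) (𝓝 0) := by
      have h1 : Tendsto (fun l => 8 * (Bχ * D) * M * √l) (𝓝 0) (𝓝 (8 * (Bχ * D) * M * √0)) :=
        (continuous_const.mul Real.continuous_sqrt).tendsto 0
      rw [Real.sqrt_zero, mul_zero] at h1
      exact h1.mono_left nhdsWithin_le_nhds
    refine squeeze_zero_norm' ?_ h0
    filter_upwards [Ioo_mem_nhdsGT hb0] with l hl
    exact (C2Bound.deriv_spec H₃ l hl).2.2.1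
  have I₃ := intervalIntegrable_phase_mul hb0 B₃ (fun l _ => le_rfl) t
  have E₃ := norm_integral_phase_le_half hb0 hb1 hlb (by positivity) (by linarith) B₃ V₃ T₃ hα hα'
    (t := t) (by linarith)
  -- assembly
  have hsum : ∀ l ∈ Ioo 0 b, resolventIntegrand V χ t x y p l
      = phase t l * l * F₁ l + phase t l * l * F₂ l + phase t l * l * F₃ l := by
    intro l hl
    rw [resolventIntegrand, calR_sub_eq hN.ne' hl.1 ((hq 1 (by norm_num)).1 l hl)
      ((hq (-1) (by norm_num)).1 l hl) hx hy]
    simp only [hF₁, hF₂, hF₃, hk]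
    ring
  have hzero : ∀ l, l ∈ Ioi (0 : ℝ) \ Ioo 0 b → resolventIntegrand V χ t x y p l = 0 := by
    intro l hl
    have : b ≤ l := by
      by_contra h
      exact hl.2 ⟨hl.1, not_le.mp h⟩
    rw [resolventIntegrand, hχvan l (by linarith)]
    simp
  have hInt := (I₁.add I₂).add I₃
  rw [intervalIntegrable_iff_integrableOn_Ioo_of_le hb0.le] at hInt
  have hIntOn : IntegrableOn (resolventIntegrand V χ t x y p) (Ioo 0 b) :=
    hInt.congr_fun (fun l hl => (hsum l hl).symm) measurableSet_Ioo
  refine ⟨hIntOn.of_forall_sdiff_eq_zero measurableSet_Ioi hzero, ?_⟩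
  rw [setIntegral_eq_of_subset_of_forall_sdiff_eq_zero measurableSet_Ioi Ioo_subset_Ioi_self hzero,
    setIntegral_congr_fun measurableSet_Ioo hsum, ← integral_Ioc_eq_integral_Ioo,
    ← intervalIntegral.integral_of_le hb0.le, intervalIntegral.integral_add (I₁.add I₂) I₃,
    intervalIntegral.integral_add I₁ I₂]
  have htc : (t : ℂ) ≠ 0 := by exact_mod_cast ht0.ne'
  have hI := Complex.I_ne_zero
  -- The oscillatory estimates add `F₀/(2it)` to the integral, so the main contribution is the
  -- negative of this value.
  have hlead : -(Complex.I / (2 * (N : ℂ))) / (2 * Complex.I * t) = -(1 / (4 * t * N)) := by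
    field_simp
    norm_num
  rw [hlead] at E₁
  rw [zero_div, add_zero] at E₂ E₃
  have hre : ∀ a₁ a₂ a₃ c : ℂ, a₁ + a₂ + a₃ - c = (a₁ + -c) + a₂ + a₃ := fun _ _ _ _ => by ring
  rw [hre]
  refine (norm_add_le_of_le (norm_add_le_of_le E₁ E₂) E₃).trans ?_
  set Y := logFactor r₁ * logFactor r₂ / (t * Real.log t ^ 2) with hY
  set Z := growthFactor α r₁ * growthFactor α r₂ / t ^ (1 + α) with hZ
  have hL₁ := one_le_logFactor r₁
  have hL₂ := one_le_logFactor r₂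
  have htp : 0 < t ^ (1 + α) := by positivity
  have hlt : 0 < Real.log t := Real.log_pos (by linarith)
  have hY0 : 0 ≤ Y := by positivity
  have hg : ∀ r : ℝ, 0 < r → 1 ≤ growthFactor α r := fun r hr =>
    one_le_mul_of_one_le_of_one_le (one_le_logFactor r) (Real.one_le_rpow (by linarith)
      (by linarith))
  have hZ1 : 1 / t ^ (1 + α) ≤ Z := by
    rw [hZ]
    gcongr
    exact one_le_mul_of_one_le_of_one_le (hg r₁ hr₁) (hg r₂ hr₂)
  have hZ0 : 0 ≤ Z := le_trans (by positivity) hZ1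
  have b1 : 3 * (Bχ / N * 1 ^ α / t ^ (1 + α)) ≤ 3 * (Bχ / N) * Z := by
    rw [Real.one_rpow, mul_one]
    calc 3 * (Bχ / N / t ^ (1 + α)) = 3 * (Bχ / N) * (1 / t ^ (1 + α)) := by ring
      _ ≤ 3 * (Bχ / N) * Z := by gcongr
  have b2 : (1 + 4 / b ^ 2) * (‖k‖ * Q) / (t * Real.log t ^ 2)
      ≤ (1 + 4 / b ^ 2) * (K * K * N * Q) * Y := by
    calc (1 + 4 / b ^ 2) * (‖k‖ * Q) / (t * Real.log t ^ 2)
        ≤ (1 + 4 / b ^ 2) * (K * K * N * (logFactor r₁ * logFactor r₂) * Q)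
          / (t * Real.log t ^ 2) := by gcongr
      _ = (1 + 4 / b ^ 2) * (K * K * N * Q) * Y := by rw [hY]; ring
  have b3 : 3 * (8 * (Bχ * D) * M * (2 + r₁ + r₂) ^ α / t ^ (1 + α)) ≤ 48 * (Bχ * D) * Z := by
    have h := rpow_two_add_add_le hα.le (by linarith) hr₁ hr₂
    calc 3 * (8 * (Bχ * D) * M * (2 + r₁ + r₂) ^ α / t ^ (1 + α))
        = 24 * (Bχ * D) * (M * (2 + r₁ + r₂) ^ α) / t ^ (1 + α) := by ring
      _ ≤ 24 * (Bχ * D) * (2 * (growthFactor α r₁ * growthFactor α r₂)) / t ^ (1 + α) := by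
          gcongr
      _ = 48 * (Bχ * D) * Z := by rw [hZ]; ring
  have c1 : 0 ≤ 3 * (Bχ / N) * Y := by positivity
  have c2 : 0 ≤ (1 + 4 / b ^ 2) * (K * K * N * Q) * Z := by positivity
  have c3 : 0 ≤ 48 * (Bχ * D) * Y := by positivity
  linarith

end PlanarSchrodinger

namespace PlanarSchrodinger

/-! ### The kernel of the operator `S` -/

lemma memLp_two_mul_prod {𝕜 : Type*} [RCLike 𝕜] {f g : Plane → 𝕜} (hf : MemLp f 2 volume)
    (hg : MemLp g 2 volume) : MemLp (fun p : Plane × Plane => f p.1 * g p.2) 2 volume := by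
  have hmeas : AEStronglyMeasurable (fun p : Plane × Plane => f p.1 * g p.2) volume :=
    hf.1.comp_fst.mul hg.1.comp_snd
  rw [memLp_two_iff_integrable_sq_norm hmeas]
  have h := ((memLp_two_iff_integrable_sq_norm hf.1).mp hf).mul_prod
    ((memLp_two_iff_integrable_sq_norm hg.1).mp hg)
  refine h.congr (Filter.Eventually.of_forall fun p => ?_)
  simp only [norm_mul]
  ring

lemma isKernel_of_rankOne {A : L2 →L[ℂ] L2} {g u : L2}
    (hA : ∀ f, A f = inner ℂ g f • u) :
    IsKernel A fun p => u p.1 * (starRingEnd ℂ) (g p.2) := by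
  refine ⟨memLp_two_mul_prod (Lp.memLp u) (Lp.memLp g).star, fun f => ?_⟩
  rw [hA f]
  filter_upwards [Lp.coeFn_smul (inner ℂ g f) u] with x hx
  rw [hx]
  simp only [Pi.smul_apply, smul_eq_mul, mul_assoc]
  rw [integral_const_mul, mul_comm, L2.inner_def]
  simp only [RCLike.inner_apply']

/-- By separability of `L²`, testing against a countable dense sequence gives one null set of
exceptional rows; off it the difference of the rows is orthogonal to all of `L²`. The final constant
can therefore be expressed through a single kernel and still serve every other one. -/
lemma IsKernel.ae_eq {A : L2 →L[ℂ] L2} {K K' : Plane × Plane → ℂ} (hK : IsKernel A K)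
    (hK' : IsKernel A K') : K =ᵐ[volume] K' := by
  have hD : MemLp (K - K') 2 volume := hK.1.sub hK'.1
  have hDsq := (memLp_two_iff_integrable_sq_norm hD.1).mp hD
  rw [Measure.volume_eq_prod] at hDsq
  have sec : ∀ {M : Plane × Plane → ℂ}, MemLp M 2 volume →
      ∀ᵐ x, MemLp (fun y => M (x, y)) 2 volume := by
    intro M hM
    have h1 := (memLp_two_iff_integrable_sq_norm hM.1).mp hM
    rw [Measure.volume_eq_prod] at h1
    have h2 := hM.1
    rw [Measure.volume_eq_prod] at h2
    filter_upwards [h1.prod_right_ae, h2.prodMk_left] with x hx hm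
    exact (memLp_two_iff_integrable_sq_norm hm).mpr hx
  have : Fact ((2 : ENNReal) ≠ ⊤) := ⟨by simp⟩
  have hdense : ∀ᵐ x, ∀ n : ℕ, ∫ y, K (x, y) * (TopologicalSpace.denseSeq L2 n) y
      = ∫ y, K' (x, y) * (TopologicalSpace.denseSeq L2 n) y := by
    rw [ae_all_iff]
    intro n
    filter_upwards [hK.2 (TopologicalSpace.denseSeq L2 n), hK'.2 (TopologicalSpace.denseSeq L2 n)]
      with x h1 h2
    rw [← h1, h2]
  have hzero : ∀ᵐ x, ∫ y, ‖(K - K') (x, y)‖ ^ 2 = 0 := by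
    filter_upwards [sec hK.1, sec hK'.1, hdense] with x h1 h2 h3
    have hw : MemLp (fun y => K (x, y) - K' (x, y)) 2 volume := h1.sub h2
    set w : L2 := hw.star.toLp with hwdef
    have hwc : (w : Plane → ℂ) =ᵐ[volume] fun y => star (K (x, y) - K' (x, y)) :=
      hw.star.coeFn_toLp
    have hin : ∀ f : L2, inner ℂ w f = (∫ y, K (x, y) * f y) - ∫ y, K' (x, y) * f y := by
      intro f
      rw [L2.inner_def, ← integral_sub]
      · refine integral_congr_ae ?_
        filter_upwards [hwc] with y hy
        rw [RCLike.inner_apply', hy]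
        simp
        ring
      · exact h1.integrable_mul (Lp.memLp f)
      · exact h2.integrable_mul (Lp.memLp f)
    have hall : ∀ f : L2, inner ℂ w f = 0 := by
      have hcl : IsClosed {f : L2 | inner ℂ w f = (0 : ℂ)} :=
        isClosed_eq (by fun_prop) continuous_const
      have : Dense {f : L2 | inner ℂ w f = (0 : ℂ)} := by
        refine (TopologicalSpace.denseRange_denseSeq L2).mono ?_
        rintro _ ⟨n, rfl⟩
        rw [mem_ofPred_eq, hin, h3 n, sub_self]
      intro f
      have hf : f ∈ closure {f : L2 | inner ℂ w f = (0 : ℂ)} := this f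
      rwa [hcl.closure_eq] at hf
    have hw0 : w = 0 := inner_self_eq_zero.mp (hall w)
    have hw0' : (w : Plane → ℂ) =ᵐ[volume] 0 := by
      rw [hw0]
      exact Lp.coeFn_zero _ _ _
    change ∫ y, ‖K (x, y) - K' (x, y)‖ ^ 2 = 0
    rw [integral_eq_zero_iff_of_nonneg (fun _ => by positivity)
      ((memLp_two_iff_integrable_sq_norm hw.1).mp hw)]
    filter_upwards [hwc, hw0'] with y h4 h5
    rw [h5] at h4
    have : K (x, y) - K' (x, y) = 0 := by
      rw [← star_eq_zero, ← h4]
      rfl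
    simp [this]
  have htot : ∫ p, ‖(K - K') p‖ ^ 2 = 0 := by
    rw [Measure.volume_eq_prod, integral_prod _ hDsq]
    exact integral_eq_zero_of_ae hzero
  rw [integral_eq_zero_iff_of_nonneg (fun _ => by positivity)
    ((memLp_two_iff_integrable_sq_norm hD.1).mp hD)] at htot
  filter_upwards [htot] with p hp
  have : ‖(K - K') p‖ = 0 := by simpa using hp
  exact sub_eq_zero.mp (norm_eq_zero.mp this)

/-! ### The projection onto `v` and the rank-one form of `S` -/

/-- `v` as an element of `L²`. -/
noncomputable def vVec {V : Plane → ℝ} (hv : MemLp (fun x => (vRoot V x : ℂ)) 2 volume) :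
    L2 := hv.toLp

lemma inner_vVec {V : Plane → ℝ} (hv : MemLp (fun x => (vRoot V x : ℂ)) 2 volume)
    (f : L2) : inner ℂ (vVec hv) f = ∫ y, f y * (vRoot V y : ℂ) := by
  rw [L2.inner_def]
  refine integral_congr_ae ?_
  filter_upwards [hv.coeFn_toLp] with y hy
  rw [RCLike.inner_apply, vVec, hy, Complex.conj_ofReal]

lemma inner_vVec_self {V : Plane → ℝ} (hv : MemLp (fun x => (vRoot V x : ℂ)) 2 volume) :
    inner ℂ (vVec hv) (vVec hv) = (normOne V : ℂ) := by
  rw [inner_vVec, normOne, ← integral_complex_ofReal]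
  refine integral_congr_ae ?_
  filter_upwards [hv.coeFn_toLp] with y hy
  rw [vVec, hy, ← Complex.ofReal_mul, vRoot, Real.mul_self_sqrt (abs_nonneg _)]

/-- `opP` is defined by choice from an almost everywhere formula: an explicit rank-one operator
shows that the choice is not the default `0`, and the formula determines the values. -/
lemma opP_apply {V : Plane → ℝ} (hv : MemLp (fun x => (vRoot V x : ℂ)) 2 volume)
    (f : L2) : opP V f = (inner ℂ (vVec hv) f / normOne V) • vVec hv := by
  have hex : ∃ A : L2 →L[ℂ] L2, ∀ f : L2, (A f : Plane → ℂ) =ᵐ[volume]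
      fun x => vRoot V x * (∫ y, f y * (vRoot V y : ℂ)) / normOne V := by
    refine ⟨((innerSL ℂ (vVec hv)).smulRight (((normOne V : ℂ)⁻¹) • vVec hv)), fun f => ?_⟩
    rw [ContinuousLinearMap.smulRight_apply, innerSL_apply_apply, smul_smul]
    filter_upwards [Lp.coeFn_smul (inner ℂ (vVec hv) f * (normOne V : ℂ)⁻¹) (vVec hv),
      hv.coeFn_toLp] with x h1 h2
    rw [h1, Pi.smul_apply, vVec, h2, ← inner_vVec hv, smul_eq_mul, vVec]
    ring
  have hspec : ∀ f : L2, (opP V f : Plane → ℂ) =ᵐ[volume]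
      fun x => vRoot V x * (∫ y, f y * (vRoot V y : ℂ)) / normOne V := by
    rw [opP, opOfFormula, dif_pos hex]
    exact hex.choose_spec
  refine Lp.ext ?_
  filter_upwards [hspec f, Lp.coeFn_smul (inner ℂ (vVec hv) f / normOne V) (vVec hv),
    hv.coeFn_toLp] with x h0 h1 h2
  rw [h0, h1, Pi.smul_apply, vVec, h2, ← inner_vVec hv, smul_eq_mul, vVec]
  ring

lemma opQ_vVec {V : Plane → ℝ} (hv : MemLp (fun x => (vRoot V x : ℂ)) 2 volume)
    (hN : normOne V ≠ 0) : opQ V (vVec hv) = 0 := by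
  have hNc : (normOne V : ℂ) ≠ 0 := by exact_mod_cast hN
  rw [opQ, sub_apply, opP_apply hv, inner_vVec_self, div_self hNc, one_smul]
  simp

lemma inner_vVec_opQ {V : Plane → ℝ} (hv : MemLp (fun x => (vRoot V x : ℂ)) 2 volume)
    (hN : normOne V ≠ 0) (f : L2) : inner ℂ (vVec hv) (opQ V f) = (0 : ℂ) := by
  have hNc : (normOne V : ℂ) ≠ 0 := by exact_mod_cast hN
  rw [opQ, sub_apply, opP_apply hv, inner_sub_right, inner_smul_right,
    inner_vVec_self, div_mul_cancel₀ _ hNc]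
  simp

lemma opQD0Q_vVec {V : Plane → ℝ} (hv : MemLp (fun x => (vRoot V x : ℂ)) 2 volume)
    (hN : normOne V ≠ 0) : opQD0Q V (vVec hv) = 0 := by
  have h : toRangeQ V (vVec hv) = 0 := Subtype.ext (opQ_vVec hv hN)
  simp [opQD0Q, h]

lemma inner_vVec_opQD0Q {V : Plane → ℝ} (hv : MemLp (fun x => (vRoot V x : ℂ)) 2 volume)
    (hN : normOne V ≠ 0) (f : L2) : inner ℂ (vVec hv) (opQD0Q V f) = (0 : ℂ) :=
  inner_vVec_opQ hv hN _

/-- The four blocks factor as `S = (1 - Q D₀ Q T) P (1 - T Q D₀ Q)`, and `P` has rank at most one.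
-/
lemma opS_apply {V : Plane → ℝ} (hv : MemLp (fun x => (vRoot V x : ℂ)) 2 volume)
    (f : L2) : opS V f
    = (inner ℂ (vVec hv) (f - opT V (opQD0Q V f)) / normOne V)
      • (vVec hv - opQD0Q V (opT V (vVec hv))) := by
  simp only [opS, add_apply, sub_apply,
    ContinuousLinearMap.comp_apply, opP_apply hv, map_smul, inner_sub_right]
  module

/-- Moving `T Q D₀ Q` onto `v` by the adjoint writes the functional in the rank-one form as an inner
product with a fixed vector. -/
lemma exists_isKernel_opS {V : Plane → ℝ} (hv : MemLp (fun x => (vRoot V x : ℂ)) 2 volume) :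
    ∃ K, IsKernel (opS V) K := by
  refine ⟨_, isKernel_of_rankOne (u := vVec hv - opQD0Q V (opT V (vVec hv)))
    (g := ((normOne V : ℂ)⁻¹) • (vVec hv
      - ContinuousLinearMap.adjoint (opT V ∘L opQD0Q V) (vVec hv))) fun f => ?_⟩
  rw [opS_apply hv, inner_smul_left, inner_sub_left, inner_sub_right,
    ContinuousLinearMap.adjoint_inner_left, ContinuousLinearMap.comp_apply, map_inv₀,
    Complex.conj_ofReal, div_eq_inv_mul]

/-- In the factored form, `Q D₀ Q` disappears on the right because it kills `v`, and on the left
because its range is orthogonal to `v`. What is left is `⟨Pv, v⟩`. -/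
lemma inner_vVec_opS_vVec {V : Plane → ℝ} (hv : MemLp (fun x => (vRoot V x : ℂ)) 2 volume)
    (hN : normOne V ≠ 0) : inner ℂ (vVec hv) (opS V (vVec hv)) = (normOne V : ℂ) := by
  have hNc : (normOne V : ℂ) ≠ 0 := by exact_mod_cast hN
  rw [opS_apply hv, opQD0Q_vVec hv hN, map_zero, sub_zero, inner_smul_right, inner_sub_right,
    inner_vVec_opQD0Q hv hN, inner_vVec_self, div_self hNc, one_mul, sub_zero]

lemma integrable_vRoot_kernel_vRoot {V : Plane → ℝ} (hv : MemLp (fun x => (vRoot V x : ℂ)) 2 volume)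
    {K : Plane × Plane → ℂ} (hK : IsKernel (opS V) K) :
    Integrable fun p : Plane × Plane => (vRoot V p.1 : ℂ) * K p * vRoot V p.2 := by
  have h := (memLp_two_mul_prod hv hv).integrable_mul hK.1
  refine h.congr (Filter.Eventually.of_forall fun p => ?_)
  simp only [Pi.mul_apply]
  ring

lemma integral_vRoot_kernel_vRoot {V : Plane → ℝ} (hv : MemLp (fun x => (vRoot V x : ℂ)) 2 volume)
    (hN : normOne V ≠ 0) {K : Plane × Plane → ℂ} (hK : IsKernel (opS V) K) :
    ∫ p : Plane × Plane, (vRoot V p.1 : ℂ) * K p * vRoot V p.2 = normOne V := by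
  have hint := integrable_vRoot_kernel_vRoot hv hK
  rw [Measure.volume_eq_prod] at hint ⊢
  rw [integral_prod _ hint, ← inner_vVec_opS_vVec hv hN, inner_vVec]
  refine integral_congr_ae ?_
  filter_upwards [hK.2 (vVec hv)] with x hx
  rw [hx, mul_comm, ← integral_const_mul]
  refine integral_congr_ae ?_
  filter_upwards [hv.coeFn_toLp] with y hy
  rw [vVec, hy]
  ring

end PlanarSchrodinger

namespace PlanarSchrodinger

/-! ### Weighted square integrals -/

lemma one_le_bracket (x : Plane) : 1 ≤ bracket x :=
  Real.one_le_sqrt.mpr (by nlinarith [sq_nonneg ‖x‖])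

lemma one_add_norm_le_bracket (x : Plane) : 1 + ‖x‖ ≤ 2 * bracket x := by
  have h1 := one_le_bracket x
  have h2 : ‖x‖ ≤ bracket x := Real.le_sqrt_of_sq_le (by linarith)
  linarith

lemma one_add_norm_sub_le (x y : Plane) : 1 + ‖x - y‖ ≤ (1 + ‖x‖) * (1 + ‖y‖) := by
  have h1 := norm_sub_le x y
  have h2 := mul_nonneg (norm_nonneg x) (norm_nonneg y)
  linarith

/-- The singularity `1 / |z|`, restricted to the unit disc. -/
noncomputable def localSingularity (z : Plane) : ℝ :=
  (Metric.ball (0 : Plane) 1).indicator (fun z => 1 / ‖z‖) z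

/-- In polar coordinates in the plane the Jacobian `r` cancels the singularity `1/r`. -/
lemma integrable_localSingularity : Integrable localSingularity := by
  unfold localSingularity
  rw [integrable_indicator_iff Metric.isOpen_ball.measurableSet]
  refine (integrableOn_fun_norm_addHaar (E := Plane) volume (f := fun r : ℝ => 1 / r)
    (r := 1)).mpr ?_
  have h : IntegrableOn (fun _ : ℝ => (1 : ℝ)) (Ioo 0 1) := integrableOn_const (by simp)
  refine h.congr_fun (fun r hr => ?_) measurableSet_Ioo
  have : r ≠ 0 := hr.1.ne'
  simp only [finrank_euclideanSpace, Fintype.card_fin]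
  simp [this]

/-- Square integrals of `v(y) f(|x - y|)` for `v` decaying and `f` with a mild singularity. -/
lemma exists_integral_sq_mul_le {v : Plane → ℝ} (hvm : Measurable v) (hv0 : ∀ x, 0 ≤ v x)
    {A e : ℝ} (he : 0 ≤ e) (hv : ∀ x, v x ≤ A * (1 + ‖x‖) ^ (-e)) {f : ℝ → ℝ}
    (hf : Measurable f) {D β c : ℝ} {Φ : Plane → ℝ} (hD : 0 ≤ D) (hc : 0 < c)
    (hΦ : ∀ x, c ≤ Φ x) (hnear : ∀ r, 0 < r → r < 1 → f r ^ 2 ≤ D / r)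
    (hfar : ∀ x y : Plane, 1 ≤ ‖x - y‖ → f ‖x - y‖ ^ 2 ≤ Φ x * (1 + ‖y‖) ^ β)
    (hβ : 2 < 2 * e - β) : ∃ C, 0 ≤ C ∧ ∀ x : Plane,
      Integrable (fun y => (v y * f ‖x - y‖) ^ 2) ∧ ∫ y, (v y * f ‖x - y‖) ^ 2 ≤ C * Φ x := by
  have hfin : ((Module.finrank ℝ Plane : ℕ) : ℝ) < 2 * e - β := by simpa using hβ
  have hJ : Integrable fun y : Plane => (1 + ‖y‖) ^ (-(2 * e - β)) := integrable_one_add_norm hfin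
  set κ := ∫ z, localSingularity z with hκ
  set J := ∫ y : Plane, (1 + ‖y‖) ^ (-(2 * e - β)) with hJdef
  have hκ0 : 0 ≤ κ := integral_nonneg fun z => indicator_nonneg (fun _ _ => by positivity) z
  have hJ0 : 0 ≤ J := integral_nonneg fun z => by positivity
  refine ⟨A ^ 2 * D * κ / c + A ^ 2 * J, by positivity, fun x => ?_⟩
  have hΦ0 : 0 < Φ x := hc.trans_le (hΦ x)
  -- The disc around `x` contributes a translate of the singularity, with integral independent of
  -- `x`. The complement contributes `Φ x` times a power of `1 + |y|` whose order `2e - β` exceeds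
  -- the dimension `2`.
  set g : Plane → ℝ := fun y => A ^ 2 * D * localSingularity (x - y)
    + Φ x * A ^ 2 * (1 + ‖y‖) ^ (-(2 * e - β)) with hg
  have hgi : Integrable g :=
    ((integrable_localSingularity.comp_sub_left x).const_mul _).add (hJ.const_mul _)
  have hle : ∀ᵐ y, (v y * f ‖x - y‖) ^ 2 ≤ g y := by
    have hne : ∀ᵐ y : Plane, y ≠ x := by simp [ae_iff]
    filter_upwards [hne] with y hy
    have hr : 0 < ‖x - y‖ := norm_pos_iff.mpr (sub_ne_zero.mpr hy.symm)
    have hsq : v y ^ 2 ≤ A ^ 2 * (1 + ‖y‖) ^ (-(2 * e)) := by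
      calc v y ^ 2 ≤ (A * (1 + ‖y‖) ^ (-e)) ^ 2 := pow_le_pow_left₀ (hv0 y) (hv y) 2
        _ = A ^ 2 * (1 + ‖y‖) ^ (-(2 * e)) := by
          rw [mul_pow, ← Real.rpow_mul_natCast (by positivity)]
          congr 2
          push_cast
          ring
    have hls : 0 ≤ localSingularity (x - y) := indicator_nonneg (fun _ _ => by positivity) _
    have hp : 0 ≤ (1 + ‖y‖) ^ (-(2 * e - β)) := by positivity
    rw [mul_pow]
    simp only [hg]
    rcases lt_or_ge ‖x - y‖ 1 with h | h
    · have h1 : localSingularity (x - y) = 1 / ‖x - y‖ := by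
        rw [localSingularity, indicator_of_mem (by simpa using h)]
      have h2 : v y ^ 2 ≤ A ^ 2 := by
        refine hsq.trans (mul_le_of_le_one_right (sq_nonneg _) ?_)
        exact Real.rpow_le_one_of_one_le_of_nonpos (by linarith [norm_nonneg y]) (by linarith)
      calc v y ^ 2 * f ‖x - y‖ ^ 2 ≤ A ^ 2 * (D / ‖x - y‖) := by
            gcongr
            exact hnear _ hr h
        _ = A ^ 2 * D * localSingularity (x - y) := by rw [h1]; ring
        _ ≤ _ := le_add_of_nonneg_right (by positivity)
    · calc v y ^ 2 * f ‖x - y‖ ^ 2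
          ≤ (A ^ 2 * (1 + ‖y‖) ^ (-(2 * e))) * (Φ x * (1 + ‖y‖) ^ β) := by
            gcongr
            exact hfar x y h
        _ = Φ x * A ^ 2 * (1 + ‖y‖) ^ (-(2 * e - β)) := by
            have : -(2 * e - β) = -(2 * e) + β := by ring
            rw [this, Real.rpow_add (by positivity)]
            ring
        _ ≤ _ := le_add_of_nonneg_left (by positivity)
  have hmeas : Measurable fun y => (v y * f ‖x - y‖) ^ 2 := by fun_prop
  have hint : Integrable fun y => (v y * f ‖x - y‖) ^ 2 := by
    refine hgi.mono' hmeas.aestronglyMeasurable ?_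
    filter_upwards [hle] with y hy
    rwa [Real.norm_of_nonneg (sq_nonneg _)]
  refine ⟨hint, (integral_mono_ae hint hgi hle).trans ?_⟩
  rw [hg, integral_add ((integrable_localSingularity.comp_sub_left x).const_mul _)
    (hJ.const_mul _), integral_const_mul, integral_const_mul,
    integral_sub_left_eq_self localSingularity volume x, ← hκ, ← hJdef, add_mul]
  have h1 : A ^ 2 * D * κ ≤ A ^ 2 * D * κ / c * Φ x := by
    rw [div_mul_eq_mul_div, le_div_iff₀ hc]
    gcongr
    exact hΦ x
  linarith

/-! ### Square integrals of `v` against the logarithmic and polynomial weights -/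

lemma measurable_logFactor : Measurable logFactor := by
  unfold logFactor
  exact (Real.measurable_log.abs).const_add 1

lemma measurable_growthFactor (α : ℝ) : Measurable (growthFactor α) := by
  unfold growthFactor
  exact measurable_logFactor.mul ((measurable_id.const_add 1).pow_const _)

lemma logFactor_sq_le {r : ℝ} (hr : 0 < r) (hr1 : r ≤ 1) : logFactor r ^ 2 ≤ 9 / r := by
  have hs : 0 < √r := Real.sqrt_pos.mpr hr
  have h1 : 1 ≤ 1 / √r := (sq_le_sqrt hr hr1).2.2
  have h2 : logFactor r ≤ 3 / √r := by
    have := abs_log_le_div_sqrt hr hr1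
    have e : 3 / √r = 1 / √r + 2 / √r := by ring
    rw [logFactor, e]
    linarith
  calc logFactor r ^ 2 ≤ (3 / √r) ^ 2 := by
        have := one_le_logFactor r
        gcongr
    _ = 9 / r := by rw [div_pow, Real.sq_sqrt hr.le]; norm_num

/-- Both logarithms are at least `1/2`, so `1 + a + b ≤ 8ab` turns their sum into a product. The one
in `y` is traded for a quarter power, whose square the decay of `v` absorbs. -/
lemma logFactor_le_of_one_le (x y : Plane) (h : 1 ≤ ‖x - y‖) :
    logFactor ‖x - y‖ ≤ 64 * (Real.log (2 + ‖x‖) * (1 + ‖y‖) ^ (1 / 4 : ℝ)) := by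
  have hlog2 := Real.log_two_gt_d9
  have hx := norm_nonneg x
  have hy := norm_nonneg y
  have ha : 1 / 2 ≤ Real.log (2 + ‖x‖) := by
    have := Real.log_le_log two_pos (by linarith : 2 ≤ 2 + ‖x‖)
    linarith
  have hb : 1 / 2 ≤ Real.log (2 + ‖y‖) := by
    have := Real.log_le_log two_pos (by linarith : 2 ≤ 2 + ‖y‖)
    linarith
  have h1 : Real.log ‖x - y‖ ≤ Real.log (2 + ‖x‖) + Real.log (2 + ‖y‖) := by
    rw [← Real.log_mul (by positivity) (by positivity)]
    refine Real.log_le_log (by linarith) ?_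
    nlinarith [norm_sub_le x y]
  have h2 : Real.log (2 + ‖y‖) ≤ 8 * (1 + ‖y‖) ^ (1 / 4 : ℝ) := by
    have e1 := Real.log_le_rpow_div (by positivity : 0 ≤ 2 + ‖y‖) (by norm_num : (0 : ℝ) < 1 / 4)
    have e2 : (2 + ‖y‖) ^ (1 / 4 : ℝ) ≤ 2 * (1 + ‖y‖) ^ (1 / 4 : ℝ) := by
      calc (2 + ‖y‖) ^ (1 / 4 : ℝ) ≤ (2 * (1 + ‖y‖)) ^ (1 / 4 : ℝ) := by gcongr; linarith
        _ = 2 ^ (1 / 4 : ℝ) * (1 + ‖y‖) ^ (1 / 4 : ℝ) := Real.mul_rpow (by norm_num) (by positivity)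
        _ ≤ 2 * (1 + ‖y‖) ^ (1 / 4 : ℝ) := by
          gcongr
          calc (2 : ℝ) ^ (1 / 4 : ℝ) ≤ 2 ^ (1 : ℝ) :=
                Real.rpow_le_rpow_of_exponent_le (by norm_num) (by norm_num)
            _ = 2 := Real.rpow_one 2
    linarith
  rw [logFactor, abs_of_nonneg (Real.log_nonneg h)]
  set a := Real.log (2 + ‖x‖)
  set b := Real.log (2 + ‖y‖)
  have h3 : 1 + a + b ≤ 8 * (a * b) := by nlinarith
  calc 1 + Real.log ‖x - y‖ ≤ 8 * (a * b) := by linarith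
    _ ≤ 8 * (a * (8 * (1 + ‖y‖) ^ (1 / 4 : ℝ))) := by gcongr
    _ = 64 * (a * (1 + ‖y‖) ^ (1 / 4 : ℝ)) := by ring

/-- The logarithm is absorbed into a power `ε`, which is the origin of the loss `ε` in the final
weights. -/
lemma growthFactor_le_of_one_le {α ε : ℝ} (hα : 0 ≤ α) (hε : 0 < ε) (x y : Plane)
    (h : 1 ≤ ‖x - y‖) : growthFactor α ‖x - y‖
      ≤ (1 + 1 / ε) * 2 ^ (1 / 2 + α + ε) * (bracket x ^ (1 / 2 + α + ε)
        * (1 + ‖y‖) ^ (1 / 2 + α + ε)) := by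
  set r := ‖x - y‖
  have hr : 0 < r := by linarith
  have h1 : logFactor r ≤ (1 + 1 / ε) * (1 + r) ^ ε := by
    have e1 := Real.log_le_rpow_div hr.le hε
    have e2 : r ^ ε ≤ (1 + r) ^ ε := by gcongr; linarith
    have e3 : 1 ≤ (1 + r) ^ ε := Real.one_le_rpow (by linarith) hε.le
    rw [logFactor, abs_of_nonneg (Real.log_nonneg h)]
    calc 1 + Real.log r ≤ (1 + r) ^ ε + (1 + r) ^ ε / ε := by
          refine add_le_add e3 (e1.trans ?_)
          gcongr
      _ = (1 + 1 / ε) * (1 + r) ^ ε := by ring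
  have h2 : 1 + r ≤ 2 * (bracket x * (1 + ‖y‖)) := by
    refine (one_add_norm_sub_le x y).trans ?_
    have := mul_le_mul_of_nonneg_right (one_add_norm_le_bracket x)
      (by positivity : 0 ≤ 1 + ‖y‖)
    linarith
  have hb : 0 ≤ bracket x := by linarith [one_le_bracket x]
  calc growthFactor α r ≤ (1 + 1 / ε) * (1 + r) ^ ε * (1 + r) ^ (1 / 2 + α) := by
        rw [growthFactor]
        gcongr
    _ = (1 + 1 / ε) * (1 + r) ^ (1 / 2 + α + ε) := by
        rw [Real.rpow_add (by positivity) (1 / 2 + α) ε]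
        ring
    _ ≤ (1 + 1 / ε) * (2 * (bracket x * (1 + ‖y‖))) ^ (1 / 2 + α + ε) := by gcongr
    _ = _ := by
        rw [Real.mul_rpow (by norm_num) (by positivity), Real.mul_rpow hb (by positivity)]
        ring

lemma measurable_vRoot {V : Plane → ℝ} (hV : Measurable V) : Measurable (vRoot V) := by
  unfold vRoot
  exact hV.abs.sqrt

lemma vRoot_nonneg (V : Plane → ℝ) (x : Plane) : 0 ≤ vRoot V x := Real.sqrt_nonneg _

lemma exists_vRoot_le {V : Plane → ℝ} {A e : ℝ} (he : 0 ≤ e)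
    (h : ∀ x, vRoot V x ≤ A * bracket x ^ (-e)) :
    ∃ A', 0 ≤ A' ∧ ∀ x, vRoot V x ≤ A' * (1 + ‖x‖) ^ (-e) := by
  refine ⟨|A| * 2 ^ e, by positivity, fun x => ?_⟩
  have hb := one_le_bracket x
  have h1 : bracket x ^ (-e) ≤ 2 ^ e * (1 + ‖x‖) ^ (-e) := by
    calc bracket x ^ (-e) ≤ ((1 + ‖x‖) / 2) ^ (-e) :=
          Real.rpow_le_rpow_of_nonpos (by positivity)
            (by linarith [one_add_norm_le_bracket x]) (by linarith)
      _ = 2 ^ e * (1 + ‖x‖) ^ (-e) := by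
          rw [Real.div_rpow (by positivity) (by norm_num), Real.rpow_neg (by norm_num : (0 : ℝ) ≤ 2)]
          field_simp
  calc vRoot V x ≤ A * bracket x ^ (-e) := h x
    _ ≤ |A| * (2 ^ e * (1 + ‖x‖) ^ (-e)) := by
        have : 0 ≤ bracket x ^ (-e) := by positivity
        gcongr
        exact le_abs_self A
    _ = |A| * 2 ^ e * (1 + ‖x‖) ^ (-e) := by ring

lemma integrable_vRoot_sq {V : Plane → ℝ} {A e : ℝ} (hV : Measurable V) (he : 1 < e)
    (h : ∀ x, vRoot V x ≤ A * (1 + ‖x‖) ^ (-e)) : Integrable fun x => vRoot V x ^ 2 := by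
  obtain ⟨C, -, hC⟩ := exists_integral_sq_mul_le (measurable_vRoot hV) (vRoot_nonneg V)
    (by linarith) h (f := fun _ => 1) measurable_const (D := 1) (β := 0) (c := 1) (Φ := fun _ => 1)
    zero_le_one one_pos (fun _ => le_rfl)
    (fun r h0 h1 => by rw [one_pow, le_div_iff₀ h0]; linarith) (fun x y _ => by simp) (by linarith)
  simpa using (hC 0).1

lemma exists_integral_logFactor_le {V : Plane → ℝ} {A e : ℝ} (hV : Measurable V) (he : 3 / 2 ≤ e)
    (h : ∀ x, vRoot V x ≤ A * (1 + ‖x‖) ^ (-e)) : ∃ C, 0 ≤ C ∧ ∀ x : Plane,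
      Integrable (fun y => (vRoot V y * logFactor ‖x - y‖) ^ 2) ∧
        ∫ y, (vRoot V y * logFactor ‖x - y‖) ^ 2 ≤ C * weight x := by
  obtain ⟨C, hC0, hC⟩ := exists_integral_sq_mul_le (measurable_vRoot hV) (vRoot_nonneg V)
    (by linarith) h (f := logFactor) measurable_logFactor (D := 9) (β := 1 / 2) (c := 1)
    (Φ := fun x => 64 ^ 2 * weight x) (by norm_num) one_pos
    (fun x => by
      have h1 := Real.log_le_log two_pos (by linarith [norm_nonneg x] : 2 ≤ 2 + ‖x‖)
      have h2 := Real.log_two_gt_d9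
      simp only [weight]
      nlinarith)
    (fun r h0 h1 => logFactor_sq_le h0 h1.le)
    (fun x y hxy => by
      have h0 := one_le_logFactor ‖x - y‖
      calc logFactor ‖x - y‖ ^ 2
          ≤ (64 * (Real.log (2 + ‖x‖) * (1 + ‖y‖) ^ (1 / 4 : ℝ))) ^ 2 :=
            pow_le_pow_left₀ (by linarith) (logFactor_le_of_one_le x y hxy) 2
        _ = 64 ^ 2 * weight x * (1 + ‖y‖) ^ (1 / 2 : ℝ) := by
            rw [weight, mul_pow, mul_pow, ← Real.rpow_mul_natCast (by positivity)]
            norm_num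
            ring)
    (by linarith)
  refine ⟨C * 64 ^ 2, by positivity, fun x => ⟨(hC x).1, ?_⟩⟩
  rw [mul_assoc]
  exact (hC x).2

/-- The squared weight grows with exponent `β = 2γ`, where `γ = 1/2 + α + ε`. Convergence in the
plane requires `2e - 2γ > 2`, that is, `e > 3/2 + α + ε`. -/
lemma exists_integral_growthFactor_le {V : Plane → ℝ} {A e : ℝ} (hV : Measurable V) {α ε : ℝ} (hα : 0 ≤ α)
    (hα1 : α ≤ 1 / 2) (hε : 0 < ε) (he : 3 / 2 + α + ε < e)
    (h : ∀ x, vRoot V x ≤ A * (1 + ‖x‖) ^ (-e)) : ∃ C, 0 ≤ C ∧ ∀ x : Plane,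
      Integrable (fun y => (vRoot V y * growthFactor α ‖x - y‖) ^ 2) ∧
        ∫ y, (vRoot V y * growthFactor α ‖x - y‖) ^ 2 ≤ C * (bracket x ^ (1 / 2 + α + ε)) ^ 2 := by
  set γ := 1 / 2 + α + ε with hγ
  set c := (1 + 1 / ε) * 2 ^ γ with hc
  have hc1 : 1 ≤ c := by
    refine one_le_mul_of_one_le_of_one_le (le_add_of_nonneg_right (by positivity)) ?_
    exact Real.one_le_rpow (by norm_num) (by positivity)
  obtain ⟨C, hC0, hC⟩ := exists_integral_sq_mul_le (measurable_vRoot hV) (vRoot_nonneg V)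
    (by linarith) h (f := growthFactor α) (measurable_growthFactor α) (D := 36) (β := 2 * γ)
    (c := 1) (Φ := fun x => c ^ 2 * (bracket x ^ γ) ^ 2) (by norm_num) one_pos
    (fun x => by
      have h1 : 1 ≤ bracket x ^ γ := Real.one_le_rpow (one_le_bracket x) (by positivity)
      exact one_le_mul_of_one_le_of_one_le (one_le_pow₀ hc1) (one_le_pow₀ h1))
    (fun r h0 h1 => by
      have h2 : (1 + r) ^ (1 / 2 + α) ≤ 2 := by
        calc (1 + r) ^ (1 / 2 + α) ≤ (1 + r) ^ (1 : ℝ) :=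
              Real.rpow_le_rpow_of_exponent_le (by linarith) (by linarith)
          _ ≤ 2 := by rw [Real.rpow_one]; linarith
      rw [growthFactor, mul_pow]
      calc logFactor r ^ 2 * ((1 + r) ^ (1 / 2 + α)) ^ 2 ≤ 9 / r * 2 ^ 2 := by
            gcongr
            exact logFactor_sq_le h0 h1.le
        _ = 36 / r := by ring)
    (fun x y hxy => by
      have hb := one_le_bracket x
      have h0 : 0 ≤ growthFactor α ‖x - y‖ := by
        have := one_le_logFactor ‖x - y‖
        rw [growthFactor]
        positivity
      calc growthFactor α ‖x - y‖ ^ 2 ≤ (c * (bracket x ^ γ * (1 + ‖y‖) ^ γ)) ^ 2 :=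
            pow_le_pow_left₀ h0 (growthFactor_le_of_one_le hα hε x y hxy) 2
        _ = c ^ 2 * (bracket x ^ γ) ^ 2 * (1 + ‖y‖) ^ (2 * γ) := by
            have e2 : (1 + ‖y‖) ^ (2 * γ) = ((1 + ‖y‖) ^ γ) ^ 2 := by
              rw [← Real.rpow_mul_natCast (by positivity : 0 ≤ 1 + ‖y‖), mul_comm]
              norm_num
            rw [e2]
            ring)
    (by linarith)
  refine ⟨C * c ^ 2, by positivity, fun x => ⟨(hC x).1, ?_⟩⟩
  rw [mul_assoc]
  exact (hC x).2

/-- Cauchy–Schwarz on the product space; the square integral of `a ⊗ b` factors by Fubini. -/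
lemma integral_mul_mul_norm_le {a b : Plane → ℝ} {K : Plane × Plane → ℂ} (ha0 : ∀ x, 0 ≤ a x)
    (hb0 : ∀ x, 0 ≤ b x) (ha : MemLp a 2 volume) (hb : MemLp b 2 volume)
    (hK : MemLp K 2 volume) :
    Integrable (fun p : Plane × Plane => a p.1 * b p.2 * ‖K p‖) ∧
      ∫ p : Plane × Plane, a p.1 * b p.2 * ‖K p‖
        ≤ √(∫ x, a x ^ 2) * √(∫ x, b x ^ 2) * √(∫ p, ‖K p‖ ^ 2) := by
  have hab := memLp_two_mul_prod ha hb
  refine ⟨hab.integrable_mul hK.norm, ?_⟩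
  have h := integral_mul_le_Lp_mul_Lq_of_nonneg (μ := (volume : Measure (Plane × Plane)))
    Real.HolderConjugate.two_two (f := fun p => a p.1 * b p.2) (g := fun p => ‖K p‖)
    (Filter.Eventually.of_forall fun p => mul_nonneg (ha0 _) (hb0 _))
    (Filter.Eventually.of_forall fun p => norm_nonneg _) (by simpa using hab)
    (by simpa using hK.norm)
  have e : ∫ p : Plane × Plane, (a p.1 * b p.2) ^ (2 : ℝ) = (∫ x, a x ^ 2) * ∫ x, b x ^ 2 := by
    rw [Measure.volume_eq_prod, ← integral_prod_mul]
    refine integral_congr_ae (Filter.Eventually.of_forall fun p => ?_)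
    simp only [Real.rpow_two, mul_pow]
  rw [e] at h
  simp only [Real.rpow_two, ← Real.sqrt_eq_rpow] at h
  rwa [Real.sqrt_mul (integral_nonneg fun x => sq_nonneg _)] at h

/-! ### The spectral integral -/

lemma continuous_besselJ0 : Continuous besselJ0 :=
  continuous_iff_continuousAt.mpr fun z => (hasDerivAt_besselJ0 z).continuousAt

lemma measurable_besselY0 : Measurable besselY0 := by
  have h : Continuous besselYReg :=
    continuous_iff_continuousAt.mpr fun z => (hasDerivAt_besselYReg z).continuousAt
  rw [funext besselY0_eq]
  have h1 := h.measurable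
  have h2 := continuous_besselJ0.measurable
  fun_prop

lemma measurable_hankel0 (s : ℝ) : Measurable (hankel0 s) := by
  have h1 := Complex.measurable_ofReal.comp continuous_besselJ0.measurable
  have h2 := Complex.measurable_ofReal.comp measurable_besselY0
  exact h1.add (h2.const_mul _)

/-- Joint measurability makes the inner integral a measurable function of `(x₁, y₁)`, which the
pointwise estimate alone does not provide. -/
lemma measurable_resolventIntegrand (V : Plane → ℝ) {χ : ℝ → ℝ} (hχ : Continuous χ) (t : ℝ)
    (x y : Plane) :
    Measurable fun q : (Plane × Plane) × ℝ => resolventIntegrand V χ t x y q.1 q.2 := by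
  have hh : ∀ s, Measurable fun q : (Plane × Plane) × ℝ => hFun V s q.2 := by
    intro s
    have h : Measurable fun l : ℝ => hFun V s l := by
      unfold hFun gFun
      fun_prop
    exact h.comp measurable_snd
  have hf₁ : ∀ s, Measurable fun q : (Plane × Plane) × ℝ => freeResolvent s q.2 x q.1.1 := by
    intro s
    have h : Measurable fun q : (Plane × Plane) × ℝ => q.2 * ‖x - q.1.1‖ := by fun_prop
    exact ((measurable_hankel0 s).comp h).const_mul _
  have hf₂ : ∀ s, Measurable fun q : (Plane × Plane) × ℝ => freeResolvent s q.2 q.1.2 y := by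
    intro s
    have h : Measurable fun q : (Plane × Plane) × ℝ => q.2 * ‖q.1.2 - y‖ := by fun_prop
    exact ((measurable_hankel0 s).comp h).const_mul _
  have hR : ∀ s, Measurable fun q : (Plane × Plane) × ℝ => calR V s q.2 x q.1.1 q.1.2 y :=
    fun s => ((hf₁ s).mul (hf₂ s)).div (hh s)
  have hphase := (continuous_phase t).measurable
  have hχm := hχ.measurable
  have h1 : Measurable fun q : (Plane × Plane) × ℝ => phase t q.2 * (q.2 : ℂ) := by fun_prop
  have h2 : Measurable fun q : (Plane × Plane) × ℝ => (χ q.2 : ℂ) := by fun_prop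
  exact h1.mul (h2.mul ((hR (-1)).sub (hR 1)))

lemma stoneIntegrand_eq (V : Plane → ℝ) (χ : ℝ → ℝ) (K : Plane × Plane → ℂ) (t : ℝ) (x y : Plane)
    (p : Plane × Plane) (l : ℝ) : stoneIntegrand V χ K t x y p l
      = resolventIntegrand V χ t x y p l * ((vRoot V p.1 : ℂ) * K p * vRoot V p.2) := by
  rw [stoneIntegrand, resolventIntegrand, phase]
  ring

lemma stoneInner_eq (V : Plane → ℝ) (χ : ℝ → ℝ) (K : Plane × Plane → ℂ) (t : ℝ) (x y : Plane)
    (p : Plane × Plane) : stoneInner V χ K t x y p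
      = (∫ l in Ioi 0, resolventIntegrand V χ t x y p l)
        * ((vRoot V p.1 : ℂ) * K p * vRoot V p.2) := by
  rw [stoneInner, ← integral_mul_const]
  simp only [stoneIntegrand_eq]

lemma normOne_pos {V : Plane → ℝ} (hV0 : ¬ V =ᵐ[volume] 0)
    (hint : Integrable fun x => vRoot V x ^ 2) : 0 < normOne V := by
  have hsq : ∀ x, vRoot V x ^ 2 = |V x| := fun x => Real.sq_sqrt (abs_nonneg _)
  simp only [hsq] at hint
  refine lt_of_le_of_ne (integral_nonneg fun x => abs_nonneg _) fun h => hV0 ?_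
  have h0 := (integral_eq_zero_iff_of_nonneg (fun x => abs_nonneg (V x)) hint).mp h.symm
  filter_upwards [h0] with x hx
  exact abs_eq_zero.mp hx

lemma ae_ne_fst_and_ne_snd (x y : Plane) :
    ∀ᵐ p : Plane × Plane, x ≠ p.1 ∧ p.2 ≠ y := by
  have h : ∀ z : Plane, ∀ᵐ w : Plane, w ≠ z := fun z => by simp [ae_iff]
  rw [Measure.volume_eq_prod]
  filter_upwards [Measure.quasiMeasurePreserving_fst.ae (h x),
    Measure.quasiMeasurePreserving_snd.ae (h y)] with p h1 h2
  exact ⟨h1.symm, h2⟩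

lemma growthFactor_nonneg (α : ℝ) {r : ℝ} (hr : 0 ≤ r) : 0 ≤ growthFactor α r := by
  have := one_le_logFactor r
  rw [growthFactor]
  positivity

/-- Integration of a pointwise bound by a product kernel against `v K v`. -/
lemma integral_kernel_weight_le {V : Plane → ℝ} (hV : Measurable V) {K : Plane × Plane → ℂ}
    (hK : MemLp K 2 volume) {f : ℝ → ℝ} (hf : Measurable f) (hf0 : ∀ r, 0 ≤ r → 0 ≤ f r)
    {C : ℝ} {Φ : Plane → ℝ} (hC : 0 ≤ C) (hΦ : ∀ x, 0 ≤ Φ x)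
    (h : ∀ x : Plane, Integrable (fun y => (vRoot V y * f ‖x - y‖) ^ 2) ∧
      ∫ y, (vRoot V y * f ‖x - y‖) ^ 2 ≤ C * Φ x) (x y : Plane) :
    Integrable (fun p : Plane × Plane =>
        f ‖x - p.1‖ * f ‖p.2 - y‖ * ‖(vRoot V p.1 : ℂ) * K p * vRoot V p.2‖) ∧
      ∫ p : Plane × Plane, f ‖x - p.1‖ * f ‖p.2 - y‖ * ‖(vRoot V p.1 : ℂ) * K p * vRoot V p.2‖
        ≤ C * √(∫ p, ‖K p‖ ^ 2) * √(Φ x * Φ y) := by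
  have hmem : ∀ z : Plane, MemLp (fun w => vRoot V w * f ‖z - w‖) 2 volume := by
    intro z
    have hv := measurable_vRoot hV
    have hm : Measurable fun w => vRoot V w * f ‖z - w‖ := by fun_prop
    exact (memLp_two_iff_integrable_sq hm.aestronglyMeasurable).mpr (h z).1
  have hnn : ∀ z w : Plane, 0 ≤ vRoot V w * f ‖z - w‖ := fun z w =>
    mul_nonneg (vRoot_nonneg V w) (hf0 _ (norm_nonneg _))
  have heq : (fun p : Plane × Plane =>
      f ‖x - p.1‖ * f ‖p.2 - y‖ * ‖(vRoot V p.1 : ℂ) * K p * vRoot V p.2‖)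
      = fun p => (vRoot V p.1 * f ‖x - p.1‖) * (vRoot V p.2 * f ‖y - p.2‖) * ‖K p‖ := by
    ext p
    rw [norm_mul, norm_mul, Complex.norm_real, Complex.norm_real,
      Real.norm_of_nonneg (vRoot_nonneg V _), Real.norm_of_nonneg (vRoot_nonneg V _),
      norm_sub_rev p.2 y]
    ring
  obtain ⟨h1, h2⟩ := integral_mul_mul_norm_le (hnn x) (hnn y) (hmem x) (hmem y) hK
  rw [heq]
  refine ⟨h1, h2.trans ?_⟩
  have h3 : √(∫ w, (vRoot V w * f ‖x - w‖) ^ 2) * √(∫ w, (vRoot V w * f ‖y - w‖) ^ 2)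
      ≤ C * √(Φ x * Φ y) := by
    calc √(∫ w, (vRoot V w * f ‖x - w‖) ^ 2) * √(∫ w, (vRoot V w * f ‖y - w‖) ^ 2)
        ≤ √(C * Φ x) * √(C * Φ y) := by
          gcongr
          · exact (h x).2
          · exact (h y).2
      _ = C * √(Φ x * Φ y) := by
          rw [Real.sqrt_mul hC, Real.sqrt_mul hC, Real.sqrt_mul (hΦ x)]
          calc √C * √(Φ x) * (√C * √(Φ y)) = √C * √C * (√(Φ x) * √(Φ y)) := by ring
            _ = C * (√(Φ x) * √(Φ y)) := by rw [Real.mul_self_sqrt hC]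
  calc _ ≤ C * √(Φ x * Φ y) * √(∫ p, ‖K p‖ ^ 2) := by gcongr
    _ = C * √(∫ p, ‖K p‖ ^ 2) * √(Φ x * Φ y) := by ring

end PlanarSchrodinger

/-! ### The asymptotic formula for the spectral integral -/

open PlanarSchrodinger in
theorem mainTheorem5 (V : PlanarSchrodinger.Plane → ℝ) (hV : Measurable V)
    (hV0 : ¬ V =ᵐ[volume] 0) (hreg : PlanarSchrodinger.ZeroIsRegular V)
    (α : ℝ) (hα0 : 0 < α) (hα : α < 1 / 4)
    (hdecay : ∃ δ : ℝ, 0 < δ ∧ ∃ A : ℝ, ∀ x : PlanarSchrodinger.Plane,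
      PlanarSchrodinger.vRoot V x ≤ A * PlanarSchrodinger.bracket x ^ (-(3 / 2) - α - δ)) :
    (∃ K : PlanarSchrodinger.Plane × PlanarSchrodinger.Plane → ℂ,
      PlanarSchrodinger.IsKernel (PlanarSchrodinger.opS V) K) ∧
    ∃ lam₀ : ℝ, 0 < lam₀ ∧ ∀ lam₁ : ℝ, 0 < lam₁ → lam₁ ≤ lam₀ →
      ∀ χ : ℝ → ℝ, PlanarSchrodinger.IsCutoff lam₁ χ →
      ∀ ε : ℝ, 0 < ε → ∃ C : ℝ,
      ∀ K : PlanarSchrodinger.Plane × PlanarSchrodinger.Plane → ℂ,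
        PlanarSchrodinger.IsKernel (PlanarSchrodinger.opS V) K →
      ∀ (x y : PlanarSchrodinger.Plane) (t : ℝ), 2 < t →
        (∀ᵐ p : PlanarSchrodinger.Plane × PlanarSchrodinger.Plane,
          IntegrableOn (PlanarSchrodinger.stoneIntegrand V χ K t x y p) (Ioi 0)) ∧
        Integrable (PlanarSchrodinger.stoneInner V χ K t x y) ∧
        ‖(∫ p, PlanarSchrodinger.stoneInner V χ K t x y p) - 1 / (4 * (t : ℂ))‖ ≤
          C * (Real.sqrt (PlanarSchrodinger.weight x * PlanarSchrodinger.weight y)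
                / (t * Real.log t ^ 2)
            + PlanarSchrodinger.bracket x ^ (1 / 2 + α + ε)
                * PlanarSchrodinger.bracket y ^ (1 / 2 + α + ε) / t ^ (1 + α)) := by
  obtain ⟨δ, hδ, A₀, hA₀⟩ := hdecay
  set e := 3 / 2 + α + δ with he
  have hexp : -(3 / 2) - α - δ = -e := by rw [he]; ring
  rw [hexp] at hA₀
  obtain ⟨A, hA, hAv⟩ := exists_vRoot_le (by positivity) hA₀
  have hsq := integrable_vRoot_sq hV (by linarith) hAv
  have hN := normOne_pos hV0 hsq
  have hvR : MemLp (fun x => vRoot V x) 2 volume :=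
    (memLp_two_iff_integrable_sq (measurable_vRoot hV).aestronglyMeasurable).mpr hsq
  have hv : MemLp (fun x => (vRoot V x : ℂ)) 2 volume := hvR.ofReal
  obtain ⟨K₀, hK₀⟩ := exists_isKernel_opS hv
  refine ⟨⟨K₀, hK₀⟩, ?_⟩
  obtain ⟨lam₀, hlam₀, hmain⟩ := exists_resolventIntegrand_estimate hN hα0 hα.le
  refine ⟨lam₀, hlam₀, fun lam₁ hlam₁ hle χ hχ ε hε => ?_⟩
  obtain ⟨C₀, hC₀, hpt⟩ := hmain lam₁ hle hlam₁ χ hχ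
  obtain ⟨C₁, hC₁, hL⟩ := exists_integral_logFactor_le hV (by linarith) hAv
  -- The decay of `v` permits only a loss smaller than `δ`. For larger `ε` the estimate follows by
  -- monotonicity, since `bracket` is at least `1`.
  set ε' := min ε (δ / 2) with hε'
  have hε'0 : 0 < ε' := lt_min hε (by linarith)
  have hε'δ : ε' < δ := (min_le_right _ _).trans_lt (by linarith)
  obtain ⟨C₂, hC₂, hG⟩ := exists_integral_growthFactor_le hV hα0.le (by linarith) hε'0
    (by linarith) hAv
  -- The constant must precede the kernel `K`, so it uses the norm of the fixed kernel `K₀`; the two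
  -- norms agree by uniqueness.
  refine ⟨C₀ * ((C₁ + C₂) * √(∫ p, ‖K₀ p‖ ^ 2)), fun K hK x y t ht => ?_⟩
  have hKK : ∫ p, ‖K p‖ ^ 2 = ∫ p, ‖K₀ p‖ ^ 2 := by
    refine integral_congr_ae ?_
    filter_upwards [hK.ae_eq hK₀] with p hp
    rw [hp]
  have ht0 : 0 < t := by linarith
  have hlt : 0 < Real.log t := Real.log_pos (by linarith)
  have htc : (t : ℂ) ≠ 0 := by exact_mod_cast ht0.ne'
  have hNc : (normOne V : ℂ) ≠ 0 := by exact_mod_cast hN.ne'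
  have hae := ae_ne_fst_and_ne_snd x y
  set W : Plane × Plane → ℂ := fun p => (vRoot V p.1 : ℂ) * K p * vRoot V p.2 with hW
  set J : Plane × Plane → ℂ := fun p => ∫ l in Ioi 0, resolventIntegrand V χ t x y p l with hJ
  set c : ℂ := 1 / (4 * t * normOne V) with hc
  have hWint : Integrable W := integrable_vRoot_kernel_vRoot hv hK
  have hWval : ∫ p, W p = normOne V := integral_vRoot_kernel_vRoot hv hN.ne' hK
  have hJmeas : AEStronglyMeasurable J volume :=
    (measurable_resolventIntegrand V hχ.smooth.continuous t x
      y).stronglyMeasurable.integral_prod_right.aestronglyMeasurable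
  obtain ⟨iL, bL⟩ := integral_kernel_weight_le hV hK.1 measurable_logFactor
    (fun r _ => zero_le_one.trans (one_le_logFactor r)) hC₁ (fun x => sq_nonneg _) hL x y
  obtain ⟨iG, bG⟩ := integral_kernel_weight_le hV hK.1 (measurable_growthFactor α)
    (fun r hr => growthFactor_nonneg α hr) hC₂ (fun x => sq_nonneg _) hG x y
  set B : Plane × Plane → ℝ := fun p =>
    C₀ / (t * Real.log t ^ 2) * (logFactor ‖x - p.1‖ * logFactor ‖p.2 - y‖ * ‖W p‖)
      + C₀ / t ^ (1 + α) * (growthFactor α ‖x - p.1‖ * growthFactor α ‖p.2 - y‖ * ‖W p‖) with hB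
  have hBint : Integrable B := (iL.const_mul _).add (iG.const_mul _)
  have hbound : ∀ᵐ p, ‖(J p - c) * W p‖ ≤ B p := by
    filter_upwards [hae] with p hp
    have h := (hpt x y p hp.1 hp.2 t ht).2
    rw [norm_mul]
    calc ‖J p - c‖ * ‖W p‖ ≤ C₀ * (logFactor ‖x - p.1‖ * logFactor ‖p.2 - y‖
          / (t * Real.log t ^ 2) + growthFactor α ‖x - p.1‖ * growthFactor α ‖p.2 - y‖
          / t ^ (1 + α)) * ‖W p‖ := by gcongr
      _ = B p := by rw [hB]; ring
  have hdiff : Integrable fun p => (J p - c) * W p :=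
    hBint.mono' ((hJmeas.sub aestronglyMeasurable_const).mul hWint.1) hbound
  -- The constant `c` is split off pointwise: its integral against `W` is exactly `1/(4t)`, and the
  -- rest is dominated by `B`. This decomposition also gives integrability of the inner integral.
  have hinner : stoneInner V χ K t x y = fun p => (J p - c) * W p + c * W p := by
    ext p
    rw [stoneInner_eq]
    ring
  refine ⟨?_, ?_, ?_⟩
  · filter_upwards [hae] with p hp
    have h := (hpt x y p hp.1 hp.2 t ht).1.mul_const (W p)
    refine h.congr (Filter.Eventually.of_forall fun l => ?_)
    exact (stoneIntegrand_eq V χ K t x y p l).symm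
  · rw [hinner]
    exact hdiff.add (hWint.const_mul c)
  · have hval : (∫ p, stoneInner V χ K t x y p) - 1 / (4 * (t : ℂ)) = ∫ p, (J p - c) * W p := by
      have hcN : c * (normOne V : ℂ) = 1 / (4 * (t : ℂ)) := by
        rw [hc]
        field_simp
      rw [hinner, integral_add hdiff (hWint.const_mul c), integral_const_mul, hWval, hcN,
        add_sub_cancel_right]
    have hbr : ∀ z : Plane, bracket z ^ (1 / 2 + α + ε') ≤ bracket z ^ (1 / 2 + α + ε) := fun z =>
      Real.rpow_le_rpow_of_exponent_le (one_le_bracket z) (by linarith [min_le_left ε (δ / 2)])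
    have hb0 : ∀ z : Plane, 0 ≤ bracket z := fun z => zero_le_one.trans (one_le_bracket z)
    have hGs : √((bracket x ^ (1 / 2 + α + ε')) ^ 2 * (bracket y ^ (1 / 2 + α + ε')) ^ 2)
        ≤ bracket x ^ (1 / 2 + α + ε) * bracket y ^ (1 / 2 + α + ε) := by
      have hx := hb0 x
      have hy := hb0 y
      rw [← mul_pow, Real.sqrt_sq (by positivity)]
      exact mul_le_mul (hbr x) (hbr y) (by positivity) (by positivity)
    rw [hval]
    refine (norm_integral_le_of_norm_le hBint hbound).trans ?_
    rw [hB, integral_add (iL.const_mul _) (iG.const_mul _), integral_const_mul,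
      integral_const_mul]
    set k := √(∫ p, ‖K₀ p‖ ^ 2)
    rw [hKK] at bL bG
    set X := √(weight x * weight y)
    set Y := bracket x ^ (1 / 2 + α + ε) * bracket y ^ (1 / 2 + α + ε)
    have hY0 : 0 ≤ Y := (Real.sqrt_nonneg _).trans hGs
    have hk0 : 0 ≤ k := Real.sqrt_nonneg _
    have hX0 : 0 ≤ X := Real.sqrt_nonneg _
    have hLfin := mul_le_mul_of_nonneg_left bL
      (by positivity : 0 ≤ C₀ / (t * Real.log t ^ 2))
    have hGfin := mul_le_mul_of_nonneg_left
      (bG.trans (mul_le_mul_of_nonneg_left hGs (by positivity)))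
      (by positivity : 0 ≤ C₀ / t ^ (1 + α))
    refine (add_le_add hLfin hGfin).trans ?_
    have e1 : 0 ≤ C₀ * (C₂ * k) * (X / (t * Real.log t ^ 2)) := by positivity
    have e2 : 0 ≤ C₀ * (C₁ * k) * (Y / t ^ (1 + α)) := by positivity
    calc C₀ / (t * Real.log t ^ 2) * (C₁ * k * X) + C₀ / t ^ (1 + α) * (C₂ * k * Y)
        = C₀ * (C₁ * k) * (X / (t * Real.log t ^ 2)) + C₀ * (C₂ * k) * (Y / t ^ (1 + α)) := by
          ring
      _ ≤ C₀ * (C₁ * k) * (X / (t * Real.log t ^ 2)) + C₀ * (C₂ * k) * (Y / t ^ (1 + α))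
          + (C₀ * (C₂ * k) * (X / (t * Real.log t ^ 2))
            + C₀ * (C₁ * k) * (Y / t ^ (1 + α))) := by linarith
      _ = C₀ * ((C₁ + C₂) * k) * (X / (t * Real.log t ^ 2) + Y / t ^ (1 + α)) := by ring
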